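/- **Proposition 7.3.** Let $X$ be a smooth irreducible complex projective variety of dimension $n\ge 1$ with a fixed ample line bundle $H$, and let $\mathcal D=\{D_1,\dots,D_k\}$ ($k \ge 0$) be an arrangement of pairwise distinct smooth irreducible divisors on $X$ with simple normal crossings. Let $T_X(-\log\mathcal D)\subseteq T_X$ be the locally free sheaf of vector fields tangent to $\mathcal D$. A $\mathcal D$-logarithmic co-Higgs bundle is a pair $(\mathcal E,\Phi)$ consisting of a vector bundle $\mathcal E$ on $X$ and a morphism $\Phi:\mathcal E\to\mathcal E\otimes T_X(-\log\mathcal D)$ with $\Phi\wedge\Phi=0$. For a non-zero coherent subsheaf $\mathcal F\subseteq\mathcal E$ put $\deg\mathcal F=c_1(\mathcal F)\cdot H^{n-1}$ and $\mu(\mathcal F)=\deg\mathcal F/\operatorname{rank}\mathcal F$. The bundle $\mathcal E$ is *semistable* if $\mu(\mathcal F)\le\mu(\mathcal E)$ for every coherent subsheaf $0\subsetneq\mathcal F\subsetneq\mathcal E$; the pair $(\mathcal E,\Phi)$ is *semistable* if this inequality holds for every such $\mathcal F$ with $\Phi(\mathcal F)\subseteq\mathcal F\otimes T_X(-\log\mathcal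 D)$. Let $\mathcal S$ be the set of pairs $(\mathcal F,\mathcal G)$ of coherent subsheaves $0\subsetneq\mathcal F\subseteq\mathcal G\subseteq\mathcal E$ with $\Phi(\mathcal F)\subseteq\mathcal G\otimes T_X(-\log\mathcal D)$. For real $\alpha\ge 0$ and $(\mathcal F,\mathcal G)\in\mathcal S$ put $$\mu_\alpha(\mathcal F,\mathcal G)=\mu(\mathcal F)+\alpha\,\frac{\operatorname{rank}\mathcal F}{\operatorname{rank}\mathcal G},$$ and call $(\mathcal E,\Phi)$ *$\mu_\alpha$-semistable* if $\mu_\alpha(\mathcal F,\mathcal G)\le\mu_\alpha(\mathcal E,\mathcal E)$ for all $(\mathcal F,\mathcal G)\in\mathcal S\setminus\{(\mathcal E,\mathcal E)\}$. Let $(\mathcal E,\Phi)$ be a $\mathcal D$-logarithmic co-Higgs bundle on $X$ such that $\mathcal E$ is not semistable. Then there exist real numbers $\beta>0$ and $\gamma>0$ such that 1. $(\mathcal E,\Phi)$ is not $\mu_\alpha$-semistable for any $\alpha$ with $0\le\alpha<\beta$; 2. if $(\mathcal E,\Phi)$ is semistable, then it is $\mu_\alpha$-semistable for all $\alpha>\gamma$.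 -/

import Mathlib

open CategoryTheory AlgebraicGeometry TensorProduct
open scoped Nat

noncomputable section

namespace LogCoHiggs

/-- The base of all varieties: the spectrum of the field of complex numbers. -/
abbrev SpecC : Scheme.{0} := Spec (CommRingCat.of ℂ)

/-! ### The affine opens and the function field of an integral complex scheme -/

/-- The non-empty affine open subsets of `X`. -/
def AffOpen (X : Scheme.{0}) : Type := {U : X.Opens // IsAffineOpen U ∧ Nonempty U}

namespace AffOpen

variable {X : Scheme.{0}}

/-- The underlying open subset. -/
abbrev op (U : AffOpen X) : X.Opens := U.1

/-- The same subset as an element of the type of all affine opens. -/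
abbrev aff (U : AffOpen X) : X.affineOpens := ⟨U.1, U.2.1⟩

instance (U : AffOpen X) : Nonempty U.op := U.2.2

end AffOpen

section Base

variable {X : Scheme.{0}}

/-- The restriction homomorphism `𝒪(U) → 𝒪(V)` for `V ⊆ U`. -/
abbrev resO {U V : X.Opens} (h : V ≤ U) : Γ(X, U) →+* Γ(X, V) :=
  (X.presheaf.map (homOfLE h).op).hom

/-- The restriction map `E(U) → E(V)` of a sheaf of modules, for `V ⊆ U`. -/
def res (E : X.Modules) {U V : X.Opens} (h : V ≤ U) : Γ(E, U) →ₛₗ[resO h] Γ(E, V) where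
  toFun s := E.presheaf.map (homOfLE h).op s
  map_add' := map_add _
  map_smul' r s := Scheme.Modules.map_smul E (homOfLE h) r s

/-- The structure of a complex algebra on the ring of functions on an open subset. -/
instance algebraSections [X.Over SpecC] (U : X.Opens) : Algebra ℂ Γ(X, U) :=
  (((X ↘ SpecC).appLE ⊤ U (fun _ _ => trivial)).hom.comp
    (Scheme.ΓSpecIso (CommRingCat.of ℂ)).inv.hom).toAlgebra

theorem resO_algebraMap [X.Over SpecC] {U V : X.Opens} (h : V ≤ U) (c : ℂ) :
    resO h (algebraMap ℂ Γ(X, U) c) = algebraMap ℂ Γ(X, V) c := by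
  have e := Scheme.Hom.appLE_map (X ↘ SpecC) (U := ⊤) (V := U) (fun _ _ => trivial) (homOfLE h).op
  exact congrArg (fun q => q.hom ((Scheme.ΓSpecIso (CommRingCat.of ℂ)).inv.hom c)) e

variable [IsIntegral X]

instance nonemptyTop : Nonempty (⊤ : X.Opens) := ⟨⟨genericPoint X, trivial⟩⟩

/-- The structure of a complex algebra on the function field. -/
instance algebraFunctionField [X.Over SpecC] : Algebra ℂ X.functionField :=
  ((algebraMap Γ(X, (⊤ : X.Opens)) X.functionField).comp
    (algebraMap ℂ Γ(X, (⊤ : X.Opens)))).toAlgebra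

theorem algebraMap_resO {U V : X.Opens} [Nonempty U] [Nonempty V] (h : V ≤ U) (f : Γ(X, U)) :
    algebraMap Γ(X, V) X.functionField (resO h f) = algebraMap Γ(X, U) X.functionField f :=
  X.presheaf.germ_res_apply (homOfLE h) _ _ f

instance towerFunctionField [X.Over SpecC] (U : X.Opens) [Nonempty U] :
    IsScalarTower ℂ Γ(X, U) X.functionField :=
  IsScalarTower.of_algebraMap_eq fun c => by
    rw [← resO_algebraMap (le_top : U ≤ ⊤), algebraMap_resO]
    rfl

instance smulCommFunctionField [X.Over SpecC] (U : X.Opens) [Nonempty U] :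
    SMulCommClass ℂ Γ(X, U) X.functionField :=
  ⟨fun c a k => by simp only [Algebra.smul_def]; ring⟩

variable (X) in
/-- The ring `𝒪(U)`, regarded as a subalgebra of the function field. -/
def ring [X.Over SpecC] (U : AffOpen X) : Subalgebra ℂ X.functionField :=
  (IsScalarTower.toAlgHom ℂ Γ(X, U.op) X.functionField).range

end Base

/-! ### Vector bundles and coherent subsheaves -/

section Sheaves

variable {X : Scheme.{0}}

/-- `E` is locally free of rank `r`: every point has an open neighbourhood `U` over which `E` has a
frame, i.e. `r` sections whose restrictions form a basis of `E(V)` over `𝒪(V)` for every open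
`V ⊆ U` (equivalently, they define an isomorphism from the free module of rank `r` to `E|_U`). -/
def IsLocallyFreeOfRank (E : X.Modules) (r : ℕ) : Prop :=
  ∀ x : X, ∃ U : X.Opens, x ∈ U ∧ ∃ e : Fin r → Γ(E, U), ∀ (V : X.Opens) (h : V ≤ U),
    LinearIndependent Γ(X, V) (fun i => res E h (e i)) ∧
      Submodule.span Γ(X, V) (Set.range fun i => res E h (e i)) = ⊤

/-- `E` is a vector bundle, i.e. locally free of some finite rank (which is constant, as this is
used on connected schemes). -/
def IsVectorBundle (E : X.Modules) : Prop := ∃ r : ℕ, IsLocallyFreeOfRank E r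

/-- `L` is a line bundle. -/
def IsLineBundle (L : X.Modules) : Prop := IsLocallyFreeOfRank L 1

/-- A family of submodules `F(U) ⊆ E(U)`, one for every non-empty affine open `U`. -/
abbrev SubmoduleFamily (E : X.Modules) : Type :=
  ∀ U : AffOpen X, Submodule Γ(X, U.op) Γ(E, U.op)

/-- The family `F` is a coherent subsheaf of the vector bundle `E` on a Noetherian scheme: passing
from an affine open `U` to a principal open subset `V = D(f)` of it, the module `F(V)` is generated
by the restrictions of the elements of `F(U)`, i.e. `F(D(f)) = F(U)_f`. (This is how
`Scheme.IdealSheafData` describes the quasi-coherent ideals. The finite generation of `F(U)` is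
automatic, since `E(U)` is finitely generated and `𝒪(U)` is Noetherian.) -/
def IsCoherentSubsheaf {E : X.Modules} (F : SubmoduleFamily E) : Prop :=
  ∀ (U V : AffOpen X) (f : Γ(X, U.op)) (h : V.op = X.basicOpen f),
    F V = Submodule.span Γ(X, V.op) (res E (h.trans_le (X.basicOpen_le f)) '' (F U : Set Γ(E, U.op)))

variable [IsIntegral X]

/-- The fibre `E_η` of `E` at the generic point. -/
abbrev GenericFibre (E : X.Modules) : Type := E.presheaf.stalk (genericPoint X)

/-- The generic fibre is a vector space over the function field. -/
instance moduleGenericFibre (E : X.Modules) : Module X.functionField (GenericFibre E) :=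
  PresheafOfModules.instModuleCarrierStalkCommRingCatCarrierAbPresheafOpensCarrier
    (R := X.presheaf) E.val (genericPoint X)

/-- The germ at the generic point of a section over a non-empty affine open. -/
def germ (E : X.Modules) (U : AffOpen X) (s : Γ(E, U.op)) : GenericFibre E :=
  E.presheaf.germ U.op (genericPoint X)
    (((genericPoint_spec X).mem_open_set_iff U.op.isOpen).mpr (by simpa using U.2.2)) s

theorem germ_smul (E : X.Modules) (U : AffOpen X) (f : Γ(X, U.op)) (s : Γ(E, U.op)) :
    germ E U (f • s) = algebraMap Γ(X, U.op) X.functionField f • germ E U s :=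
  PresheafOfModules.germ_smul (R := X.presheaf) E.val (genericPoint X) U.op
    (((genericPoint_spec X).mem_open_set_iff U.op.isOpen).mpr (by simpa using U.2.2)) f s

/-- The rank of a subsheaf `F`: the dimension of its generic fibre, a subspace of `E_η`. -/
def rank {E : X.Modules} (F : SubmoduleFamily E) : ℕ :=
  Module.finrank X.functionField
    (Submodule.span X.functionField {v : GenericFibre E | ∃ U, ∃ s ∈ F U, germ E U s = v})

end Sheaves

/-! ### Twists, global sections, ampleness and the degree

A torsion-free quasi-coherent sheaf on an integral scheme is a subsheaf of the constant sheaf given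
by its generic fibre `V`, hence is given by an `𝒪(U)`-submodule of `V` for every non-empty affine
open `U`, and its global sections are the elements of `V` that lie in all these submodules. -/

section Degree

variable {X : Scheme.{0}} [X.Over SpecC] [IsIntegral X]

/-- The complex vector space of global sections of a torsion-free sheaf with generic fibre `V`. -/
def globalSections {V : Type} [AddCommGroup V] [Module X.functionField V]
    (L : ∀ U : AffOpen X, Submodule (ring X U) V) :
    letI := Module.compHom V (algebraMap ℂ X.functionField)
    Submodule ℂ V :=
  letI := Module.compHom V (algebraMap ℂ X.functionField)
  { carrier := {v | ∀ U, v ∈ L U}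
    add_mem' := fun ha hb U => add_mem (ha U) (hb U)
    zero_mem' := fun _ => zero_mem _
    smul_mem' := fun c _ hv U => (L U).smul_mem (algebraMap ℂ (ring X U) c) (hv U) }

/-- The dimension `h⁰` of the space of global sections. -/
def h0 {V : Type} [AddCommGroup V] [Module X.functionField V]
    (L : ∀ U : AffOpen X, Submodule (ring X U) V) : ℕ :=
  letI := Module.compHom V (algebraMap ℂ X.functionField)
  Module.finrank ℂ (globalSections L)

/-- The tensor power `H^m` of a line bundle `H`, inside the `m`-th tensor power of `H_η`. -/
def linePow (H : X.Modules) (m : ℕ) (U : AffOpen X) :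
    Submodule (ring X U) (⨂[X.functionField]^m (GenericFibre H)) :=
  Submodule.span _ {v | ∃ t : Fin m → Γ(H, U.op),
    PiTensorProduct.tprod X.functionField (fun i => germ H U (t i)) = v}

/-- The twist `F(m) = F ⊗ H^m` of a subsheaf `F` of a vector bundle `E`, inside
`E_η ⊗ H_η^m`. -/
def twist {E : X.Modules} (F : SubmoduleFamily E) (H : X.Modules) (m : ℕ) (U : AffOpen X) :
    Submodule (ring X U)
      (GenericFibre E ⊗[X.functionField] (⨂[X.functionField]^m (GenericFibre H))) :=
  Submodule.span _ {v | ∃ s ∈ F U, ∃ t : Fin m → Γ(H, U.op),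
    germ E U s ⊗ₜ[X.functionField]
      PiTensorProduct.tprod X.functionField (fun i => germ H U (t i)) = v}

/-- The line bundle `H` on the quasi-compact scheme `X` is ample: every point lies in an affine open
set of the form `X_σ`, where `σ` is a global section of some power `H^m` with `m > 0` and `X_σ` is
the set of points near which `σ` generates `H^m`. -/
def IsAmple (H : X.Modules) : Prop :=
  ∀ x : X, ∃ m : ℕ, 0 < m ∧ ∃ σ : ⨂[X.functionField]^m (GenericFibre H),
    (∀ U, σ ∈ linePow H m U) ∧ ∃ W : X.Opens, IsAffineOpen W ∧ x ∈ W ∧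
      ∀ y : X, y ∈ W ↔ ∃ U : AffOpen X, y ∈ U.op ∧
        linePow H m U = Submodule.span (ring X U) {σ}

/-- The degree of a coherent subsheaf `F` of a vector bundle on an `n`-dimensional projective
variety `X` (`n ≥ 1`), with respect to the ample line bundle `H`:
`deg F = α_{n-1}(F) - rank(F) α_{n-1}(𝒪_X)`, where `∑ α_i(F) mⁱ / i!` is the Hilbert polynomial of
`F`, i.e. the polynomial in `m` which equals `χ(F(m))` for all `m` and `h⁰(F(m))` for `m ≫ 0`. As
`α_n(F) = rank(F) α_n(𝒪_X)`, this is the limit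
`lim (n-1)! (h⁰(F(m)) - rank(F) h⁰(𝒪_X(m))) / m^(n-1)` for `m → ∞`. For smooth `X` it is the
intersection number `c₁(F) · H^(n-1)`, by the Riemann–Roch theorem. -/
def degree (n : ℕ) (H : X.Modules) {E : X.Modules} (F : SubmoduleFamily E) : ℝ :=
  Filter.limsup (fun m : ℕ => ((n - 1)! : ℝ) *
    ((h0 (twist F H m) : ℝ) - (rank F : ℝ) * (h0 (linePow H m) : ℝ)) / (m : ℝ) ^ (n - 1))
    Filter.atTop

/-- The slope of a non-zero subsheaf. -/
def slope (n : ℕ) (H : X.Modules) {E : X.Modules} (F : SubmoduleFamily E) : ℝ :=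
  degree n H F / rank F

/-- The vector bundle `E` is (slope) semistable: `μ(F) ≤ μ(E)` for every coherent subsheaf
`0 ⊊ F ⊊ E`. -/
def IsSemistable (n : ℕ) (H E : X.Modules) : Prop :=
  ∀ F : SubmoduleFamily E, IsCoherentSubsheaf F → F ≠ ⊥ → F ≠ ⊤ →
    slope n H F ≤ slope n H (⊤ : SubmoduleFamily E)

end Degree

/-! ### Logarithmic vector fields and logarithmic co-Higgs fields -/

section Log

variable {X : Scheme.{0}} [X.Over SpecC] [IsIntegral X] {k : ℕ}

/-- The ideal sheaves `D 1, …, D k` define an arrangement of pairwise distinct smooth irreducible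
divisors with simple normal crossings on the smooth variety `X` of dimension `n`: near every point
`x` there are étale local coordinates `f 1, …, f n` such that the divisors through `x` are
coordinate hyperplanes `f j = 0`, with different `j` for different divisors. -/
structure IsSNCArrangement (n : ℕ) (D : Fin k → X.IdealSheafData) : Prop where
  injective : Function.Injective D
  integral : ∀ i, IsIntegral (D i).subscheme
  smooth : ∀ i, Smooth ((D i).subschemeι ≫ (X ↘ SpecC))
  coordinates : ∀ x : X, ∃ U : X.affineOpens, x ∈ U.1 ∧ ∃ f : Fin n → Γ(X, U.1),
    (∃ b : Module.Basis (Fin n) Γ(X, U.1) (Ω[Γ(X, U.1)⁄ℂ]),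
      ∀ j, b j = KaehlerDifferential.D ℂ Γ(X, U.1) (f j)) ∧
    ∃ c : Fin k → Fin n, Set.InjOn c {i | x ∈ (D i).support} ∧
      ∀ i, (x ∈ (D i).support → (D i).ideal U = Ideal.span {f (c i)}) ∧
        (x ∉ (D i).support → (D i).ideal U = ⊤)

/-- The sheaf `T_X(-log D)` of logarithmic vector fields along `D`. A vector field on `U` is a
derivation of the function field that preserves the subring `𝒪(V)` for every `V ⊆ U`; it is
logarithmic if it is tangent to each of the divisors, i.e. preserves their ideals. -/
def logT (D : Fin k → X.IdealSheafData) (U : AffOpen X) :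
    Submodule Γ(X, U.op) (Derivation ℂ X.functionField X.functionField) where
  carrier := {δ | ∀ V : AffOpen X, V.op ≤ U.op →
    (∀ f : Γ(X, V.op), ∃ g : Γ(X, V.op),
      δ (algebraMap Γ(X, V.op) X.functionField f) = algebraMap Γ(X, V.op) X.functionField g) ∧
    ∀ i, ∀ f ∈ (D i).ideal V.aff, ∃ g ∈ (D i).ideal V.aff,
      δ (algebraMap Γ(X, V.op) X.functionField f) = algebraMap Γ(X, V.op) X.functionField g}
  add_mem' := by
    intro a b ha hb V hV
    refine ⟨fun f => ?_, fun i f hf => ?_⟩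
    · obtain ⟨g, hg⟩ := (ha V hV).1 f
      obtain ⟨g', hg'⟩ := (hb V hV).1 f
      exact ⟨g + g', by rw [Derivation.add_apply, hg, hg', map_add]⟩
    · obtain ⟨g, hgm, hg⟩ := (ha V hV).2 i f hf
      obtain ⟨g', hgm', hg'⟩ := (hb V hV).2 i f hf
      exact ⟨g + g', add_mem hgm hgm', by rw [Derivation.add_apply, hg, hg', map_add]⟩
  zero_mem' := fun V _ => ⟨fun _ => ⟨0, by simp⟩, fun _ _ _ => ⟨0, zero_mem _, by simp⟩⟩
  smul_mem' := by
    intro c δ hδ V hV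
    refine ⟨fun f => ?_, fun i f hf => ?_⟩
    · obtain ⟨g, hg⟩ := (hδ V hV).1 f
      exact ⟨resO hV c * g, by
        rw [Derivation.smul_apply, hg, map_mul, algebraMap_resO, Algebra.smul_def]⟩
    · obtain ⟨g, hgm, hg⟩ := (hδ V hV).2 i f hf
      exact ⟨resO hV c * g, Ideal.mul_mem_left _ _ hgm, by
        rw [Derivation.smul_apply, hg, map_mul, algebraMap_resO, Algebra.smul_def]⟩

/-- The restriction map of `T_X(-log D)` for `V ⊆ U`. -/
def resT (D : Fin k → X.IdealSheafData) {U V : AffOpen X} (h : V.op ≤ U.op) :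
    logT D U →ₛₗ[resO h] logT D V where
  toFun δ := ⟨δ.1, fun W hW => δ.2 W (hW.trans h)⟩
  map_add' _ _ := rfl
  map_smul' c δ := Subtype.ext <| Derivation.ext fun x => by
    change c • δ.1 x = resO h c • δ.1 x
    rw [Algebra.smul_def, Algebra.smul_def, algebraMap_resO]

/-- For an `R`-linear map `Φ : E → E ⊗ T`, the map `Φ ∧ Φ : E → E ⊗ Λ²T`, with `Λ²T` regarded as the
degree two part of the exterior algebra of `T`: it is the composition of `Φ`, of
`Φ ⊗ 1 : E ⊗ T → (E ⊗ T) ⊗ T`, and of the exterior multiplication of the two factors `T`. -/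
def wedgeSquare {R E T : Type} [CommRing R] [AddCommGroup E] [Module R E] [AddCommGroup T]
    [Module R T] (Φ : E →ₗ[R] E ⊗[R] T) : E →ₗ[R] E ⊗[R] ExteriorAlgebra R T :=
  (LinearMap.lTensor E (LinearMap.mul' R (ExteriorAlgebra R T) ∘ₗ
      TensorProduct.map (ExteriorAlgebra.ι R) (ExteriorAlgebra.ι R))) ∘ₗ
    (TensorProduct.assoc R E T T).toLinearMap ∘ₗ LinearMap.rTensor T Φ ∘ₗ Φ

/-- A logarithmic co-Higgs field on `E`: a morphism of sheaves `Φ : E → E ⊗ T_X(-log D)`, given on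
the non-empty affine opens and compatible with restriction, with `Φ ∧ Φ = 0`. -/
structure LogCoHiggsField (D : Fin k → X.IdealSheafData) (E : X.Modules) where
  app : ∀ U : AffOpen X, Γ(E, U.op) →ₗ[Γ(X, U.op)] Γ(E, U.op) ⊗[Γ(X, U.op)] logT D U
  naturality : ∀ (U V : AffOpen X) (h : V.op ≤ U.op) (s : Γ(E, U.op)),
    app V (res E h s) = TensorProduct.map (res E h) (resT D h) (app U s)
  integrable : ∀ U : AffOpen X, wedgeSquare (app U) = 0

variable {D : Fin k → X.IdealSheafData} {E : X.Modules}

/-- The condition `Φ(F) ⊆ G ⊗ T_X(-log D)` for subsheaves `F` and `G` of `E`. -/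
def MapsInto (Φ : LogCoHiggsField D E) (F G : SubmoduleFamily E) : Prop :=
  ∀ U : AffOpen X, (F U).map (Φ.app U) ≤
    LinearMap.range (LinearMap.rTensor (logT D U) (G U).subtype)

/-- The co-Higgs bundle `(E, Φ)` is semistable: `μ(F) ≤ μ(E)` for every coherent subsheaf
`0 ⊊ F ⊊ E` with `Φ(F) ⊆ F ⊗ T_X(-log D)`. -/
def IsCoHiggsSemistable (n : ℕ) (H : X.Modules) (Φ : LogCoHiggsField D E) : Prop :=
  ∀ F : SubmoduleFamily E, IsCoherentSubsheaf F → F ≠ ⊥ → F ≠ ⊤ → MapsInto Φ F F →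
    slope n H F ≤ slope n H (⊤ : SubmoduleFamily E)

/-- The set `𝒮(E, Φ)` of pairs of coherent subsheaves `0 ⊊ F ⊆ G ⊆ E` with
`Φ(F) ⊆ G ⊗ T_X(-log D)`. -/
def pairs (Φ : LogCoHiggsField D E) : Set (SubmoduleFamily E × SubmoduleFamily E) :=
  {p | IsCoherentSubsheaf p.1 ∧ IsCoherentSubsheaf p.2 ∧ p.1 ≠ ⊥ ∧ p.1 ≤ p.2 ∧
    MapsInto Φ p.1 p.2}

/-- The slope `μ_α(F, G) = μ(F) + α · rank F / rank G`. -/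
def muAlpha (n : ℕ) (H : X.Modules) (α : ℝ) (F G : SubmoduleFamily E) : ℝ :=
  slope n H F + α * ((rank F : ℝ) / (rank G : ℝ))

/-- The pair `(E, Φ)` is `μ_α`-semistable: `μ_α(F, G) ≤ μ_α(E, E)` for all pairs `(F, G) ≠ (E, E)`
in `𝒮(E, Φ)`. -/
def IsMuSemistable (n : ℕ) (H : X.Modules) (Φ : LogCoHiggsField D E) (α : ℝ) : Prop :=
  ∀ p ∈ pairs Φ, p ≠ (⊤, ⊤) → muAlpha n H α p.1 p.2 ≤ muAlpha n H α ⊤ (⊤ : SubmoduleFamily E)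

end Log

end LogCoHiggs

end

/-! For small `α`, a subsheaf `F` with `μ(F) > μ(E)` already destabilizes: the pair `(F, E)` belongs
to `𝒮` whatever `Φ` is, so `β = μ(F) - μ(E)` works (`not_isMuSemistable`).

For large `α`, consider a pair `(F, G)` and let `r = rank E`. If `rank F < rank G`, the quotient of
the ranks is at most `1 - 1/r`, so the pair loses at least `α/r` against `(E, E)`. The degrees of
all coherent subsheaves of `E` are bounded above by one constant `C ≥ 0` (`exists_degree_le`), so
any `α ≥ r (C - μ(E))` suffices. If `rank F = rank G`, the `α`-terms cancel and semistability of
`(E, Φ)` must be used, although `F` itself need not be `Φ`-invariant. But `F` and `G` have the same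
generic fibre, hence the same saturation, and this saturation is `Φ`-invariant because `T_X(-log D)`
is flat and `E` modulo the saturation is torsion-free (`mapsInto_saturation`). Saturating does not
lower the degree (`degree_le_of_rank_eq`), so `μ(F) ≤ μ(E)`.

Most of the work concerns the degree, which is a limsup of expressions in `h⁰`. One needs `h⁰(F(m))
- rank F · h⁰(H^m) = O(m^(n-1))`, with an upper bound uniform in `F`. Clearing denominators embeds
`H⁰(F(m))` into `rank F` copies of `H⁰(H^(m+a))`, with `a` independent of `F`, and embeds `rank F`
copies of `H⁰(H^m)` into `H⁰(F(m+a))`, with `a` depending on `F`. So everything reduces to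
`h⁰(H^(m+a)) - h⁰(H^m) = O(m^(n-1))`.

This estimate is obtained without cohomology, by Noether normalization. A trivialization of `H_η`
turns the section ring of `H` into a graded subring `⨁ S_m t^m` of `K[t]`, where `K` is the function
field. Ampleness gives finitely many sections of one power of `H` without common zeros. As `X` is
proper, every valuation ring of `K` over `ℂ` has a centre on `X`, where one of these sections has
minimal value. Hence all sections are integral over the polynomials in these parameters. Linear
projections make the parameters algebraically independent, so there are at most `n + 1` of them, and
the section ring is a finite module over a polynomial ring. Counting monomials then gives the
estimate (`IsNormalized.finrank_add_le`). -/

namespace LogCoHiggs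

/-! ### Noether normalization by linear projections, in terms of valuations -/

section GradedSubspaces

theorem eval₂_mul_of_isHomogeneous {ι k R : Type*} [CommRing k] [CommRing R] (f : k →+* R)
    {p : MvPolynomial ι k} {d : ℕ} (hp : p.IsHomogeneous d) (u : R) (x : ι → R) :
    p.eval₂ f (fun i => u * x i) = u ^ d * p.eval₂ f x := by
  rw [MvPolynomial.eval₂_eq, MvPolynomial.eval₂_eq, Finset.mul_sum]
  refine Finset.sum_congr rfl fun m hm => ?_
  have h := hp.degree_eq_sum_deg_support hm
  rw [Finset.prod_congr rfl fun i _ => mul_pow u (x i) (m i), Finset.prod_mul_distrib,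
    Finset.prod_pow_eq_pow_sum, h]
  ring

variable {k K : Type} [Field k] [Field K] [Algebra k K]

theorem ValuationSubring.mem_of_pow_mem (V : ValuationSubring K) {N : ℕ} (hN : 0 < N) {x : K}
    (h : x ^ N ∈ V) : x ∈ V := by
  rw [← V.valuation_le_one_iff] at h ⊢
  rw [map_pow] at h
  exact (pow_le_one_iff hN.ne').mp h

/-- Every valuation of `K` over `k` has a `σ j` of minimal value among the elements of `S N`, up to
taking powers. Geometrically: the `σ j` have no common zero on any complete model. -/
def Dominates {ι : Type} (S : ℕ → Submodule k K) (N : ℕ) (σ : ι → K) : Prop :=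
  ∀ V : ValuationSubring K, (∀ c : k, algebraMap k K c ∈ V) →
    ∃ j, σ j ≠ 0 ∧ ∀ m, ∀ s ∈ S m, s ^ N / σ j ^ m ∈ V

/-- Projection from a point `e` with `p(e) ≠ 0`. If no new element were minimal for `V`, then the
reductions of the ratios `σ i / σ j` to the residue field would form a multiple of `e`. The relation
`p` vanishes at this vector but not at `e`, so the vector is zero, although its `j`-th entry is `1`.
-/
theorem Dominates.exists_fewer [Infinite k] {S : ℕ → Submodule k K} {N l d : ℕ} (hN : 0 < N)
    {σ : Fin (l + 1) → K} (hσ : ∀ j, σ j ∈ S N) (h : Dominates S N σ)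
    {p : MvPolynomial (Fin (l + 1)) k} (hp : p.IsHomogeneous d) (hp0 : p ≠ 0)
    (hrel : MvPolynomial.aeval σ p = 0) :
    ∃ σ' : Fin l → K, (∀ j, σ' j ∈ S N) ∧ Dominates S N σ' := by
  -- The factor `X (Fin.last l)` ensures that the last coordinate of `c` is also nonzero, so that it
  -- can be scaled to `1`.
  obtain ⟨c, hc⟩ : ∃ c : Fin (l + 1) → k, MvPolynomial.eval c (p * MvPolynomial.X (Fin.last l)) ≠ 0 := by
    by_contra! hcon
    have : p * MvPolynomial.X (Fin.last l) = 0 := MvPolynomial.funext fun c => by simpa using hcon c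
    simp [hp0] at this
  simp only [map_mul, MvPolynomial.eval_X, ne_eq, mul_eq_zero, not_or] at hc
  set e : Fin (l + 1) → k := fun i => (c (Fin.last l))⁻¹ * c i with he
  have he1 : e (Fin.last l) = 1 := by simp [he, hc.2]
  have hpe : MvPolynomial.eval e p ≠ 0 := by
    have := eval₂_mul_of_isHomogeneous (RingHom.id k) hp (c (Fin.last l))⁻¹ c
    rw [MvPolynomial.eval₂_id, MvPolynomial.eval₂_id] at this
    rw [he, this]
    exact mul_ne_zero (pow_ne_zero _ (inv_ne_zero hc.2)) hc.1
  refine ⟨fun i => σ i.castSucc - e i.castSucc • σ (Fin.last l),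
    fun i => sub_mem (hσ _) (Submodule.smul_mem _ _ (hσ _)), fun V hV => ?_⟩
  obtain ⟨j, hj, hjm⟩ := h V hV
  by_contra! hcon
  -- A new element whose value is no larger than that of `σ j` would inherit the minimality of `σ
  -- j`.
  have hlt : ∀ i : Fin l,
      V.valuation ((σ i.castSucc - e i.castSucc • σ (Fin.last l)) / σ j) < 1 := by
    intro i
    by_contra! hge
    have hne : σ i.castSucc - e i.castSucc • σ (Fin.last l) ≠ 0 := by
      intro h0
      rw [h0] at hge
      simp at hge
    obtain ⟨m, s, hs, hns⟩ := hcon i hne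
    apply hns
    have h1 : σ j / (σ i.castSucc - e i.castSucc • σ (Fin.last l)) ∈ V := by
      rw [← V.valuation_le_one_iff, ← inv_div, map_inv₀]
      exact inv_le_one_of_one_le₀ hge
    have h2 := mul_mem (hjm m s hs) (pow_mem h1 m)
    rwa [div_pow, div_mul_div_cancel₀ (pow_ne_zero _ hj)] at h2
  have hmem : ∀ i, σ i / σ j ∈ V := fun i => by
    refine ValuationSubring.mem_of_pow_mem V hN ?_
    rw [div_pow]
    exact hjm N _ (hσ i)
  let f : k →+* V := (algebraMap k K).codRestrict V.toSubring hV
  let a : Fin (l + 1) → V := fun i => ⟨σ i / σ j, hmem i⟩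
  let π := IsLocalRing.residue V
  have hpa : p.eval₂ f a = 0 := by
    refine (map_eq_zero_iff V.subtype Subtype.val_injective).mp ?_
    have h1 : (V.subtype (p.eval₂ f a)) = p.eval₂ (algebraMap k K) (fun i => (σ j)⁻¹ * σ i) := by
      rw [MvPolynomial.hom_eval₂]
      congr 1
      funext i
      exact div_eq_inv_mul _ _
    rw [h1, eval₂_mul_of_isHomogeneous _ hp]
    rw [MvPolynomial.aeval_def] at hrel
    rw [hrel, mul_zero]
  have hπ : ∀ i, π (a i) = π (a (Fin.last l)) * π (f (e i)) := by
    intro i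
    refine Fin.lastCases (by simp [he1]) (fun i => ?_) i
    have h0 : π (a i.castSucc - a (Fin.last l) * f (e i.castSucc)) = 0 := by
      rw [IsLocalRing.residue_eq_zero_iff, ValuationSubring.valuation_lt_one_iff]
      convert hlt i using 2
      change σ i.castSucc / σ j - σ (Fin.last l) / σ j * algebraMap k K (e i.castSucc) = _
      rw [Algebra.smul_def]
      ring
    rwa [map_sub, map_mul, sub_eq_zero] at h0
  have hu : π (a (Fin.last l)) = 0 := by
    have h1 : p.eval₂ (π.comp f) (fun i => π (a (Fin.last l)) * π (f (e i))) = 0 := by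
      have := congrArg π hpa
      rw [MvPolynomial.hom_eval₂, map_zero] at this
      rw [← this]
      congr 1
      exact funext fun i => (hπ i).symm
    rw [eval₂_mul_of_isHomogeneous _ hp] at h1
    have h2 : p.eval₂ (π.comp f) (fun i => π (f (e i))) ≠ 0 := by
      have := MvPolynomial.hom_eval₂ p (RingHom.id k) (π.comp f) e
      rw [MvPolynomial.eval₂_id, RingHom.comp_id] at this
      exact fun h0 => hpe ((map_eq_zero (π.comp f)).mp (this.trans h0))
    exact eq_zero_of_pow_eq_zero ((mul_eq_zero.mp h1).resolve_right h2)
  have h1 := hπ j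
  rw [hu, zero_mul] at h1
  have : a j = 1 := Subtype.ext (div_self hj)
  rw [this, map_one] at h1
  exact one_ne_zero h1

theorem Dominates.exists_independent [Infinite k] {S : ℕ → Submodule k K} {N : ℕ} (hN : 0 < N)
    {l : ℕ} {σ : Fin l → K} (hσ : ∀ j, σ j ∈ S N) (h : Dominates S N σ) :
    ∃ (l' : ℕ) (σ' : Fin l' → K), (∀ j, σ' j ∈ S N) ∧ Dominates S N σ' ∧
      ∀ (p : MvPolynomial (Fin l') k) (d : ℕ), p.IsHomogeneous d →
        MvPolynomial.aeval σ' p = 0 → p = 0 := by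
  induction l with
  | zero =>
    refine ⟨0, σ, hσ, h, fun p d _ hp => ?_⟩
    rw [MvPolynomial.eq_C_of_isEmpty p, MvPolynomial.aeval_C, map_eq_zero] at hp
    rw [MvPolynomial.eq_C_of_isEmpty p, hp, map_zero]
  | succ l ih =>
    by_cases hrel : ∃ (p : MvPolynomial (Fin (l + 1)) k) (d : ℕ), p.IsHomogeneous d ∧
        MvPolynomial.aeval σ p = 0 ∧ p ≠ 0
    · obtain ⟨p, d, hp, hpσ, hp0⟩ := hrel
      obtain ⟨σ', hσ', h'⟩ := h.exists_fewer hN hσ hp hp0 hpσ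
      exact ih hσ' h'
    · push Not at hrel
      exact ⟨l + 1, σ, hσ, h, hrel⟩

open Polynomial in
theorem aeval_monomial_of_isHomogeneous {ι : Type} (N : ℕ) (σ : ι → K) {p : MvPolynomial ι k}
    {d : ℕ} (hp : p.IsHomogeneous d) :
    MvPolynomial.aeval (fun j => monomial N (σ j)) p =
      monomial (N * d) (MvPolynomial.aeval σ p) := by
  have h := eval₂_mul_of_isHomogeneous (algebraMap k K[X]) hp (X ^ N) (fun j => C (σ j))
  have h2 := MvPolynomial.hom_eval₂ p (algebraMap k K) (C : K →+* K[X]) σ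
  rw [MvPolynomial.aeval_def, MvPolynomial.aeval_def,
    ← C_mul_X_pow_eq_monomial, h2, mul_comm N d, pow_mul', mul_comm]
  refine Eq.trans ?_ h
  congr 1
  funext j
  rw [← C_mul_X_pow_eq_monomial, mul_comm]

open Polynomial in
theorem coeff_aeval_monomial {ι : Type} {N : ℕ} (hN : 0 < N) (σ : ι → K) (p : MvPolynomial ι k)
    (m : ℕ) :
    (MvPolynomial.aeval (fun j => monomial N (σ j)) p).coeff m =
      if N ∣ m then MvPolynomial.aeval σ (MvPolynomial.homogeneousComponent (m / N) p) else 0 := by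
  conv_lhs => rw [← MvPolynomial.sum_homogeneousComponent p]
  rw [map_sum, finsetSum_coeff, Finset.sum_congr rfl fun d _ => by
    rw [aeval_monomial_of_isHomogeneous N σ
      (MvPolynomial.homogeneousComponent_isHomogeneous d p), coeff_monomial]]
  split_ifs with hm
  · obtain ⟨d, rfl⟩ := hm
    rw [Nat.mul_div_cancel_left _ hN]
    simp only [Nat.mul_left_cancel_iff hN, Finset.sum_ite_eq', Finset.mem_range]
    split_ifs with hd
    · rfl
    · rw [MvPolynomial.homogeneousComponent_eq_zero _ _ (by omega), map_zero]
  · refine Finset.sum_eq_zero fun d _ => if_neg ?_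
    rintro rfl
    exact hm (dvd_mul_right _ _)

-- The exponent of the polynomial variable records the degree, so homogeneous components cannot
-- cancel one another. Independence for homogeneous relations among the `σ j` becomes genuine
-- algebraic independence of the `σ j X^N`.
open Polynomial in
theorem aeval_monomial_injective {ι : Type} {N : ℕ} (hN : 0 < N) {σ : ι → K}
    (h : ∀ (p : MvPolynomial ι k) (d : ℕ), p.IsHomogeneous d → MvPolynomial.aeval σ p = 0 → p = 0) :
    Function.Injective (MvPolynomial.aeval (R := k) (fun j => (monomial N (σ j) : K[X]))) := by
  rw [injective_iff_map_eq_zero]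
  intro p hp
  rw [← MvPolynomial.sum_homogeneousComponent p]
  refine Finset.sum_eq_zero fun d _ => h _ d (MvPolynomial.homogeneousComponent_isHomogeneous d p) ?_
  have := coeff_aeval_monomial hN σ p (N * d)
  rwa [hp, coeff_zero, if_pos (dvd_mul_right _ _), Nat.mul_div_cancel_left _ hN, eq_comm] at this

end GradedSubspaces

/-! ### Integrality by valuation rings, and finiteness of integral closures -/

section Finiteness

/-- The integral closure of a subring of a field is the intersection of the valuation rings that
contain it; apply this to the image of `A`. -/
theorem isIntegral_of_forall_valuationSubring {A L : Type} [CommRing A] [Field L] [Algebra A L]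
    {x : L} (h : ∀ V : ValuationSubring L, (∀ a, algebraMap A L a ∈ V) → x ∈ V) :
    IsIntegral A x := by
  have hx : x ∈ (integralClosure (Subring.closure (Set.range (algebraMap A L))) L).toSubring := by
    rw [← iInf_valuationSubring_superset]
    simp only [Subring.mem_iInf]
    exact fun V => h V.1 fun a => V.2 ⟨a, rfl⟩
  have hcl : Subring.closure (Set.range (algebraMap A L)) = (algebraMap A L).range := by
    rw [← RingHom.coe_range, Subring.closure_eq]
  rw [hcl] at hx
  let : Algebra A (algebraMap A L).range := (algebraMap A L).rangeRestrict.toAlgebra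
  have : IsScalarTower A (algebraMap A L).range L := IsScalarTower.of_algebraMap_eq fun _ => rfl
  have : Algebra.IsIntegral A (algebraMap A L).range := ⟨fun y => by
    obtain ⟨a, ha⟩ := (algebraMap A L).rangeRestrict_surjective y
    rw [← ha]
    exact isIntegral_algebraMap (R := A) (A := (algebraMap A L).range)⟩
  exact isIntegral_trans (R := A) (A := (algebraMap A L).range) x hx

/-- The finitely many algebraic generators `G` make `L` a finite extension of the fraction field of
`A`, separable in characteristic zero. The integral closure of the Noetherian normal domain `A` in
it is then a Noetherian module containing the span. -/
theorem fg_span_of_isIntegral {A L : Type} [CommRing A] [IsDomain A] [IsIntegrallyClosed A]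
    [IsNoetherianRing A] [CharZero A] [Field L] [Algebra A L] [FaithfulSMul A L]
    (G : Set L) (hG : G.Finite) (hGalg : ∀ g ∈ G, IsAlgebraic A g)
    (hGtop : ∀ M : Subfield L, (∀ a, algebraMap A L a ∈ M) → G ⊆ M → M = ⊤)
    {Z : Set L} (hZ : ∀ z ∈ Z, IsIntegral A z) : (Submodule.span A Z).FG := by
  let := FractionRing.liftAlgebra A L
  let F := FractionRing A
  have htop : IntermediateField.adjoin F G = ⊤ := by
    have := hGtop (IntermediateField.adjoin F G).toSubfield (fun a => by
      rw [IsScalarTower.algebraMap_apply A F L]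
      exact (IntermediateField.adjoin F G).algebraMap_mem _) (IntermediateField.subset_adjoin F G)
    refine eq_top_iff.mpr fun x _ => ?_
    change x ∈ (IntermediateField.adjoin F G).toSubfield
    rw [this]
    trivial
  have hfd : FiniteDimensional F L := by
    have : Finite G := hG
    have h1 : FiniteDimensional F (IntermediateField.adjoin F G) :=
      IntermediateField.finiteDimensional_adjoin fun x hx =>
        isAlgebraic_iff_isIntegral.mp ((hGalg x hx).extendScalars (IsFractionRing.injective A F))
    rw [htop] at h1
    exact IntermediateField.topEquiv.toLinearEquiv.finiteDimensional
  have : CharZero F := charZero_of_injective_algebraMap (IsFractionRing.injective A F)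
  have := IsIntegralClosure.isNoetherian A F L (integralClosure A L)
  have hle : Submodule.span A Z ≤ Subalgebra.toSubmodule (integralClosure A L) :=
    Submodule.span_le.mpr fun z hz => hZ z hz
  have : IsNoetherian A (Subalgebra.toSubmodule (integralClosure A L)) := this
  exact Submodule.FG.of_le_of_isNoetherian hle

end Finiteness

/-! ### Graded subrings of `K[t]` as finite modules over their parameters -/

section SectionRing

variable {k K : Type} [Field k] [Field K] [Algebra k K]

/-- The subspaces `S m` form a graded ring `⨁ S m tᵐ ⊆ K[t]` -/
structure IsSectionRing (S : ℕ → Submodule k K) : Prop where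
  one_mem : 1 ∈ S 0
  mul_mem : ∀ {a b s t}, s ∈ S a → t ∈ S b → s * t ∈ S (a + b)

namespace IsSectionRing

variable {S : ℕ → Submodule k K} (hS : IsSectionRing S)
include hS

theorem pow_mem {a : ℕ} {s : K} (hs : s ∈ S a) (d : ℕ) : s ^ d ∈ S (a * d) := by
  induction d with
  | zero => simpa using hS.one_mem
  | succ d ih => rw [pow_succ, mul_add, mul_one]; exact hS.mul_mem ih hs

theorem prod_mem {ι : Type*} (J : Finset ι) {a : ι → ℕ} {s : ι → K}
    (hs : ∀ i ∈ J, s i ∈ S (a i)) : ∏ i ∈ J, s i ∈ S (∑ i ∈ J, a i) := by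
  classical
  induction J using Finset.induction_on with
  | empty => simpa using hS.one_mem
  | insert i J hi ih =>
    rw [Finset.prod_insert hi, Finset.sum_insert hi]
    exact hS.mul_mem (hs i (Finset.mem_insert_self _ _))
      (ih fun j hj => hs j (Finset.mem_insert_of_mem hj))

theorem aeval_mem {ι : Type} [Fintype ι] {N : ℕ} {σ : ι → K} (hσ : ∀ j, σ j ∈ S N)
    {p : MvPolynomial ι k} {d : ℕ} (hp : p.IsHomogeneous d) : MvPolynomial.aeval σ p ∈ S (N * d) := by
  rw [MvPolynomial.aeval_def, MvPolynomial.eval₂_eq]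
  refine sum_mem fun m hm => ?_
  rw [← Algebra.smul_def]
  refine Submodule.smul_mem _ _ ?_
  have := hS.prod_mem m.support (a := fun i => N * m i) (s := fun i => σ i ^ m i)
    fun i _ => hS.pow_mem (hσ i) (m i)
  rwa [← Finset.mul_sum, ← hp.degree_eq_sum_deg_support hm] at this

end IsSectionRing

open Polynomial in
/-- The standing assumptions on a graded ring `⨁ S m tᵐ ⊆ K[t]`: it has enough elements to generate
`K`, and `σ` is a system of parameters. -/
structure IsNormalized (S : ℕ → Submodule k K) (N : ℕ) {l : ℕ} (σ : Fin l → K) : Prop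
    extends IsSectionRing S where
  pos : 0 < N
  mem : ∀ j, σ j ∈ S N
  dominates : Dominates S N σ
  independent : ∀ (p : MvPolynomial (Fin l) k) (d : ℕ), p.IsHomogeneous d →
    MvPolynomial.aeval σ p = 0 → p = 0
  frac : ∀ g : K, ∃ a, ∃ Q ∈ S a, Q ≠ 0 ∧ Q * g ∈ S a

namespace IsNormalized

variable {S : ℕ → Submodule k K} {N l : ℕ} {σ : Fin l → K} (h : IsNormalized S N σ)
include h

open Polynomial

omit h in
/-- The action of the polynomial ring in the parameters on `K[t]`. -/
noncomputable abbrev parameterHom (k : Type) {K : Type} [Field k] [Field K] [Algebra k K] (N : ℕ) {l : ℕ}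
    (σ : Fin l → K) : MvPolynomial (Fin l) k →ₐ[k] K[X] :=
  MvPolynomial.aeval fun j => monomial N (σ j)

theorem parameterHom_injective : Function.Injective (parameterHom k N σ) :=
  aeval_monomial_injective h.pos h.independent

section FractionField

variable (L : Type) [Field L] [Algebra K[X] L] [IsFractionRing K[X] L]

-- Restrict a valuation ring of `L` that contains the `σ j t^N` to `K` and pick the minimal `σ j`.
-- Then `(s t^m)^N = (s^N / σ_j^m) · (σ_j t^N)^m` is a product of two of its elements.
omit [IsFractionRing K[X] L] in
theorem isIntegral_monomial {m : ℕ} {s : K} (hs : s ∈ S m) :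
    letI := ((algebraMap K[X] L).comp (parameterHom k N σ).toRingHom).toAlgebra
    IsIntegral (MvPolynomial (Fin l) k) (algebraMap K[X] L (monomial m s)) := by
  let := ((algebraMap K[X] L).comp (parameterHom k N σ).toRingHom).toAlgebra
  refine isIntegral_of_forall_valuationSubring fun V hV => ?_
  have hV' : ∀ p, algebraMap K[X] L (parameterHom k N σ p) ∈ V := hV
  let ι : K →+* L := (algebraMap K[X] L).comp C
  obtain ⟨j, hj, hm⟩ := h.dominates (V.comap ι) fun c => by
    have := hV' (MvPolynomial.C c)
    rw [parameterHom, MvPolynomial.aeval_C] at this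
    exact this
  have h1 : ι (s ^ N / σ j ^ m) ∈ V := hm m s hs
  have h2 := hV' (MvPolynomial.X j ^ m)
  rw [map_pow, parameterHom, MvPolynomial.aeval_X] at h2
  refine ValuationSubring.mem_of_pow_mem V h.pos ?_
  convert mul_mem h1 h2 using 1
  change _ = algebraMap K[X] L _ * _
  rw [← map_mul, ← map_pow, monomial_pow, monomial_pow, C_mul_monomial,
    div_mul_cancel₀ _ (pow_ne_zero _ hj), mul_comm N m]

theorem isAlgebraic_C (g : K) :
    letI := ((algebraMap K[X] L).comp (parameterHom k N σ).toRingHom).toAlgebra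
    IsAlgebraic (MvPolynomial (Fin l) k) (algebraMap K[X] L (C g)) := by
  let := ((algebraMap K[X] L).comp (parameterHom k N σ).toRingHom).toAlgebra
  obtain ⟨a, Q, hQ, hQ0, hQg⟩ := h.frac g
  have hne : algebraMap K[X] L (monomial a Q) ≠ 0 := by
    rw [Ne, map_eq_zero_iff _ (IsFractionRing.injective K[X] L), monomial_eq_zero_iff]
    exact hQ0
  have : algebraMap K[X] L (C g) = algebraMap K[X] L (monomial a (Q * g)) *
      (algebraMap K[X] L (monomial a Q))⁻¹ := by
    rw [eq_mul_inv_iff_mul_eq₀ hne, ← map_mul, C_mul_monomial, mul_comm]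
  rw [this]
  exact (h.isIntegral_monomial L hQg).isAlgebraic.mul (h.isIntegral_monomial L hQ).isAlgebraic.inv

theorem isAlgebraic_X :
    letI := ((algebraMap K[X] L).comp (parameterHom k N σ).toRingHom).toAlgebra
    IsAlgebraic (MvPolynomial (Fin l) k) (algebraMap K[X] L X) := by
  let := ((algebraMap K[X] L).comp (parameterHom k N σ).toRingHom).toAlgebra
  -- The trivial valuation ring `K` serves only to produce a nonzero parameter; then `X^N` is `σ_j
  -- X^N` divided by the constant `σ_j`.
  obtain ⟨j, hj, -⟩ := h.dominates ⊤ fun _ => trivial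
  refine IsAlgebraic.of_pow h.pos ?_
  have hne : algebraMap K[X] L (C (σ j)) ≠ 0 := by
    rw [Ne, map_eq_zero_iff _ (IsFractionRing.injective K[X] L), C_eq_zero]
    exact hj
  have : algebraMap K[X] L X ^ N = algebraMap K[X] L (monomial N (σ j)) *
      (algebraMap K[X] L (C (σ j)))⁻¹ := by
    rw [eq_mul_inv_iff_mul_eq₀ hne, ← map_pow, ← map_mul, mul_comm, C_mul_X_pow_eq_monomial]
  rw [this]
  exact (h.isIntegral_monomial L (h.mem j)).isAlgebraic.mul (h.isAlgebraic_C L _).inv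

end FractionField

/-- All `s t^m` are integral over the polynomials in the parameters, so they span a finitely
generated module. Generators can be chosen among the `s t^m` themselves, and comparing coefficients
of `t^m` makes the coefficients homogeneous. -/
theorem exists_generators_of_isFractionRing (L : Type) [Field L] [Algebra K[X] L] [IsFractionRing K[X] L]
    [CharZero k] {G : Set K} (hG : G.Finite)
    (hGtop : IntermediateField.adjoin k G = ⊤) :
    ∃ (ι : Type) (_ : Fintype ι) (e : ι → ℕ) (w : ι → K), (∀ i, w i ∈ S (e i)) ∧
      ∀ m, ∀ s ∈ S m, ∃ p : ι → MvPolynomial (Fin l) k,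
        (∀ i, p i ≠ 0 → ∃ d, N * d + e i = m ∧ (p i).IsHomogeneous d) ∧
          s = ∑ i, MvPolynomial.aeval σ (p i) * w i := by
  classical
  let := ((algebraMap K[X] L).comp (parameterHom k N σ).toRingHom).toAlgebra
  have hsmul : ∀ (p : MvPolynomial (Fin l) k) (q : K[X]), p • algebraMap K[X] L q =
    algebraMap K[X] L (parameterHom k N σ p * q) := fun p q => by
      rw [map_mul, Algebra.smul_def]; rfl
  have : FaithfulSMul (MvPolynomial (Fin l) k) L :=
    (faithfulSMul_iff_algebraMap_injective _ _).mpr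
      ((IsFractionRing.injective K[X] L).comp h.parameterHom_injective)
  let ι : K →+* L := (algebraMap K[X] L).comp C
  have hfg := fg_span_of_isIntegral (A := MvPolynomial (Fin l) k) (L := L)
    (insert (algebraMap K[X] L X) (ι '' G)) ((hG.image _).insert _) (by
      rintro g (rfl | ⟨g, -, rfl⟩)
      · exact h.isAlgebraic_X L
      · exact h.isAlgebraic_C L g) (by
      intro M hM hGM
      have hk : ∀ c : k, ι (algebraMap k K c) ∈ M := fun c => by
        have := hM (MvPolynomial.C c)
        change algebraMap K[X] L (parameterHom k N σ _) ∈ M at this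
        rw [parameterHom, MvPolynomial.aeval_C] at this
        exact this
      have hK : ∀ g, ι g ∈ M := fun g => by
        let M' : IntermediateField k K := (M.comap ι).toIntermediateField hk
        have : IntermediateField.adjoin k G ≤ M' :=
          IntermediateField.adjoin_le_iff.mpr fun g hg => hGM (Or.inr ⟨g, hg, rfl⟩)
        rw [hGtop] at this
        exact this (x := g) trivial
      have hp : ∀ q : K[X], algebraMap K[X] L q ∈ M := fun q => by
        induction q using Polynomial.induction_on' with
        | add p q hp hq => rw [map_add]; exact add_mem hp hq
        | monomial m a =>
          rw [← C_mul_X_pow_eq_monomial, map_mul, map_pow]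
          exact mul_mem (hK a) (pow_mem (hGM (Or.inl rfl)) m)
      refine eq_top_iff.mpr fun x _ => ?_
      obtain ⟨a, b, -, rfl⟩ := IsFractionRing.div_surjective (A := K[X]) x
      exact div_mem (hp a) (hp b))
    (Z := {z | ∃ m, ∃ s ∈ S m, algebraMap K[X] L (monomial m s) = z}) (by
      rintro _ ⟨m, s, hs, rfl⟩
      exact h.isIntegral_monomial L hs)
  rw [Submodule.fg_span_iff_fg_span_finset_subset] at hfg
  obtain ⟨T, hT, hspan⟩ := hfg
  choose e w hw hew using fun z : T => hT z.2
  refine ⟨T, inferInstance, e, w, hw, fun m s hs => ?_⟩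
  have hmem : algebraMap K[X] L (monomial m s) ∈
      Submodule.span (MvPolynomial (Fin l) k) (T : Set L) := by
    rw [← hspan]
    exact Submodule.subset_span ⟨m, s, hs, rfl⟩
  obtain ⟨q, hq⟩ := (Submodule.mem_span_finset'.mp hmem)
  have hq' : ∑ z : T, parameterHom k N σ (q z) * monomial (e z) (w z) = monomial m s := by
    apply IsFractionRing.injective K[X] L
    rw [← hq, map_sum]
    refine Finset.sum_congr rfl fun z _ => ?_
    rw [← hew z, hsmul]
  -- Only the component of `q z` of degree `(m - e z) / N` contributes to `t^m`. The condition
  -- excludes the cases where truncated subtraction or division would yield a spurious degree.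
  refine ⟨fun z => if e z ≤ m ∧ N ∣ m - e z then
    MvPolynomial.homogeneousComponent ((m - e z) / N) (q z) else 0, fun z hz => ?_, ?_⟩
  · dsimp only at hz ⊢
    split_ifs at hz ⊢ with hd
    · refine ⟨(m - e z) / N, ?_, MvPolynomial.homogeneousComponent_isHomogeneous _ _⟩
      rw [Nat.mul_div_cancel' hd.2]
      omega
    · exact absurd rfl hz
  · have := congrArg (fun q => q.coeff m) hq'
    simp only [finsetSum_coeff, coeff_monomial, if_true] at this
    rw [← this]
    refine Finset.sum_congr rfl fun z _ => ?_
    dsimp only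
    rw [← C_mul_X_pow_eq_monomial, ← mul_assoc, coeff_mul_X_pow']
    by_cases h1 : e z ≤ m
    · rw [if_pos h1, coeff_mul_C, parameterHom, coeff_aeval_monomial h.pos]
      by_cases h2 : N ∣ m - e z
      · rw [if_pos h2, if_pos ⟨h1, h2⟩]
      · rw [if_neg h2, if_neg (by tauto), map_zero]
    · rw [if_neg h1, if_neg (by tauto), map_zero, zero_mul]

theorem isIntegral_polynomial_of_isFractionRing (L : Type) [Field L] [Algebra K[X] L] [IsFractionRing K[X] L]
    {m : ℕ} {s : K} (hs : s ∈ S m) :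
    letI := (parameterHom k N σ).toRingHom.toAlgebra
    IsIntegral (MvPolynomial (Fin l) k) (monomial m s) := by
  let := (parameterHom k N σ).toRingHom.toAlgebra
  let := ((algebraMap K[X] L).comp (parameterHom k N σ).toRingHom).toAlgebra
  have : IsScalarTower (MvPolynomial (Fin l) k) K[X] L :=
    IsScalarTower.of_algebraMap_eq fun _ => rfl
  exact (isIntegral_algebraMap_iff (IsFractionRing.injective K[X] L)).mp
    (h.isIntegral_monomial L hs)

/-- The `σ j t^N` are algebraically independent in `K[t]`, whose transcendence degree is one more
than that of `K`. -/
theorem card_le [FaithfulSMul k K] {n : ℕ} (htr : Algebra.trdeg k K ≤ n) : l ≤ n + 1 := by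
  have h1 : AlgebraicIndependent k fun j => (monomial N (σ j) : K[X]) := h.parameterHom_injective
  have h2 := h1.cardinalMk_le_trdeg
  rw [← trdeg_add_eq k K, Polynomial.trdeg_of_isDomain, Cardinal.mk_fin] at h2
  have h3 : (l : Cardinal) ≤ ((n + 1 : ℕ) : Cardinal) := by
    push_cast
    exact h2.trans (by gcongr)
  exact_mod_cast h3

theorem exists_generators [CharZero k] {G : Set K} (hG : G.Finite)
    (hGtop : IntermediateField.adjoin k G = ⊤) :
    ∃ (ι : Type) (_ : Fintype ι) (e : ι → ℕ) (w : ι → K), (∀ i, w i ∈ S (e i)) ∧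
      ∀ m, ∀ s ∈ S m, ∃ p : ι → MvPolynomial (Fin l) k,
        (∀ i, p i ≠ 0 → ∃ d, N * d + e i = m ∧ (p i).IsHomogeneous d) ∧
          s = ∑ i, MvPolynomial.aeval σ (p i) * w i :=
  h.exists_generators_of_isFractionRing (RatFunc K) hG hGtop

/-- Every nonzero element divides a nonzero homogeneous polynomial in the parameters. -/
theorem exists_multiple {a : ℕ} {τ : K} (hτ : τ ∈ S a) (hτ0 : τ ≠ 0) :
    ∃ (d b : ℕ) (p : MvPolynomial (Fin l) k) (y : K), p.IsHomogeneous d ∧ p ≠ 0 ∧ y ∈ S b ∧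
      b + a = N * d ∧ MvPolynomial.aeval σ p = τ * y := by
  let := (parameterHom k N σ).toRingHom.toAlgebra
  -- `B` is the graded ring `⨁ S m t^m`. Integrality is used inside `B` rather than in `K[X]`, so
  -- that the cofactor `y` has its coefficients in the spaces `S m`.
  let B : Subalgebra (MvPolynomial (Fin l) k) K[X] :=
    { carrier := {q | ∀ m, q.coeff m ∈ S m}
      mul_mem' := fun {p q} hp hq m => by
        rw [coeff_mul]
        refine sum_mem fun x hx => ?_
        have hx' : x.1 + x.2 = m := Finset.HasAntidiagonal.mem_antidiagonal.mp hx
        rw [← hx']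
        exact h.mul_mem (hp _) (hq _)
      add_mem' := fun {p q} hp hq m => by
        rw [coeff_add]
        exact add_mem (hp m) (hq m)
      algebraMap_mem' := fun p m => by
        change (parameterHom k N σ p).coeff m ∈ S m
        rw [parameterHom, coeff_aeval_monomial h.pos]
        split_ifs with hm
        · have := h.toIsSectionRing.aeval_mem h.mem
            (MvPolynomial.homogeneousComponent_isHomogeneous (m / N) p)
          rwa [Nat.mul_div_cancel' hm] at this
        · exact zero_mem _ }
  have hB : monomial a τ ∈ B := fun m => by
    rw [coeff_monomial]
    split_ifs with hm
    · rwa [← hm]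
    · exact zero_mem _
  have hint : IsIntegral (MvPolynomial (Fin l) k) (⟨monomial a τ, hB⟩ : B) := by
    have h2 := h.isIntegral_polynomial_of_isFractionRing (RatFunc K) hτ
    exact (isIntegral_algebraMap_iff (A := B) (B := K[X]) Subtype.val_injective).mp h2
  obtain ⟨r, hr, ⟨y, hyB⟩, hy⟩ := hint.isAlgebraic.exists_nonzero_dvd
    (mem_nonZeroDivisors_of_ne_zero fun h0 => hτ0 (by
      have := congrArg Subtype.val h0
      exact (monomial_eq_zero_iff _ _).mp this))
  have hy' : parameterHom k N σ r = monomial a τ * y := congrArg Subtype.val hy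
  -- The multiple need not be homogeneous; a nonzero component and the coefficient of `t^(N d)` give
  -- a homogeneous one.
  obtain ⟨d, hd⟩ : ∃ d, MvPolynomial.homogeneousComponent d r ≠ 0 := by
    by_contra! hcon
    apply hr
    rw [← MvPolynomial.sum_homogeneousComponent r]
    exact Finset.sum_eq_zero fun d _ => hcon d
  have hhom := MvPolynomial.homogeneousComponent_isHomogeneous d r
  have hc := congrArg (fun q => q.coeff (N * d)) hy'
  rw [parameterHom, coeff_aeval_monomial h.pos, if_pos (dvd_mul_right _ _),
    Nat.mul_div_cancel_left _ h.pos, ← C_mul_X_pow_eq_monomial, mul_assoc, coeff_C_mul,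
    coeff_X_pow_mul'] at hc
  by_cases hle : a ≤ N * d
  · rw [if_pos hle] at hc
    exact ⟨d, N * d - a, _, _, hhom, hd, hyB _, by omega, hc⟩
  -- A multiple of `t^a` has no term of degree `N d < a`, so the component would be a relation among
  -- the `σ j`.
  · rw [if_neg hle, mul_zero] at hc
    exact absurd (h.independent _ d hhom hc) hd

end IsNormalized

end SectionRing

/-! ### Counting monomials -/

section Counting

theorem multichoose_succ_le (l d : ℕ) : (l + 1).multichoose d ≤ (d + 1) ^ l := by
  induction l generalizing d with
  | zero => simp
  | succ l ih =>
    induction d with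
    | zero => simp
    | succ d ihd =>
      rw [Nat.multichoose_succ_succ]
      calc _ ≤ (d + 1 + 1) ^ l + (d + 1) ^ (l + 1) := add_le_add (ih _) ihd
        _ ≤ (d + 1 + 1) ^ l + (d + 1) * (d + 1 + 1) ^ l := by
          rw [pow_succ']
          gcongr
          omega
        _ = _ := by ring

theorem multichoose_le_of_le {n l : ℕ} (hn : 1 ≤ n) (hl : l ≤ n) (d : ℕ) :
    l.multichoose d ≤ (d + 1) ^ (n - 1) := by
  cases l with
  | zero => cases d <;> simp
  | succ l =>
    exact (multichoose_succ_le l d).trans (Nat.pow_le_pow_right (by omega) (by omega))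

/-- Raising the degree by one adds the monomials in one variable fewer, at most `n` variables, and
there are at most `(d + 1)^(n-1)` of these in degree `d`. -/
theorem multichoose_add_le {n l : ℕ} (hn : 1 ≤ n) (hl : l ≤ n + 1) (d e : ℕ) :
    l.multichoose (d + e) ≤ l.multichoose d + e * (d + e + 1) ^ (n - 1) := by
  induction e with
  | zero => simp
  | succ e ih =>
    have h1 : l.multichoose (d + e + 1) ≤ l.multichoose (d + e) + (d + e + 1 + 1) ^ (n - 1) := by
      cases l with
      | zero => simp
      | succ l =>
        rw [Nat.multichoose_succ_succ, add_comm]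
        gcongr
        exact multichoose_le_of_le hn (by omega) _
    calc _ ≤ l.multichoose d + e * (d + e + 1) ^ (n - 1) + (d + e + 1 + 1) ^ (n - 1) :=
          h1.trans (Nat.add_le_add_right ih _)
      _ ≤ l.multichoose d + e * (d + e + 1 + 1) ^ (n - 1) + (d + e + 1 + 1) ^ (n - 1) := by
          have : (d + e + 1) ^ (n - 1) ≤ (d + e + 1 + 1) ^ (n - 1) :=
            Nat.pow_le_pow_left (by omega) _
          gcongr
      _ = _ := by ring

theorem finrank_homogeneousSubmodule (k : Type) [Field k] (l d : ℕ) :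
    Module.finrank k (MvPolynomial.homogeneousSubmodule (Fin l) k d) = l.multichoose d := by
  rw [MvPolynomial.homogeneousSubmodule_eq_finsupp_supported]
  have h1 : {m : Fin l →₀ ℕ | m.degree = d} = ((Finset.univ : Finset (Fin l)).finsuppAntidiag d : Set _) := by
    ext m
    simp [Finsupp.degree_eq_sum]
  rw [h1, LinearEquiv.finrank_eq (AddMonoidAlgebra.supportedEquivFinsupp _)]
  have := Finset.card_finsuppAntidiag_nat_eq_multichoose (s := (Finset.univ : Finset (Fin l))) d
  rw [Finset.card_univ, Fintype.card_fin] at this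
  rw [Module.finrank_finsupp_self]
  simpa using this

instance finite_homogeneousSubmodule (k : Type) [Field k] (l d : ℕ) :
    Module.Finite k (MvPolynomial.homogeneousSubmodule (Fin l) k d) :=
  Module.Finite.iff_fg.mpr (MvPolynomial.homogeneousSubmodule_fg _ _ d)

theorem exists_complement {k V : Type*} [Field k] [AddCommGroup V] [Module k V] {W W' : Submodule k V}
    [Module.Finite k W'] (h : W ≤ W') :
    ∃ B ≤ W', W ⊔ B = W' ∧ Module.finrank k W + Module.finrank k B = Module.finrank k W' := by
  obtain ⟨C, hC⟩ := Submodule.exists_isCompl W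
  have hsup : W ⊔ C ⊓ W' = W' := by
    rw [← sup_inf_assoc_of_le C h, hC.sup_eq_top, top_inf_eq]
  have hinf : W ⊓ (C ⊓ W') = ⊥ := by
    rw [← inf_assoc, hC.inf_eq_bot, bot_inf_eq]
  have : Module.Finite k W := Submodule.finiteDimensional_of_le h
  have : Module.Finite k (C ⊓ W' : Submodule k V) := Submodule.finiteDimensional_of_le inf_le_right
  refine ⟨C ⊓ W', inf_le_right, hsup, ?_⟩
  have := Submodule.finrank_sup_add_finrank_inf_eq W (C ⊓ W')
  rw [hsup, hinf, finrank_bot, add_zero] at this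
  exact this.symm

/-- A complement, of small dimension, of the multiples of a homogeneous polynomial. -/
theorem exists_complement_multiples {k : Type} [Field k] {n l : ℕ} (hn : 1 ≤ n) (hl : l ≤ n + 1)
    {g : MvPolynomial (Fin l) k} {e : ℕ} (hg : g.IsHomogeneous e) (hg0 : g ≠ 0) (d : ℕ) :
    ∃ B ≤ MvPolynomial.homogeneousSubmodule (Fin l) k d,
      (∀ p : MvPolynomial (Fin l) k, p.IsHomogeneous d → ∃ b ∈ B, ∃ q : MvPolynomial (Fin l) k,
        p = g * q + b ∧ (q ≠ 0 → ∃ c, c + e = d ∧ q.IsHomogeneous c)) ∧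
      Module.finrank k B ≤ (e + 1) * (d + 1) ^ (n - 1) := by
  by_cases hde : e ≤ d
  · obtain ⟨c, rfl⟩ := Nat.exists_eq_add_of_le' hde
    let W := (MvPolynomial.homogeneousSubmodule (Fin l) k c).map (LinearMap.mulLeft k g)
    have hW : W ≤ MvPolynomial.homogeneousSubmodule (Fin l) k (c + e) := by
      rintro _ ⟨q, hq, rfl⟩
      rw [add_comm]
      exact hg.mul hq
    -- Multiplication by `g` is injective, so the codimension of its image is the increment of the
    -- monomial count between degrees `c` and `c + e`.
    have hinj : Function.Injective (LinearMap.mulLeft k g) := mul_right_injective₀ hg0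
    have hWr : Module.finrank k W = l.multichoose c := by
      rw [← finrank_homogeneousSubmodule k l c]
      exact (LinearEquiv.finrank_eq (Submodule.equivMapOfInjective _ hinj _)).symm
    obtain ⟨B, hB, hsup, hr⟩ := exists_complement hW
    refine ⟨B, hB, fun p hp => ?_, ?_⟩
    · have hp' : p ∈ W ⊔ B := by rw [hsup]; exact hp
      obtain ⟨_, ⟨q, hq, rfl⟩, b, hb, rfl⟩ := Submodule.mem_sup.mp hp'
      exact ⟨b, hb, q, rfl, fun _ => ⟨c, rfl, hq⟩⟩
    · rw [hWr, finrank_homogeneousSubmodule] at hr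
      have := multichoose_add_le hn hl c e
      have h2 : e * (c + e + 1) ^ (n - 1) ≤ (e + 1) * (c + e + 1) ^ (n - 1) := by gcongr; omega
      omega
  -- Below degree `e` the whole space is small enough. The `1` in `e + 1` accounts for the single
  -- monomial of degree `0`.
  · refine ⟨_, le_rfl, fun p hp => ⟨p, hp, 0, by simp, by simp⟩, ?_⟩
    rw [finrank_homogeneousSubmodule]
    have := multichoose_add_le hn hl 0 d
    rw [zero_add, Nat.multichoose_zero_right] at this
    have h2 : 1 ≤ (d + 1) ^ (n - 1) := Nat.one_le_pow _ _ (by omega)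
    have h3 : d * (d + 1) ^ (n - 1) ≤ e * (d + 1) ^ (n - 1) := by gcongr; omega
    rw [add_mul, one_mul]
    omega

theorem finrank_iSup_le_sum {k V ι : Type*} [Field k] [AddCommGroup V] [Module k V] [Fintype ι]
    (W : ι → Submodule k V) [∀ i, Module.Finite k (W i)] :
    Module.finrank k (⨆ i, W i : Submodule k V) ≤ ∑ i, Module.finrank k (W i) := by
  classical
  have : ∀ s : Finset ι, Module.Finite k (⨆ i ∈ s, W i : Submodule k V) ∧
      Module.finrank k (⨆ i ∈ s, W i : Submodule k V) ≤ ∑ i ∈ s, Module.finrank k (W i) := by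
    intro s
    induction s using Finset.induction_on with
    | empty =>
      have h0 : (⨆ i ∈ (∅ : Finset ι), W i) = ⊥ := by simp
      rw [h0]
      exact ⟨inferInstance, by simp⟩
    | insert i s hi ih =>
      have := ih.1
      rw [Finset.iSup_insert, Finset.sum_insert hi]
      exact ⟨inferInstance, (Submodule.finrank_add_le_finrank_add_finrank _ _).trans
        (Nat.add_le_add_left ih.2 _)⟩
  have h := (this Finset.univ).2
  rwa [iSup_congr fun i => iSup_pos (Finset.mem_univ i)] at h

end Counting

/-! ### Growth of the Hilbert function -/

namespace IsNormalized

variable {k K : Type} [Field k] [Field K] [Algebra k K] [CharZero k]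
variable {S : ℕ → Submodule k K} {N l n : ℕ} {σ : Fin l → K} (h : IsNormalized S N σ)
include h

/-- The map sending a polynomial in the parameters to the corresponding multiple of `w`. -/
noncomputable def multiplesMap (k : Type) {K : Type} [Field k] [Field K] [Algebra k K] {l : ℕ}
    (σ : Fin l → K) (w : K) : MvPolynomial (Fin l) k →ₗ[k] K :=
  LinearMap.mulRight k w ∘ₗ (MvPolynomial.aeval σ).toLinearMap

theorem finite {G : Set K} (hG : G.Finite) (hGtop : IntermediateField.adjoin k G = ⊤) (m : ℕ) :
    Module.Finite k (S m) := by
  obtain ⟨ι, _, e, w, hw, hgen⟩ := h.exists_generators hG hGtop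
  have : S m ≤ ⨆ i, (MvPolynomial.homogeneousSubmodule (Fin l) k ((m - e i) / N)).map
      (multiplesMap k σ (w i)) := by
    intro s hs
    obtain ⟨p, hp, rfl⟩ := hgen m s hs
    refine sum_mem fun i _ => Submodule.mem_iSup_of_mem i ⟨p i, ?_, rfl⟩
    by_cases h0 : p i = 0
    · rw [h0]; exact zero_mem _
    · obtain ⟨d, hd, hpd⟩ := hp i h0
      have : (m - e i) / N = d := by
        rw [← hd, Nat.add_sub_cancel, Nat.mul_div_cancel_left _ h.pos]
      rw [this]
      exact hpd
  exact Submodule.finiteDimensional_of_le this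

/-- The Hilbert function has growth of order at most `n - 1`. -/
theorem finrank_add_le {G : Set K} (hG : G.Finite) (hGtop : IntermediateField.adjoin k G = ⊤)
    (hn : 1 ≤ n) (htr : Algebra.trdeg k K ≤ n) {a : ℕ} {τ : K} (hτ : τ ∈ S a) (hτ0 : τ ≠ 0) :
    ∃ C : ℕ, ∀ m, Module.finrank k (S (m + a)) ≤
      Module.finrank k (S m) + C * (m + 1) ^ (n - 1) := by
  have hfin := h.finite hG hGtop
  obtain ⟨ι, _, e, w, hw, hgen⟩ := h.exists_generators hG hGtop
  obtain ⟨d, b, g, y, hg, hg0, hy, hbd, hgy⟩ := h.exists_multiple hτ hτ0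
  have hl := h.card_le htr
  choose B hB hBp hBr using exists_complement_multiples (k := k) hn hl hg hg0
  refine ⟨Fintype.card ι * ((d + 1) * (a + 1) ^ (n - 1)), fun m => ?_⟩
  let T := (S m).map (LinearMap.mulLeft k τ)
  let R : ι → Submodule k K := fun i => (B ((m + a - e i) / N)).map (multiplesMap k σ (w i))
  have hBfin : ∀ j, Module.Finite k (B j) := fun j => Submodule.finiteDimensional_of_le (hB j)
  -- Divide each coefficient `p i` by the form `g = τ y`. The multiple of `g` contributes an element
  -- of `τ · S m`, and the remainder lies in the small complement `B`.
  have hle : S (m + a) ≤ T ⊔ ⨆ i, R i := by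
    intro s hs
    obtain ⟨p, hp, rfl⟩ := hgen _ s hs
    refine sum_mem fun i _ => ?_
    by_cases h0 : p i = 0
    · rw [h0, map_zero, zero_mul]; exact zero_mem _
    obtain ⟨c, hc, hpc⟩ := hp i h0
    have hci : (m + a - e i) / N = c := by
      rw [← hc, Nat.add_sub_cancel, Nat.mul_div_cancel_left _ h.pos]
    obtain ⟨r, hr, q, hpq, hq⟩ := hBp c (p i) hpc
    rw [hpq, map_add, add_mul]
    refine add_mem (Submodule.mem_sup_left ?_) (Submodule.mem_sup_right
      (Submodule.mem_iSup_of_mem i ⟨r, by rwa [hci], rfl⟩))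
    by_cases hq0 : q = 0
    · rw [hq0, mul_zero, map_zero, zero_mul]; exact zero_mem _
    obtain ⟨c', hc', hqc⟩ := hq hq0
    refine ⟨y * (MvPolynomial.aeval σ q * w i), ?_, ?_⟩
    · have := h.mul_mem hy (h.mul_mem (h.toIsSectionRing.aeval_mem h.mem hqc) (hw i))
      have hm : b + (N * c' + e i) = m := by
        subst hc'
        rw [mul_add] at hc
        omega
      rwa [hm] at this
    · rw [LinearMap.mulLeft_apply, map_mul, hgy]
      ring
  have hTr : Module.finrank k T = Module.finrank k (S m) :=
    (LinearEquiv.finrank_eq (Submodule.equivMapOfInjective _ (mul_right_injective₀ hτ0) _)).symm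
  -- The dimension of `R i` is bounded through its source `B`; `m + a + 1 ≤ (a + 1)(m + 1)`
  -- separates the dependence on `m`.
  have hRr : ∀ i, Module.finrank k (R i) ≤ (d + 1) * (a + 1) ^ (n - 1) * (m + 1) ^ (n - 1) := by
    intro i
    refine (Submodule.finrank_map_le _ _).trans ((hBr _).trans ?_)
    rw [mul_assoc, ← mul_pow]
    gcongr
    calc (m + a - e i) / N + 1 ≤ m + a + 1 :=
          Nat.add_le_add_right ((Nat.div_le_self _ _).trans (Nat.sub_le _ _)) 1
      _ ≤ (a + 1) * (m + 1) := by nlinarith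
  calc _ ≤ Module.finrank k (T ⊔ ⨆ i, R i : Submodule k K) := Submodule.finrank_mono hle
    _ ≤ Module.finrank k T + Module.finrank k (⨆ i, R i : Submodule k K) :=
        Submodule.finrank_add_le_finrank_add_finrank _ _
    _ ≤ Module.finrank k (S m) + ∑ i, Module.finrank k (R i) := by
        rw [hTr]
        exact Nat.add_le_add_left (finrank_iSup_le_sum R) _
    _ ≤ Module.finrank k (S m) + ∑ _i : ι, (d + 1) * (a + 1) ^ (n - 1) * (m + 1) ^ (n - 1) := by
        gcongr with i
        exact hRr i
    _ = _ := by
        rw [Finset.sum_const, Finset.card_univ, smul_eq_mul]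
        ring

end IsNormalized

/-! ### The transcendence degree of the function field -/

section TranscendenceDegree

/-- In characteristic zero `K` is formally étale both over `R` and over the polynomial ring on a
transcendence basis. Hence the differentials of `K` acquire a basis of `n` elements and one indexed
by the transcendence basis. -/
theorem trdeg_eq_of_basis_kaehlerDifferential {k R K : Type} [Field k] [CharZero k] [CommRing R]
    [IsDomain R] [Algebra k R] [Field K] [Algebra k K] [Algebra R K] [IsScalarTower k R K]
    [IsFractionRing R K] {n : ℕ} (b : Module.Basis (Fin n) R (Ω[R⁄k])) :
    Algebra.trdeg k K = n := by
  obtain ⟨ι, x, hx⟩ := exists_isTranscendenceBasis' k K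
  let A := MvPolynomial ι k
  let : Algebra A K := (MvPolynomial.aeval x).toRingHom.toAlgebra
  have : IsScalarTower k A K := IsScalarTower.of_algebraMap_eq fun c =>
    ((MvPolynomial.aeval x).commutes c).symm
  have : FaithfulSMul A K := (faithfulSMul_iff_algebraMap_injective _ _).mpr hx.1
  let := FractionRing.liftAlgebra A K
  let F := FractionRing A
  have : CharZero F := charZero_of_injective_algebraMap (algebraMap k F).injective
  have : Algebra.IsAlgebraic A K := by
    have := hx.isAlgebraic
    refine Algebra.IsAlgebraic.of_ringHom_of_comp_eq hx.1.aevalEquiv.toRingHom (RingHom.id K)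
      hx.1.aevalEquiv.surjective Function.injective_id ?_
    ext <;> simp [A, RingHom.algebraMap_toAlgebra]
  have : Algebra.IsAlgebraic F K := IsFractionRing.comap_isAlgebraic_iff.mp this
  have : Algebra.FormallyEtale F K := Algebra.FormallyEtale.of_isSeparable F K
  have : Algebra.FormallyEtale A F := Algebra.FormallyEtale.of_isLocalization (nonZeroDivisors A)
  have : Algebra.FormallyEtale A K := Algebra.FormallyEtale.comp A F K
  have : Algebra.FormallyEtale R K := Algebra.FormallyEtale.of_isLocalization (nonZeroDivisors R)
  let b₁ := (b.baseChange K).map (KaehlerDifferential.tensorKaehlerEquivOfFormallyEtale k R K)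
  let b₂ := ((KaehlerDifferential.mvPolynomialBasis k ι).baseChange K).map
    (KaehlerDifferential.tensorKaehlerEquivOfFormallyEtale k A K)
  have h1 := b₁.mk_eq_rank
  have h2 := b₂.mk_eq_rank
  rw [← hx.cardinalMk_eq_trdeg]
  simp at h1 h2
  rw [h2, ← h1]

end TranscendenceDegree

/-! ### Centres of valuations on a proper variety -/

section Center

/-- If `Spec R → X` extends the map from the spectrum of the local ring at `x` and lands in `U`, the
germs of functions on `U` come from `R` through `j`. It is used for a valuation ring `R` and the
generic point. -/
theorem germ_eq_of_lift {X : Scheme.{0}} {x : X} {R : CommRingCat} (j : R ⟶ X.presheaf.stalk x)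
    (l : Spec R ⟶ X) (hl : Spec.map j ≫ l = X.fromSpecStalk x) {U : X.Opens} (hx : x ∈ U)
    (htop : ⊤ ≤ l ⁻¹ᵁ U) :
    X.presheaf.germ U x hx = l.appLE U ⊤ htop ≫ (Scheme.ΓSpecIso R).hom ≫ j := by
  have hle : ⊤ ≤ (X.fromSpecStalk x) ⁻¹ᵁ U := by
    rw [← hl]
    exact fun y _ => htop trivial
  have h1 : l.appLE U ⊤ htop ≫ (Spec.map j).appTop = (X.fromSpecStalk x).appLE U ⊤ hle := by
    have h := Scheme.Hom.appLE_comp_appLE (Spec.map j) l U ⊤ ⊤ htop le_rfl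
    have e : (Spec.map j).appTop = (Spec.map j).appLE ⊤ ⊤ le_rfl :=
      (Scheme.Hom.appLE_eq_app (Spec.map j) (U := ⊤)).symm
    rw [e, h]
    congr 1
  have h2 : (X.fromSpecStalk x).appLE U ⊤ hle =
      X.presheaf.germ U x hx ≫ (Scheme.ΓSpecIso (X.presheaf.stalk x)).inv := by
    rw [Scheme.Hom.appLE, Scheme.fromSpecStalk_app hx, Category.assoc, Category.assoc,
      ← Functor.map_comp]
    erw [CategoryTheory.Functor.map_id, Category.comp_id]
  rw [← Scheme.ΓSpecIso_naturality j, ← Category.assoc, h1, h2, Category.assoc, Iso.inv_hom_id,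
    Category.comp_id]

variable {X : Scheme.{0}} [X.Over SpecC] [IsIntegral X]

theorem fromSpecStalk_over :
    X.fromSpecStalk (genericPoint X) ≫ (X ↘ SpecC) =
      Spec.map (CommRingCat.ofHom (algebraMap ℂ X.functionField)) := by
  refine ext_of_isAffine ?_
  rw [Scheme.Hom.comp_appTop, Scheme.fromSpecStalk_appTop]
  have h := Scheme.ΓSpecIso_inv_naturality (CommRingCat.ofHom (algebraMap ℂ X.functionField))
  rw [← cancel_epi (Scheme.ΓSpecIso (CommRingCat.of ℂ)).inv]
  refine Eq.trans ?_ h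
  have e : (X ↘ SpecC).appTop = (X ↘ SpecC).appLE ⊤ ⊤ (fun _ _ => trivial) := by
    exact (Scheme.Hom.appLE_eq_app (X ↘ SpecC) (U := ⊤)).symm
  rw [e, ← Category.assoc, ← Category.assoc]
  rfl

/-- The valuative criterion extends the generic point to a morphism from `Spec V`, and the centre is
the image of the closed point. An open set containing the centre contains the whole image, since
every point of `Spec V` specializes to the closed one. -/
theorem exists_center (hproper : IsProper (X ↘ SpecC)) (V : ValuationSubring X.functionField)
    (hV : ∀ c : ℂ, algebraMap ℂ X.functionField c ∈ V) :
    ∃ x : X, ∀ U : AffOpen X, x ∈ U.op → ∀ f : Γ(X, U.op),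
      algebraMap Γ(X, U.op) X.functionField f ∈ V := by
  let j : V →+* X.functionField := V.subtype
  let ψ : ℂ →+* V := (algebraMap ℂ X.functionField).codRestrict V.toSubring hV
  have hex : ValuativeCriterion.Existence (X ↘ SpecC) := by
    have : UniversallyClosed (X ↘ SpecC) := inferInstance
    rw [UniversallyClosed.eq_valuativeCriterion] at this
    exact this.1
  have hsq : CommSq (X.fromSpecStalk (genericPoint X)) (Spec.map (CommRingCat.ofHom j))
      (X ↘ SpecC) (Spec.map (CommRingCat.ofHom ψ)) := ⟨by
    rw [fromSpecStalk_over]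
    exact Spec.map_comp (CommRingCat.ofHom ψ) (CommRingCat.ofHom j)⟩
  obtain ⟨⟨l, hl, -⟩⟩ := (hex ⟨V, X.functionField, X.fromSpecStalk (genericPoint X),
    Spec.map (CommRingCat.ofHom ψ), hsq⟩).exists_lift
  change Spec.map (CommRingCat.ofHom j) ≫ l = _ at hl
  refine ⟨l (IsLocalRing.closedPoint V), fun U hU f => ?_⟩
  have htop : ⊤ ≤ l ⁻¹ᵁ U.op := fun y _ =>
    (IsLocalRing.specializes_closedPoint y).mem_open (l ⁻¹ᵁ U.op).isOpen hU
  have h1 := germ_eq_of_lift (CommRingCat.ofHom j) l hl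
    (((genericPoint_spec X).mem_open_set_iff U.op.isOpen).mpr (by simpa using U.2.2)) htop
  have h2 := congrArg (fun q => q.hom f) h1
  have h3 : algebraMap Γ(X, U.op) X.functionField f = j _ := h2
  rw [h3]
  exact Subtype.prop _

end Center

/-! ### Quasi-coherent families of submodules of a vector space over the function field -/

section Families

variable {X : Scheme.{0}}

theorem AffOpen.isAffine (U : AffOpen X) : IsAffineOpen U.1 := U.2.1

theorem exists_affOpen (x : X) (W : X.Opens) (hx : x ∈ W) : ∃ U : AffOpen X, x ∈ U.op ∧ U.op ≤ W := by
  obtain ⟨_, ⟨A, hA, rfl⟩, hxA, hAW⟩ := X.isBasis_affineOpens.exists_subset_of_mem_open hx W.isOpen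
  exact ⟨⟨A, hA, ⟨⟨x, hxA⟩⟩⟩, hxA, hAW⟩

theorem AffOpen.exists_common_basicOpen (U W : AffOpen X) (x : X) (hxU : x ∈ U.op)
    (hxW : x ∈ W.op) : ∃ (B : AffOpen X) (f : Γ(X, U.op)) (g : Γ(X, W.op)),
      B.op = X.basicOpen f ∧ B.op = X.basicOpen g ∧ x ∈ B.op := by
  obtain ⟨f, g, hfg, hx⟩ := exists_basicOpen_le_affine_inter U.isAffine W.isAffine x ⟨hxU, hxW⟩
  exact ⟨⟨X.basicOpen f, U.isAffine.basicOpen f, ⟨⟨x, hx⟩⟩⟩, f, g, rfl, hfg, hx⟩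

theorem AffOpen.le_of_eq_basicOpen {U B : AffOpen X} {f : Γ(X, U.op)} (h : B.op = X.basicOpen f) :
    B.op ≤ U.op := h.trans_le (X.basicOpen_le f)

theorem exists_resO_eq_pow_mul {U B : AffOpen X} {f : Γ(X, U.op)} (h : B.op = X.basicOpen f)
    (g : Γ(X, B.op)) : ∃ (n : ℕ) (a : Γ(X, U.op)),
      resO (AffOpen.le_of_eq_basicOpen h) a = resO (AffOpen.le_of_eq_basicOpen h) f ^ n * g := by
  let := (resO (AffOpen.le_of_eq_basicOpen h)).toAlgebra
  have : IsLocalization.Away f Γ(X, B.op) :=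
    U.isAffine.isLocalization_of_eq_basicOpen f (homOfLE (AffOpen.le_of_eq_basicOpen h)) h
  obtain ⟨⟨a, ⟨_, n, rfl⟩⟩, hab⟩ := IsLocalization.surj (Submonoid.powers f) g
  refine ⟨n, a, ?_⟩
  rw [← map_pow, mul_comm]
  exact hab.symm

theorem isUnit_resO {U B : AffOpen X} {f : Γ(X, U.op)} (h : B.op = X.basicOpen f) :
    IsUnit (resO (AffOpen.le_of_eq_basicOpen h) f) := by
  let := (resO (AffOpen.le_of_eq_basicOpen h)).toAlgebra
  have : IsLocalization.Away f Γ(X, B.op) :=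
    U.isAffine.isLocalization_of_eq_basicOpen f (homOfLE (AffOpen.le_of_eq_basicOpen h)) h
  exact IsLocalization.Away.algebraMap_isUnit f

variable [IsIntegral X]

instance isFractionRing_functionField (U : AffOpen X) :
    IsFractionRing Γ(X, U.op) X.functionField :=
  functionField_isFractionRing_of_isAffineOpen X U.op U.isAffine

theorem genericPoint_mem (U : AffOpen X) : genericPoint X ∈ U.op :=
  ((genericPoint_spec X).mem_open_set_iff U.op.isOpen).mpr (by simpa using U.2.2)

/-- The rational function defined by a function on an affine open subset. -/
noncomputable abbrev toK (U : AffOpen X) : Γ(X, U.op) →+* X.functionField :=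
  algebraMap Γ(X, U.op) X.functionField

theorem toK_injective (U : AffOpen X) : Function.Injective (toK U) :=
  IsFractionRing.injective _ _

theorem toK_resO {U V : AffOpen X} (h : V.op ≤ U.op) (f : Γ(X, U.op)) :
    toK V (resO h f) = toK U f := algebraMap_resO h f

theorem toK_ne_zero {U B : AffOpen X} {f : Γ(X, U.op)} (h : B.op = X.basicOpen f) :
    toK U f ≠ 0 := by
  rw [← toK_resO (AffOpen.le_of_eq_basicOpen h)]
  exact ((isUnit_resO h).map (toK B)).ne_zero

variable [X.Over SpecC]

theorem toK_mem_ring (U : AffOpen X) (f : Γ(X, U.op)) : toK U f ∈ ring X U := ⟨f, rfl⟩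

theorem ring_mono {U V : AffOpen X} (h : V.op ≤ U.op) : ring X U ≤ ring X V := by
  rintro _ ⟨f, rfl⟩
  exact ⟨resO h f, toK_resO h f⟩

theorem ring_basicOpen {U B : AffOpen X} {f : Γ(X, U.op)} (h : B.op = X.basicOpen f)
    {g : X.functionField} (hg : g ∈ ring X B) : ∃ n : ℕ, toK U f ^ n * g ∈ ring X U := by
  obtain ⟨g, rfl⟩ := hg
  obtain ⟨n, a, ha⟩ := exists_resO_eq_pow_mul h g
  refine ⟨n, a, ?_⟩
  have := congrArg (toK B) ha
  rwa [map_mul, map_pow, toK_resO, toK_resO] at this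

theorem inv_toK_mem_ring {U B : AffOpen X} {f : Γ(X, U.op)} (h : B.op = X.basicOpen f) :
    (toK U f)⁻¹ ∈ ring X B := by
  obtain ⟨u, hu⟩ := isUnit_resO h
  refine ⟨(u⁻¹ : (Γ(X, B.op))ˣ), ?_⟩
  change toK B _ = _
  rw [← toK_resO (AffOpen.le_of_eq_basicOpen h), ← hu]
  exact eq_inv_of_mul_eq_one_left (by rw [← map_mul, Units.inv_mul, map_one])

variable {V : Type} [AddCommGroup V] [Module X.functionField V]

/-- A family of submodules of the constant sheaf `V` is quasi-coherent if it is compatible with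
localization to principal open subsets. -/
structure IsQCoh (L : ∀ U : AffOpen X, Submodule (ring X U) V) : Prop where
  mono_basicOpen : ∀ (U B : AffOpen X) (f : Γ(X, U.op)), B.op = X.basicOpen f →
    ∀ v ∈ L U, v ∈ L B
  localized : ∀ (U B : AffOpen X) (f : Γ(X, U.op)), B.op = X.basicOpen f →
    ∀ v ∈ L B, ∃ n : ℕ, toK U f ^ n • v ∈ L U

theorem smul_mem_of_mem_ring {U : AffOpen X} (M : Submodule (ring X U) V) {c : X.functionField}
    (hc : c ∈ ring X U) {v : V} (hv : v ∈ M) : c • v ∈ M := M.smul_mem ⟨c, hc⟩ hv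

theorem pow_smul_mem_of_le {U : AffOpen X} (M : Submodule (ring X U) V) (f : Γ(X, U.op)) {n m : ℕ}
    (h : n ≤ m) {v : V} (hv : toK U f ^ n • v ∈ M) : toK U f ^ m • v ∈ M := by
  obtain ⟨d, rfl⟩ := Nat.exists_eq_add_of_le h
  rw [add_comm, pow_add, mul_smul]
  exact smul_mem_of_mem_ring M (pow_mem (toK_mem_ring U f) d) hv

theorem isQCoh_span {G : AffOpen X → Set V}
    (hmono : ∀ (U B : AffOpen X) (f : Γ(X, U.op)), B.op = X.basicOpen f →
      ∀ v ∈ G U, v ∈ Submodule.span (ring X B) (G B))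
    (hloc : ∀ (U B : AffOpen X) (f : Γ(X, U.op)), B.op = X.basicOpen f →
      ∀ v ∈ G B, ∃ n : ℕ, toK U f ^ n • v ∈ Submodule.span (ring X U) (G U)) :
    IsQCoh fun U => Submodule.span (ring X U) (G U) where
  mono_basicOpen U B f h v hv := by
    induction hv using Submodule.span_induction with
    | mem v hv => exact hmono U B f h v hv
    | zero => exact zero_mem _
    | add v w _ _ hv hw => exact add_mem hv hw
    | smul c v _ hv =>
      exact smul_mem_of_mem_ring _ (ring_mono (AffOpen.le_of_eq_basicOpen h) c.2) hv
  localized U B f h v hv := by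
    induction hv using Submodule.span_induction with
    | mem v hv => exact hloc U B f h v hv
    | zero => exact ⟨0, by rw [smul_zero]; exact zero_mem _⟩
    | add v w _ _ hv hw =>
      obtain ⟨n, hn⟩ := hv
      obtain ⟨m, hm⟩ := hw
      refine ⟨max n m, ?_⟩
      rw [smul_add]
      exact add_mem (pow_smul_mem_of_le _ f (le_max_left _ _) hn)
        (pow_smul_mem_of_le _ f (le_max_right _ _) hm)
    | smul c v _ hv =>
      obtain ⟨n, hn⟩ := hv
      obtain ⟨m, hm⟩ := ring_basicOpen h c.2
      refine ⟨m + n, ?_⟩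
      have : toK U f ^ (m + n) • c • v = (toK U f ^ m * (c : X.functionField)) • toK U f ^ n • v := by
        change _ • (c : X.functionField) • v = _
        rw [smul_smul, smul_smul]
        congr 1
        ring
      rw [this]
      exact smul_mem_of_mem_ring _ hm hn

namespace IsQCoh

variable {L : ∀ U : AffOpen X, Submodule (ring X U) V} (hL : IsQCoh L)
include hL

/-- Membership in a quasi-coherent family can be checked locally. -/
theorem mem_of_locally {U : AffOpen X} {v : V}
    (h : ∀ x ∈ U.op, ∃ W : AffOpen X, x ∈ W.op ∧ v ∈ L W) : v ∈ L U := by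
  -- `I` is the ideal of denominators of `v`. Its radical contains functions whose principal opens
  -- cover `U`, so `I` is the unit ideal.
  let I : Ideal Γ(X, U.op) :=
    { carrier := {a | toK U a • v ∈ L U}
      add_mem' := fun {a b} ha hb => by
        change toK U (a + b) • v ∈ L U
        rw [map_add, add_smul]
        exact add_mem ha hb
      zero_mem' := by
        change toK U 0 • v ∈ L U
        rw [map_zero, zero_smul]
        exact zero_mem _
      smul_mem' := fun c a ha => by
        change toK U (c * a) • v ∈ L U
        rw [map_mul, mul_smul]
        exact smul_mem_of_mem_ring _ (toK_mem_ring U c) ha }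
  have hI : ∀ x ∈ U.op, ∃ f ∈ I.radical, x ∈ X.basicOpen f := by
    intro x hx
    obtain ⟨W, hxW, hvW⟩ := h x hx
    obtain ⟨B, f, g, hf, hg, hxB⟩ := U.exists_common_basicOpen W x hx hxW
    obtain ⟨n, hn⟩ := hL.localized U B f hf v (hL.mono_basicOpen W B g hg v hvW)
    refine ⟨f, ⟨n, ?_⟩, hf ▸ hxB⟩
    change toK U (f ^ n) • v ∈ L U
    rwa [map_pow]
  have hsup : ⨆ f : (I.radical : Set Γ(X, U.op)), X.basicOpen (f : Γ(X, U.op)) = U.op := by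
    refine le_antisymm (iSup_le fun f => X.basicOpen_le _) fun x hx => ?_
    obtain ⟨f, hf, hxf⟩ := hI x hx
    exact TopologicalSpace.Opens.mem_iSup.mpr ⟨⟨f, hf⟩, hxf⟩
  rw [U.isAffine.iSup_basicOpen_eq_self_iff, Ideal.span_eq, Ideal.radical_eq_top] at hsup
  have : (1 : Γ(X, U.op)) ∈ I := by rw [hsup]; trivial
  change toK U 1 • v ∈ L U at this
  rwa [map_one, one_smul] at this

theorem mono {U W : AffOpen X} (h : W.op ≤ U.op) {v : V} (hv : v ∈ L U) : v ∈ L W :=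
  hL.mem_of_locally fun _ hx => ⟨U, h hx, hv⟩

end IsQCoh

/-- The product of a family of fractional ideals and a family of submodules. -/
noncomputable def smulFamily (L : ∀ U : AffOpen X, Submodule (ring X U) X.functionField)
    (M : ∀ U : AffOpen X, Submodule (ring X U) V) (U : AffOpen X) : Submodule (ring X U) V :=
  Submodule.span _ {v | ∃ c ∈ L U, ∃ w ∈ M U, c • w = v}

theorem IsQCoh.smul {L : ∀ U : AffOpen X, Submodule (ring X U) X.functionField}
    {M : ∀ U : AffOpen X, Submodule (ring X U) V} (hL : IsQCoh L) (hM : IsQCoh M) :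
    IsQCoh (smulFamily L M) := by
  refine isQCoh_span ?_ ?_
  · rintro U B f h _ ⟨c, hc, w, hw, rfl⟩
    exact Submodule.subset_span ⟨c, hL.mono_basicOpen U B f h c hc, w,
      hM.mono_basicOpen U B f h w hw, rfl⟩
  · rintro U B f h _ ⟨c, hc, w, hw, rfl⟩
    obtain ⟨n, hn⟩ := hL.localized U B f h c hc
    obtain ⟨m, hm⟩ := hM.localized U B f h w hw
    refine ⟨n + m, Submodule.subset_span ⟨_, hn, _, hm, ?_⟩⟩
    rw [smul_eq_mul, smul_smul, smul_smul, pow_add]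
    congr 1
    ring

/-- The powers of a family of fractional ideals. -/
noncomputable def powFamily (L : ∀ U : AffOpen X, Submodule (ring X U) X.functionField) (m : ℕ)
    (U : AffOpen X) : Submodule (ring X U) X.functionField := L U ^ m

theorem isQCoh_one : IsQCoh fun U : AffOpen X => (1 : Submodule (ring X U) X.functionField) where
  mono_basicOpen U B f h v hv := by
    rw [Submodule.mem_one] at hv ⊢
    obtain ⟨y, rfl⟩ := hv
    exact ⟨⟨y, ring_mono (AffOpen.le_of_eq_basicOpen h) y.2⟩, rfl⟩
  localized U B f h v hv := by
    rw [Submodule.mem_one] at hv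
    obtain ⟨y, rfl⟩ := hv
    obtain ⟨n, hn⟩ := ring_basicOpen h y.2
    exact ⟨n, Submodule.mem_one.mpr ⟨⟨_, hn⟩, rfl⟩⟩

theorem IsQCoh.pow {L : ∀ U : AffOpen X, Submodule (ring X U) X.functionField} (hL : IsQCoh L)
    (m : ℕ) : IsQCoh (powFamily L m) := by
  induction m with
  | zero =>
    have : powFamily L 0 = fun U : AffOpen X => (1 : Submodule (ring X U) X.functionField) :=
      funext fun U => pow_zero _
    rw [this]
    exact isQCoh_one
  | succ m ih =>
    have : powFamily L (m + 1) = smulFamily L (powFamily L m) := by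
      funext U
      rw [powFamily, pow_succ', Submodule.mul_eq_span_mul_set]
      rfl
    rw [this]
    exact hL.smul ih

end Families

/-! ### Vector bundles inside their generic fibres -/

section Bundles

variable {X : Scheme.{0}} {E : X.Modules}

theorem res_apply {U V : X.Opens} (h : V ≤ U) (s : Γ(E, U)) :
    res E h s = E.presheaf.map (homOfLE h).op s := rfl

theorem res_res {U V W : X.Opens} (h : V ≤ U) (h' : W ≤ V) (s : Γ(E, U)) :
    res E h' (res E h s) = res E (h'.trans h) s := by
  rw [res_apply, res_apply, res_apply, ← ConcreteCategory.comp_apply, ← Functor.map_comp]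
  rfl

theorem eq_of_res_eq {U : X.Opens} {s t : Γ(E, U)}
    (h : ∀ x ∈ U, ∃ (W : X.Opens) (hW : W ≤ U), x ∈ W ∧ res E hW s = res E hW t) : s = t := by
  choose W hW hx hst using h
  exact TopCat.Sheaf.eq_of_locally_eq' ⟨E.presheaf, E.isSheaf⟩ (fun x : U => W x.1 x.2) U
    (fun x => homOfLE (hW x.1 x.2))
    (fun x hxU => TopologicalSpace.Opens.mem_iSup.mpr ⟨⟨x, hxU⟩, hx x hxU⟩) s t
    (fun x => hst x.1 x.2)

variable [IsIntegral X]

theorem germ_res {U V : AffOpen X} (h : V.op ≤ U.op) (s : Γ(E, U.op)) :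
    germ E V (res E h s) = germ E U s :=
  E.presheaf.germ_res_apply (homOfLE h) _ (genericPoint_mem V) s

theorem germ_add (U : AffOpen X) (s t : Γ(E, U.op)) :
    germ E U (s + t) = germ E U s + germ E U t := map_add _ s t

theorem germ_zero (U : AffOpen X) : germ E U 0 = 0 := map_zero _

theorem germ_sum {ι : Type*} (J : Finset ι) (U : AffOpen X) (s : ι → Γ(E, U.op)) :
    germ E U (∑ i ∈ J, s i) = ∑ i ∈ J, germ E U (s i) := by
  classical
  induction J using Finset.induction_on with
  | empty => exact germ_zero U
  | insert i J hi ih => rw [Finset.sum_insert hi, Finset.sum_insert hi, germ_add, ih]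

/-- A frame of `E` over `U`: a family of sections which is a basis over every smaller open set. -/
def IsFrameOn {r : ℕ} (U : X.Opens) (e : Fin r → Γ(E, U)) : Prop :=
  ∀ (V : X.Opens) (h : V ≤ U), LinearIndependent Γ(X, V) (fun i => res E h (e i)) ∧
    Submodule.span Γ(X, V) (Set.range fun i => res E h (e i)) = ⊤

omit [IsIntegral X] in
theorem IsFrameOn.exists_coordinates {r : ℕ} {U : X.Opens} {e : Fin r → Γ(E, U)}
    (he : IsFrameOn U e) {V : X.Opens} (h : V ≤ U) (s : Γ(E, V)) :
    ∃ a : Fin r → Γ(X, V), s = ∑ i, a i • res E h (e i) := by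
  have : s ∈ Submodule.span Γ(X, V) (Set.range fun i => res E h (e i)) := by
    rw [(he V h).2]
    trivial
  obtain ⟨a, ha⟩ := (Submodule.mem_span_range_iff_exists_fun _).mp this
  exact ⟨a, ha.symm⟩

omit [IsIntegral X] in
theorem res_sum_smul {r : ℕ} {U V W : X.Opens} (h : V ≤ U) (h' : W ≤ V)
    (e : Fin r → Γ(E, U)) (a : Fin r → Γ(X, V)) :
    res E h' (∑ i, a i • res E h (e i)) = ∑ i, resO h' (a i) • res E (h'.trans h) (e i) := by
  rw [map_sum]
  refine Finset.sum_congr rfl fun i _ => ?_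
  rw [LinearMap.map_smulₛₗ, res_res]

/-- A section with zero germ vanishes near the generic point. Its coordinates in a local frame are
functions that vanish on a non-empty open subset of an integral scheme, hence are zero. -/
theorem eq_zero_of_germ_eq_zero {r : ℕ} (hE : IsLocallyFreeOfRank E r) {O : X.Opens}
    (hη : genericPoint X ∈ O) {s : Γ(E, O)} (hs : E.presheaf.germ O (genericPoint X) hη s = 0) :
    s = 0 := by
  obtain ⟨W, hηW, i, j, hW⟩ := E.presheaf.germ_eq (genericPoint X) hη hη s 0 (by rw [hs, map_zero])
  have hWs : res E i.le s = 0 := hW.trans (map_zero _)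
  refine eq_of_res_eq fun x hx => ?_
  obtain ⟨U, hxU, e, he⟩ := hE x
  obtain ⟨B, hxB, hB⟩ := exists_affOpen x (O ⊓ U) ⟨hx, hxU⟩
  have hBO : B.op ≤ O := hB.trans inf_le_left
  have hBU : B.op ≤ U := hB.trans inf_le_right
  refine ⟨B.op, hBO, hxB, ?_⟩
  obtain ⟨a, ha⟩ := IsFrameOn.exists_coordinates he hBU (res E hBO s)
  obtain ⟨B', -, hB'⟩ := exists_affOpen (genericPoint X) (B.op ⊓ W) ⟨genericPoint_mem B, hηW⟩
  have hB'B : B'.op ≤ B.op := hB'.trans inf_le_left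
  have hB'W : B'.op ≤ W := hB'.trans inf_le_right
  have h1 : ∑ i, resO hB'B (a i) • res E (hB'B.trans hBU) (e i) = 0 := by
    rw [← res_sum_smul hBU hB'B, ← ha, res_res, ← res_res i.le hB'W, hWs, map_zero]
  have h2 := Fintype.linearIndependent_iff.mp (he B'.op (hB'B.trans hBU)).1 _ h1
  have h3 : ∀ i, a i = 0 := fun i => toK_injective B (by
    rw [← toK_resO hB'B, h2, map_zero, map_zero])
  rw [ha, map_zero]
  exact Finset.sum_eq_zero fun i _ => by rw [h3, zero_smul]

theorem eq_of_germ_eq {r : ℕ} (hE : IsLocallyFreeOfRank E r) {O : X.Opens}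
    (hη : genericPoint X ∈ O) {s t : Γ(E, O)} (h : E.presheaf.germ O (genericPoint X) hη s =
      E.presheaf.germ O (genericPoint X) hη t) : s = t := by
  rw [← sub_eq_zero]
  refine eq_zero_of_germ_eq_zero hE hη ?_
  rw [map_sub, sub_eq_zero]
  exact h

theorem germ_injective {r : ℕ} (hE : IsLocallyFreeOfRank E r) (U : AffOpen X) :
    Function.Injective (germ E U) :=
  fun _ _ hst => eq_of_germ_eq hE (genericPoint_mem U) hst

variable [X.Over SpecC]

/-- The submodules of the generic fibre defined by a family of submodules of `E`. -/
def germFamily (F : SubmoduleFamily E) (U : AffOpen X) :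
    Submodule (ring X U) (GenericFibre E) where
  carrier := {v | ∃ s ∈ F U, germ E U s = v}
  add_mem' := by
    rintro _ _ ⟨s, hs, rfl⟩ ⟨t, ht, rfl⟩
    exact ⟨s + t, add_mem hs ht, germ_add U s t⟩
  zero_mem' := ⟨0, zero_mem _, germ_zero U⟩
  smul_mem' := by
    rintro ⟨_, ⟨f, rfl⟩⟩ _ ⟨s, hs, rfl⟩
    exact ⟨f • s, (F U).smul_mem f hs, germ_smul E U f s⟩

theorem germ_mem_germFamily {r : ℕ} (hE : IsLocallyFreeOfRank E r) {F : SubmoduleFamily E}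
    {U : AffOpen X} {s : Γ(E, U.op)} : germ E U s ∈ germFamily F U ↔ s ∈ F U :=
  ⟨fun ⟨_, ht, h⟩ => germ_injective hE U h ▸ ht, fun h => ⟨s, h, rfl⟩⟩

/-- Local sections with the same germ `v` agree on overlaps, because germs at the generic point
determine sections; so they glue. -/
theorem mem_germFamily_top_of_locally {r : ℕ} (hE : IsLocallyFreeOfRank E r) {U : AffOpen X}
    {v : GenericFibre E}
    (h : ∀ x ∈ U.op, ∃ W : AffOpen X, W.op ≤ U.op ∧ x ∈ W.op ∧ v ∈ germFamily (⊤ : SubmoduleFamily E) W) :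
    v ∈ germFamily (⊤ : SubmoduleFamily E) U := by
  choose W hWU hxW s _ hs using h
  obtain ⟨t, ht, -⟩ := TopCat.Sheaf.existsUnique_gluing' ⟨E.presheaf, E.isSheaf⟩
    (fun x : U.op => (W x.1 x.2).op) U.op (fun x => homOfLE (hWU x.1 x.2))
    (fun x hxU => TopologicalSpace.Opens.mem_iSup.mpr ⟨⟨x, hxU⟩, hxW x hxU⟩)
    (fun x => s x.1 x.2) (fun x y => by
      refine eq_of_germ_eq hE (O := (W x.1 x.2).op ⊓ (W y.1 y.2).op)
        ⟨genericPoint_mem _, genericPoint_mem _⟩ ?_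
      exact (E.presheaf.germ_res_apply _ _ _ _).trans (((hs x.1 x.2).trans (hs y.1 y.2).symm).trans
        (E.presheaf.germ_res_apply _ _ _ _).symm))
  obtain ⟨x⟩ := U.2.2
  refine ⟨t, trivial, ?_⟩
  rw [← germ_res (hWU x.1 x.2)]
  have := ht x
  change res E _ t = _ at this
  rw [this, hs]

/-- A basis of the generic fibre which generates `E` over the affine open `B`. -/
def IsFrame {r : ℕ} (B : AffOpen X) (b : Module.Basis (Fin r) X.functionField (GenericFibre E)) :
    Prop :=
  ∀ W : AffOpen X, W.op ≤ B.op → ∀ v : GenericFibre E,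
    v ∈ germFamily (⊤ : SubmoduleFamily E) W ↔ ∀ i, b.repr v i ∈ ring X W

theorem exists_isFrame {r : ℕ} (hE : IsLocallyFreeOfRank E r) (x : X) :
    ∃ (B : AffOpen X) (b : Module.Basis (Fin r) X.functionField (GenericFibre E)),
      x ∈ B.op ∧ IsFrame B b := by
  obtain ⟨U, hxU, e, he⟩ := hE x
  obtain ⟨B, hxB, hB⟩ := exists_affOpen x U hxU
  let e' : Fin r → GenericFibre E := fun i => germ E B (res E hB (e i))
  have hgerm : ∀ (W : AffOpen X) (h : W.op ≤ B.op) (a : Fin r → Γ(X, W.op)),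
      germ E W (∑ i, a i • res E (h.trans hB) (e i)) = ∑ i, toK W (a i) • e' i := by
    intro W h a
    rw [germ_sum]
    refine Finset.sum_congr rfl fun i _ => ?_
    rw [germ_smul, ← res_res hB h, germ_res]
  have hli : LinearIndependent X.functionField e' := by
    rw [Fintype.linearIndependent_iff]
    intro c hc
    -- A common denominator turns a relation over the function field into one over `𝒪(B)`, where the
    -- frame is independent.
    obtain ⟨d, hd⟩ := IsLocalization.exist_integer_multiples_of_finite
      (nonZeroDivisors Γ(X, B.op)) c
    choose a ha using hd
    have h1 : germ E B (∑ i, a i • res E (le_rfl.trans hB) (e i)) = 0 := by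
      rw [hgerm B le_rfl]
      have : ∀ i, toK B (a i) • e' i = toK B d • c i • e' i := fun i => by
        rw [smul_smul]
        congr 1
        refine (ha i).trans ?_
        rw [Algebra.smul_def]
      rw [Finset.sum_congr rfl fun i _ => this i, ← Finset.smul_sum, hc, smul_zero]
    have h2 := germ_injective hE B (h1.trans (germ_zero B).symm)
    have h3 := Fintype.linearIndependent_iff.mp (he B.op (le_rfl.trans hB)).1 _ h2
    intro i
    have h4 := ha i
    rw [h3 i, map_zero, eq_comm, Algebra.smul_def] at h4
    exact (mul_eq_zero.mp h4).resolve_left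
      (IsFractionRing.to_map_ne_zero_of_mem_nonZeroDivisors d.2)
  have hsp : ⊤ ≤ Submodule.span X.functionField (Set.range e') := by
    intro v _
    obtain ⟨W, hWB, hηW, s, rfl⟩ := E.presheaf.exists_le_germ_eq v (genericPoint_mem B)
    obtain ⟨B', -, hB'⟩ := exists_affOpen (genericPoint X) W hηW
    obtain ⟨a, ha⟩ := IsFrameOn.exists_coordinates he ((hB'.trans hWB).trans hB) (res E hB' s)
    have h1 : E.presheaf.germ W (genericPoint X) hηW s = germ E B' (res E hB' s) :=
      (E.presheaf.germ_res_apply (homOfLE hB') _ (genericPoint_mem B') s).symm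
    rw [h1, ha, hgerm B' (hB'.trans hWB)]
    exact sum_mem fun i _ => Submodule.smul_mem _ _ (Submodule.subset_span ⟨i, rfl⟩)
  refine ⟨B, Module.Basis.mk hli hsp, hxB, fun W hW v => ⟨?_, fun h => ?_⟩⟩
  · rintro ⟨s, -, rfl⟩ i
    obtain ⟨a, ha⟩ := IsFrameOn.exists_coordinates he (hW.trans hB) s
    rw [ha, hgerm W hW]
    have : ∑ i, toK W (a i) • e' i = ∑ i, toK W (a i) • Module.Basis.mk hli hsp i :=
      Finset.sum_congr rfl fun i _ => by rw [Module.Basis.mk_apply]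
    rw [this, Module.Basis.repr_sum_self]
    exact toK_mem_ring W _
  · choose a ha using h
    refine ⟨∑ i, a i • res E (hW.trans hB) (e i), trivial, ?_⟩
    rw [hgerm W hW]
    conv_rhs => rw [← (Module.Basis.mk hli hsp).sum_repr v]
    refine Finset.sum_congr rfl fun i _ => ?_
    rw [Module.Basis.mk_apply, ← ha i]
    rfl

end Bundles

/-! ### Coherent subsheaves, ranks and saturations -/

section Coherence

variable {X : Scheme.{0}} [IsIntegral X] [X.Over SpecC] {E : X.Modules}

theorem finite_genericFibre {r : ℕ} (hE : IsLocallyFreeOfRank E r) :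
    Module.Finite X.functionField (GenericFibre E) ∧
      Module.finrank X.functionField (GenericFibre E) = r := by
  obtain ⟨B, b, -, -⟩ := exists_isFrame hE (genericPoint X)
  exact ⟨Module.Finite.of_basis b, by rw [Module.finrank_eq_card_basis b, Fintype.card_fin]⟩

omit [X.Over SpecC] in
theorem AffOpen.exists_inf (U : AffOpen X) (f : Γ(X, U.op)) {B C : AffOpen X}
    (hB : B.op = X.basicOpen f) (hC : C.op ≤ U.op) :
    ∃ D : AffOpen X, D.op = X.basicOpen (resO hC f) ∧ D.op ≤ B.op ∧ D.op ≤ C.op := by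
  have h : X.basicOpen (resO hC f) = C.op ⊓ B.op := by
    rw [hB]
    exact Scheme.basicOpen_res X f (homOfLE hC).op
  refine ⟨⟨X.basicOpen (resO hC f), C.isAffine.basicOpen _, ?_⟩, rfl, ?_, ?_⟩
  · rw [h]
    exact ⟨⟨genericPoint X, genericPoint_mem C, genericPoint_mem B⟩⟩
  · exact h.trans_le inf_le_right
  · exact h.trans_le inf_le_left

/-- On a small affine open with a frame, denominators are cleared coordinate by coordinate.
Compactness of `U` makes the exponent uniform, and the resulting local sections glue. -/
theorem isQCoh_germFamily_top {r : ℕ} (hE : IsLocallyFreeOfRank E r) :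
    IsQCoh (germFamily (⊤ : SubmoduleFamily E)) where
  mono_basicOpen := by
    rintro U B f h _ ⟨s, -, rfl⟩
    exact ⟨res E (AffOpen.le_of_eq_basicOpen h) s, trivial, germ_res _ s⟩
  localized := by
    intro U B f h v hv
    have key : ∀ x ∈ U.op, ∃ (C : AffOpen X) (n : ℕ), x ∈ C.op ∧ C.op ≤ U.op ∧
        toK U f ^ n • v ∈ germFamily (⊤ : SubmoduleFamily E) C := by
      intro x hx
      obtain ⟨W, b, hxW, hb⟩ := exists_isFrame hE x
      obtain ⟨C, hxC, hC⟩ := exists_affOpen x (U.op ⊓ W.op) ⟨hx, hxW⟩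
      have hCU : C.op ≤ U.op := hC.trans inf_le_left
      have hCW : C.op ≤ W.op := hC.trans inf_le_right
      obtain ⟨D, hD, hDB, hDC⟩ := AffOpen.exists_inf U f h hCU
      have hvD : v ∈ germFamily (⊤ : SubmoduleFamily E) D := by
        obtain ⟨s, -, rfl⟩ := hv
        exact ⟨res E hDB s, trivial, germ_res _ s⟩
      have h1 := (hb D (hDC.trans hCW) v).mp hvD
      choose n hn using fun i => ring_basicOpen hD (h1 i)
      refine ⟨C, Finset.univ.sup n, hxC, hCU, (hb C hCW _).mpr fun i => ?_⟩
      rw [map_smul, Finsupp.smul_apply, smul_eq_mul]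
      obtain ⟨d, hd⟩ := Nat.exists_eq_add_of_le (Finset.le_sup (f := n) (Finset.mem_univ i))
      rw [hd, add_comm, pow_add, mul_assoc, ← toK_resO hCU]
      exact mul_mem (pow_mem (toK_mem_ring C _) d) (hn i)
    choose C n hxC hCU hmem using key
    obtain ⟨t, ht⟩ := U.isAffine.isCompact.elim_nhds_subcover' (fun x hx => ((C x hx).op : Set X))
      (fun x hx => (C x hx).op.isOpen.mem_nhds (hxC x hx))
    refine ⟨t.sup fun x => n x.1 x.2, mem_germFamily_top_of_locally hE fun x hx => ?_⟩
    obtain ⟨y, hy, hxy⟩ := Set.mem_iUnion₂.mp (ht hx)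
    refine ⟨C y.1 y.2, hCU _ _, hxy, ?_⟩
    have h1 := hmem y.1 y.2
    rw [← toK_resO (hCU y.1 y.2)] at h1 ⊢
    exact pow_smul_mem_of_le _ _ (Finset.le_sup (f := fun x : U.op => n x.1 x.2) hy) h1

/-- This moves all questions about coherent subsheaves into the single vector space `E_η`;
injectivity of germs loses no information. -/
theorem isCoherentSubsheaf_iff {r : ℕ} (hE : IsLocallyFreeOfRank E r) (F : SubmoduleFamily E) :
    IsCoherentSubsheaf F ↔ IsQCoh (germFamily F) := by
  constructor
  · intro hF
    constructor
    · rintro U B f h _ ⟨s, hs, rfl⟩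
      refine ⟨res E (AffOpen.le_of_eq_basicOpen h) s, ?_, germ_res _ s⟩
      rw [hF U B f h]
      exact Submodule.subset_span ⟨s, hs, rfl⟩
    · rintro U B f h _ ⟨s, hs, rfl⟩
      rw [hF U B f h] at hs
      induction hs using Submodule.span_induction with
      | mem s hs =>
        obtain ⟨t, ht, rfl⟩ := hs
        exact ⟨0, t, ht, by rw [pow_zero, one_smul, germ_res]⟩
      | zero => exact ⟨0, by rw [germ_zero, smul_zero]; exact zero_mem _⟩
      | add s t _ _ hs ht =>
        obtain ⟨n, hn⟩ := hs
        obtain ⟨m, hm⟩ := ht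
        refine ⟨max n m, ?_⟩
        rw [germ_add, smul_add]
        exact add_mem (pow_smul_mem_of_le _ f (le_max_left _ _) hn)
          (pow_smul_mem_of_le _ f (le_max_right _ _) hm)
      | smul c s _ hs =>
        obtain ⟨n, hn⟩ := hs
        obtain ⟨m, hm⟩ := ring_basicOpen h (toK_mem_ring B c)
        refine ⟨m + n, ?_⟩
        have : toK U f ^ (m + n) • germ E B (c • s) =
            (toK U f ^ m * toK B c) • toK U f ^ n • germ E B s := by
          rw [germ_smul, smul_smul, smul_smul]
          congr 1
          ring
        rw [this]
        exact smul_mem_of_mem_ring _ hm hn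
  · intro hF U B f h
    apply le_antisymm
    · intro s hs
      obtain ⟨n, t, ht, hts⟩ := hF.localized U B f h (germ E B s) ⟨s, hs, rfl⟩
      obtain ⟨u, hu⟩ := isUnit_resO h
      have h1 : (u : Γ(X, B.op)) ^ n • s = res E (AffOpen.le_of_eq_basicOpen h) t := by
        apply germ_injective hE
        rw [germ_res, hts, germ_smul, hu, map_pow]
        congr 2
        exact toK_resO (AffOpen.le_of_eq_basicOpen h) f
      have h2 : s = ((u⁻¹ : (Γ(X, B.op))ˣ) : Γ(X, B.op)) ^ n •
          res E (AffOpen.le_of_eq_basicOpen h) t := by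
        rw [← h1, smul_smul, ← mul_pow, Units.inv_mul, one_pow, one_smul]
      rw [h2]
      exact Submodule.smul_mem _ _ (Submodule.subset_span ⟨t, ht, rfl⟩)
    · refine Submodule.span_le.mpr ?_
      rintro _ ⟨s, hs, rfl⟩
      have := hF.mono_basicOpen U B f h _ ⟨s, hs, rfl⟩
      rw [← germ_res (AffOpen.le_of_eq_basicOpen h)] at this
      exact (germ_mem_germFamily hE).mp this

theorem isCoherentSubsheaf_top {r : ℕ} (hE : IsLocallyFreeOfRank E r) :
    IsCoherentSubsheaf (⊤ : SubmoduleFamily E) :=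
  (isCoherentSubsheaf_iff hE _).mpr (isQCoh_germFamily_top hE)

/-- The generic fibre of a subsheaf. -/
noncomputable def genericSpan (F : SubmoduleFamily E) : Submodule X.functionField (GenericFibre E) :=
  Submodule.span X.functionField {v : GenericFibre E | ∃ U, ∃ s ∈ F U, germ E U s = v}

omit [X.Over SpecC] in
theorem rank_eq (F : SubmoduleFamily E) :
    rank F = Module.finrank X.functionField (genericSpan F) := rfl

omit [X.Over SpecC] in
theorem germ_mem_genericSpan {F : SubmoduleFamily E} {U : AffOpen X} {s : Γ(E, U.op)}
    (hs : s ∈ F U) : germ E U s ∈ genericSpan F := Submodule.subset_span ⟨U, s, hs, rfl⟩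

omit [X.Over SpecC] in
theorem genericSpan_mono {F G : SubmoduleFamily E} (h : F ≤ G) : genericSpan F ≤ genericSpan G :=
  Submodule.span_mono fun _ ⟨U, s, hs, e⟩ => ⟨U, s, h U hs, e⟩

/-- A quasi-coherent family generates the same subspace of the generic fibre over every affine
open. -/
theorem genericSpan_le_span {F : SubmoduleFamily E} (hF : IsQCoh (germFamily F)) (U : AffOpen X) :
    genericSpan F ≤ Submodule.span X.functionField (germFamily F U : Set (GenericFibre E)) := by
  refine Submodule.span_le.mpr ?_
  rintro _ ⟨W, s, hs, rfl⟩
  obtain ⟨B, f, g, hf, hg, -⟩ := U.exists_common_basicOpen W (genericPoint X) (genericPoint_mem U)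
    (genericPoint_mem W)
  obtain ⟨n, hn⟩ := hF.localized U B f hf _ (hF.mono_basicOpen W B g hg _ ⟨s, hs, rfl⟩)
  have h0 : toK U f ^ n ≠ 0 := pow_ne_zero _ (toK_ne_zero hf)
  rw [SetLike.mem_coe, ← inv_smul_smul₀ h0 (germ E W s)]
  exact Submodule.smul_mem _ _ (Submodule.subset_span hn)

/-- An element of the generic fibre of `F` is a fraction of an element of `F(U)`. -/
theorem exists_smul_mem {F : SubmoduleFamily E} (hF : IsQCoh (germFamily F)) (U : AffOpen X)
    {v : GenericFibre E} (hv : v ∈ genericSpan F) :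
    ∃ q : Γ(X, U.op), q ≠ 0 ∧ toK U q • v ∈ germFamily F U := by
  replace hv := genericSpan_le_span hF U hv
  induction hv using Submodule.span_induction with
  | mem v hv => exact ⟨1, one_ne_zero, by rwa [map_one, one_smul]⟩
  | zero => exact ⟨1, one_ne_zero, by rw [smul_zero]; exact zero_mem _⟩
  | add v w _ _ hv hw =>
    obtain ⟨p, hp, hpv⟩ := hv
    obtain ⟨q, hq, hqw⟩ := hw
    refine ⟨p * q, mul_ne_zero hp hq, ?_⟩
    rw [smul_add, map_mul, mul_comm, mul_smul, mul_smul]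
    refine add_mem (smul_mem_of_mem_ring _ (toK_mem_ring U q) hpv) ?_
    rw [smul_comm]
    exact smul_mem_of_mem_ring _ (toK_mem_ring U p) hqw
  | smul c v _ hv =>
    obtain ⟨p, hp, hpv⟩ := hv
    obtain ⟨a, d, hd, rfl⟩ := IsFractionRing.div_surjective (A := Γ(X, U.op)) c
    have hd0 : toK U d ≠ 0 := IsFractionRing.to_map_ne_zero_of_mem_nonZeroDivisors hd
    refine ⟨d * p, mul_ne_zero (nonZeroDivisors.ne_zero hd) hp, ?_⟩
    have : toK U (d * p) • (toK U a / toK U d) • v = toK U a • toK U p • v := by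
      rw [smul_smul, smul_smul, map_mul]
      congr 1
      field_simp
    rw [this]
    exact smul_mem_of_mem_ring _ (toK_mem_ring U a) hpv

theorem genericSpan_top {r : ℕ} (hE : IsLocallyFreeOfRank E r) :
    genericSpan (⊤ : SubmoduleFamily E) = ⊤ := by
  obtain ⟨B, b, -, hb⟩ := exists_isFrame hE (genericPoint X)
  rw [eq_top_iff, ← b.span_eq]
  refine Submodule.span_le.mpr ?_
  rintro _ ⟨i, rfl⟩
  have h1 : b i ∈ germFamily (⊤ : SubmoduleFamily E) B := (hb B le_rfl _).mpr fun j => by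
    rw [Module.Basis.repr_self, Finsupp.single_apply]
    split_ifs
    exacts [one_mem _, zero_mem _]
  obtain ⟨s, hs, h⟩ := h1
  rw [← h]
  exact germ_mem_genericSpan hs

theorem rank_top {r : ℕ} (hE : IsLocallyFreeOfRank E r) : rank (⊤ : SubmoduleFamily E) = r := by
  rw [rank_eq, genericSpan_top hE, finrank_top]
  exact (finite_genericFibre hE).2

theorem rank_le {r : ℕ} (hE : IsLocallyFreeOfRank E r) {F G : SubmoduleFamily E} (h : F ≤ G) :
    rank F ≤ rank G := by
  have := (finite_genericFibre hE).1
  exact Submodule.finrank_mono (genericSpan_mono h)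

theorem rank_pos {r : ℕ} (hE : IsLocallyFreeOfRank E r) {F : SubmoduleFamily E} (hF : F ≠ ⊥) :
    0 < rank F := by
  have := (finite_genericFibre hE).1
  rw [rank_eq, Module.finrank_pos_iff, Submodule.nontrivial_iff_ne_bot]
  intro hbot
  refine hF (funext fun U => (Submodule.eq_bot_iff _).mpr fun s hs => ?_)
  have h := germ_mem_genericSpan hs
  rw [hbot, Submodule.mem_bot] at h
  exact germ_injective hE U (h.trans (germ_zero U).symm)

/-- The saturation of a subsheaf. -/
def saturation (F : SubmoduleFamily E) (U : AffOpen X) : Submodule Γ(X, U.op) Γ(E, U.op) where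
  carrier := {s | germ E U s ∈ genericSpan F}
  add_mem' := fun {s t} hs ht => by
    rw [Set.mem_ofPred_eq, germ_add]
    exact add_mem hs ht
  zero_mem' := by
    rw [Set.mem_ofPred_eq, germ_zero]
    exact zero_mem _
  smul_mem' := fun c s hs => by
    rw [Set.mem_ofPred_eq, germ_smul]
    exact Submodule.smul_mem _ _ hs

omit [X.Over SpecC] in
theorem mem_saturation {F : SubmoduleFamily E} {U : AffOpen X} {s : Γ(E, U.op)} :
    s ∈ saturation F U ↔ germ E U s ∈ genericSpan F := Iff.rfl

omit [X.Over SpecC] in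
theorem le_saturation (F : SubmoduleFamily E) : F ≤ saturation F :=
  fun _ _ hs => germ_mem_genericSpan hs

omit [X.Over SpecC] in
theorem genericSpan_saturation (F : SubmoduleFamily E) :
    genericSpan (saturation F) = genericSpan F := by
  refine le_antisymm (Submodule.span_le.mpr ?_) (genericSpan_mono (le_saturation F))
  rintro _ ⟨U, s, hs, rfl⟩
  exact hs

omit [X.Over SpecC] in
theorem rank_saturation (F : SubmoduleFamily E) : rank (saturation F) = rank F := by
  rw [rank_eq, rank_eq, genericSpan_saturation]

theorem isQCoh_germFamily_saturation {r : ℕ} (hE : IsLocallyFreeOfRank E r)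
    (F : SubmoduleFamily E) : IsQCoh (germFamily (saturation F)) where
  mono_basicOpen := by
    rintro U B f h _ ⟨s, hs, rfl⟩
    refine ⟨res E (AffOpen.le_of_eq_basicOpen h) s, ?_, germ_res _ s⟩
    rw [mem_saturation, germ_res]
    exact hs
  localized := by
    rintro U B f h _ ⟨s, hs, rfl⟩
    obtain ⟨n, t, -, ht⟩ := (isQCoh_germFamily_top hE).localized U B f h (germ E B s)
      ⟨s, trivial, rfl⟩
    refine ⟨n, t, ?_, ht⟩
    rw [mem_saturation, ht]
    exact Submodule.smul_mem _ _ hs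

theorem isCoherentSubsheaf_saturation {r : ℕ} (hE : IsLocallyFreeOfRank E r)
    (F : SubmoduleFamily E) : IsCoherentSubsheaf (saturation F) :=
  (isCoherentSubsheaf_iff hE _).mpr (isQCoh_germFamily_saturation hE F)

end Coherence

/-! ### Powers of an ample line bundle as fractional ideals -/

section LineBundles

variable {X : Scheme.{0}} [IsIntegral X] [X.Over SpecC]

/-- The image of a family of submodules under a linear map. -/
noncomputable def mapFamily {V W : Type} [AddCommGroup V] [Module X.functionField V]
    [AddCommGroup W] [Module X.functionField W] (ψ : V →ₗ[X.functionField] W)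
    (L : ∀ U : AffOpen X, Submodule (ring X U) V) (U : AffOpen X) : Submodule (ring X U) W :=
  (L U).map (ψ.restrictScalars (ring X U))

theorem IsQCoh.map {V W : Type} [AddCommGroup V] [Module X.functionField V]
    [AddCommGroup W] [Module X.functionField W] (ψ : V →ₗ[X.functionField] W)
    {L : ∀ U : AffOpen X, Submodule (ring X U) V} (hL : IsQCoh L) : IsQCoh (mapFamily ψ L) where
  mono_basicOpen := by
    rintro U B f h _ ⟨v, hv, rfl⟩
    exact ⟨v, hL.mono_basicOpen U B f h v hv, rfl⟩
  localized := by
    rintro U B f h _ ⟨v, hv, rfl⟩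
    obtain ⟨n, hn⟩ := hL.localized U B f h v hv
    exact ⟨n, _, hn, ψ.map_smul _ _⟩

variable {H : X.Modules} (θ : GenericFibre H ≃ₗ[X.functionField] X.functionField)

/-- A line bundle with trivialized generic fibre, as a family of fractional ideals. -/
noncomputable def lineFamily (U : AffOpen X) : Submodule (ring X U) X.functionField :=
  mapFamily θ.toLinearMap (germFamily (⊤ : SubmoduleFamily H)) U

theorem mem_lineFamily {U : AffOpen X} {c : X.functionField} :
    c ∈ lineFamily θ U ↔ ∃ s : Γ(H, U.op), θ (germ H U s) = c := by
  constructor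
  · rintro ⟨_, ⟨s, -, rfl⟩, rfl⟩
    exact ⟨s, rfl⟩
  · rintro ⟨s, rfl⟩
    exact ⟨_, ⟨s, trivial, rfl⟩, rfl⟩

/-- The sections of the powers of a line bundle, as rational functions. -/
noncomputable def lineSections (m : ℕ) : Submodule ℂ X.functionField where
  carrier := {c | ∀ U : AffOpen X, c ∈ powFamily (lineFamily θ) m U}
  add_mem' := fun ha hb U => add_mem (ha U) (hb U)
  zero_mem' := fun _ => zero_mem _
  smul_mem' := fun c _ hv U => (powFamily (lineFamily θ) m U).smul_mem (algebraMap ℂ (ring X U) c) (hv U)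

theorem isSectionRing_lineSections : IsSectionRing (lineSections θ) where
  one_mem U := by
    rw [powFamily, pow_zero]
    exact Submodule.one_le.mp le_rfl
  mul_mem ha hb U := by
    rw [powFamily, pow_add]
    exact Submodule.mul_mem_mul (ha U) (hb U)

variable {θ} in
theorem isQCoh_lineFamily (hH : IsLineBundle H) : IsQCoh (lineFamily θ) :=
  (isQCoh_germFamily_top hH).map _

theorem exists_lineFamily_generator (hH : IsLineBundle H) (x : X) :
    ∃ (B : AffOpen X) (e : X.functionField), x ∈ B.op ∧ e ≠ 0 ∧
      ∀ W : AffOpen X, W.op ≤ B.op → lineFamily θ W = Submodule.span _ {e} := by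
  obtain ⟨B, b, hxB, hb⟩ := exists_isFrame hH x
  refine ⟨B, θ (b 0), hxB, (map_ne_zero_iff _ θ.injective).mpr (b.ne_zero 0), fun W hW => ?_⟩
  have hrepr : ∀ v, v = b.repr v 0 • b 0 := fun v => by
    conv_lhs => rw [← b.sum_repr v]
    rw [Fin.sum_univ_one]
  ext c
  rw [Submodule.mem_span_singleton]
  constructor
  · rintro ⟨v, hv, rfl⟩
    refine ⟨⟨_, (hb W hW v).mp hv 0⟩, ?_⟩
    change b.repr v 0 • θ (b 0) = θ v
    rw [← map_smul, ← hrepr]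
  · rintro ⟨a, rfl⟩
    refine ⟨(a : X.functionField) • b 0, (hb W hW _).mpr fun i => ?_, ?_⟩
    · rw [map_smul, Module.Basis.repr_self, Subsingleton.elim i 0, Finsupp.smul_single,
        Finsupp.single_eq_same, smul_eq_mul, mul_one]
      exact a.2
    · exact θ.map_smul _ _

theorem exists_ne_zero_mem_lineFamily (hH : IsLineBundle H) (U : AffOpen X) :
    ∃ c ∈ lineFamily θ U, c ≠ 0 := by
  by_contra! hcon
  have h1 : ∀ v ∈ germFamily (⊤ : SubmoduleFamily H) U, v = 0 := fun v hv =>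
    θ.map_eq_zero_iff.mp (hcon _ ⟨v, hv, rfl⟩)
  have h2 := genericSpan_le_span (isQCoh_germFamily_top hH) U
  rw [genericSpan_top hH, Submodule.span_eq_bot.mpr h1] at h2
  have h3 : θ.symm 1 ∈ (⊤ : Submodule X.functionField (GenericFibre H)) := trivial
  have := h2 h3
  rw [Submodule.mem_bot, LinearEquiv.map_eq_zero_iff] at this
  exact one_ne_zero this

theorem ne_zero_of_powFamily_eq_span (hH : IsLineBundle H) {U : AffOpen X} {m : ℕ}
    {σ : X.functionField} (h : powFamily (lineFamily θ) m U = Submodule.span _ {σ}) : σ ≠ 0 := by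
  rintro rfl
  obtain ⟨c, hc, hc0⟩ := exists_ne_zero_mem_lineFamily θ hH U
  have : c ^ m ∈ powFamily (lineFamily θ) m U := Submodule.pow_mem_pow _ hc m
  rw [h, Submodule.span_zero_singleton, Submodule.mem_bot] at this
  exact pow_ne_zero m hc0 this

theorem powFamily_mul_eq_span {L : ∀ U : AffOpen X, Submodule (ring X U) X.functionField}
    {U : AffOpen X} {m : ℕ} {σ : X.functionField} (h : powFamily L m U = Submodule.span _ {σ})
    (d : ℕ) : powFamily L (m * d) U = Submodule.span _ {σ ^ d} := by
  rw [powFamily, pow_mul, ← powFamily, h, Submodule.span_pow, Set.singleton_pow]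

/-- A section `σ` of a power of the line bundle that generates it locally on an affine open set
which contains all the points where this happens. -/
structure IsAmpleSection (m : ℕ) (σ : X.functionField) (W : AffOpen X) : Prop where
  pos : 0 < m
  mem : σ ∈ lineSections θ m
  generates : ∀ y ∈ W.op, ∃ U : AffOpen X, y ∈ U.op ∧
    powFamily (lineFamily θ) m U = Submodule.span _ {σ}
  mem_of_generates : ∀ (y : X) (U : AffOpen X), y ∈ U.op →
    powFamily (lineFamily θ) m U = Submodule.span _ {σ} → y ∈ W.op

variable {θ}

namespace IsAmpleSection

variable {m : ℕ} {σ : X.functionField} {W : AffOpen X} (h : IsAmpleSection θ m σ W)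
include h

theorem ne_zero (hH : IsLineBundle H) : σ ≠ 0 := by
  obtain ⟨U, -, hU⟩ := h.generates _ (genericPoint_mem W)
  exact ne_zero_of_powFamily_eq_span θ hH hU

/-- Near `x` write `σ = f e^m` with `e` a local generator of the line bundle. Where `f` is
invertible `σ` generates, so `D(f)` lies in `W` and the poles of `q` are cleared by a power of `f`.
-/
theorem exists_mul_mem_locally (hH : IsLineBundle H) {q : X.functionField} (hq : q ∈ ring X W)
    (x : X) : ∃ (B : AffOpen X) (n : ℕ), x ∈ B.op ∧
      ∀ k, n ≤ k → σ ^ k * q ∈ powFamily (lineFamily θ) (m * k) B := by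
  obtain ⟨B, e, hxB, he0, he⟩ := exists_lineFamily_generator θ hH x
  have hpow : ∀ (d : ℕ) (W' : AffOpen X), W'.op ≤ B.op →
      powFamily (lineFamily θ) d W' = Submodule.span _ {e ^ d} := fun d W' hW' => by
    rw [powFamily, he W' hW', Submodule.span_pow, Set.singleton_pow]
  have h1 := h.mem B
  rw [hpow m B le_rfl, Submodule.mem_span_singleton] at h1
  obtain ⟨⟨_, f, rfl⟩, hf⟩ := h1
  replace hf : toK B f * e ^ m = σ := hf
  have hf0 : f ≠ 0 := by
    rintro rfl
    rw [map_zero, zero_mul] at hf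
    exact h.ne_zero hH hf.symm
  have hne : Nonempty (X.basicOpen f) := by
    by_contra hem
    refine hf0 ((basicOpen_eq_bot_iff f).mp ?_)
    ext y
    exact iff_of_false (fun hy => hem ⟨⟨y, hy⟩⟩) (fun hy => hy)
  let C : AffOpen X := ⟨X.basicOpen f, B.isAffine.basicOpen f, hne⟩
  have hC : C.op = X.basicOpen f := rfl
  have hCB := AffOpen.le_of_eq_basicOpen hC
  have hCW : C.op ≤ W.op := by
    intro y hy
    refine h.mem_of_generates y C hy ?_
    rw [hpow m C hCB]
    refine le_antisymm ?_ ?_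
    · rw [Submodule.span_singleton_le_iff_mem, Submodule.mem_span_singleton]
      refine ⟨⟨_, inv_toK_mem_ring hC⟩, ?_⟩
      change (toK B f)⁻¹ * σ = _
      rw [← hf, inv_mul_cancel_left₀ (toK_ne_zero hC)]
    · rw [Submodule.span_singleton_le_iff_mem, Submodule.mem_span_singleton]
      refine ⟨⟨_, ring_mono hCB (toK_mem_ring B f)⟩, hf⟩
  obtain ⟨n, hn⟩ := ring_basicOpen hC (ring_mono hCW hq)
  refine ⟨B, n, hxB, fun k hk => ?_⟩
  rw [hpow _ B le_rfl, Submodule.mem_span_singleton]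
  obtain ⟨d, rfl⟩ := Nat.exists_eq_add_of_le hk
  refine ⟨⟨_, mul_mem (pow_mem (toK_mem_ring B f) d) hn⟩, ?_⟩
  change toK B f ^ d * (toK B f ^ n * q) * e ^ (m * (n + d)) = _
  rw [← hf, mul_pow, ← pow_mul, pow_add (toK B f)]
  ring

theorem exists_mul_mem [CompactSpace X] (hH : IsLineBundle H) {q : X.functionField}
    (hq : q ∈ ring X W) : ∃ n : ℕ, ∀ k, n ≤ k → σ ^ k * q ∈ lineSections θ (m * k) := by
  choose B n hxB hB using h.exists_mul_mem_locally hH hq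
  obtain ⟨t, ht⟩ := isCompact_univ.elim_nhds_subcover (fun x => ((B x).op : Set X))
    (fun x _ => (B x).op.isOpen.mem_nhds (hxB x))
  refine ⟨t.sup n, fun k hk U => ?_⟩
  refine ((isQCoh_lineFamily hH).pow (m * k)).mem_of_locally fun x _ => ?_
  obtain ⟨y, hy, hxy⟩ := Set.mem_iUnion₂.mp (ht.2 (Set.mem_univ x))
  exact ⟨B y, hxy, hB y k ((Finset.le_sup hy).trans hk)⟩

/-- Write `g` as a fraction of two functions on `W`, and multiply both by one large power of `σ`. -/
theorem exists_denominator [CompactSpace X] (hH : IsLineBundle H) (g : X.functionField) :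
    ∃ a, ∃ Q ∈ lineSections θ a, Q ≠ 0 ∧ Q * g ∈ lineSections θ a := by
  obtain ⟨p, q, hq, rfl⟩ := IsFractionRing.div_surjective (A := Γ(X, W.op)) g
  have hq0 : toK W q ≠ 0 := IsFractionRing.to_map_ne_zero_of_mem_nonZeroDivisors hq
  obtain ⟨n, hn⟩ := h.exists_mul_mem hH (toK_mem_ring W q)
  obtain ⟨n', hn'⟩ := h.exists_mul_mem hH (toK_mem_ring W p)
  refine ⟨_, _, hn (max n n') (le_max_left _ _), mul_ne_zero (pow_ne_zero _ (h.ne_zero hH)) hq0, ?_⟩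
  have : σ ^ max n n' * toK W q * (toK W p / toK W q) = σ ^ max n n' * toK W p := by
    field_simp
  rw [this]
  exact hn' _ (le_max_right _ _)

end IsAmpleSection

/-- Finitely many of the `W` cover `X`, and powers bring their sections to the common degree `N`,
the product of the `m`. The centre of a valuation ring lies in one of the `W`, whose section
generates near the centre; dividing by it leaves a regular function there. -/
theorem exists_dominates [CompactSpace X] (hproper : IsProper (X ↘ SpecC)) (hH : IsLineBundle H)
    (h : ∀ x : X, ∃ m σ, ∃ W : AffOpen X, x ∈ W.op ∧ IsAmpleSection θ m σ W) :
    ∃ (N l : ℕ) (σ : Fin l → X.functionField), 0 < N ∧ (∀ j, σ j ∈ lineSections θ N) ∧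
      Dominates (lineSections θ) N σ := by
  choose m σ W hxW hW using h
  obtain ⟨t, ht⟩ := isCompact_univ.elim_nhds_subcover (fun x => ((W x).op : Set X))
    (fun x _ => (W x).op.isOpen.mem_nhds (hxW x))
  have hN : ∀ x ∈ t, m x ∣ ∏ y ∈ t, m y := fun x hx => Finset.dvd_prod_of_mem m hx
  set N := ∏ y ∈ t, m y with hNdef
  have hS := isSectionRing_lineSections θ
  refine ⟨N, t.card, fun j => σ (t.equivFin.symm j) ^ (N / m (t.equivFin.symm j)),
    Finset.prod_pos fun x _ => (hW x).pos, fun j => ?_, fun V hV => ?_⟩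
  · have := hS.pow_mem (hW (t.equivFin.symm j)).mem (N / m (t.equivFin.symm j))
    rwa [Nat.mul_div_cancel' (hN _ (t.equivFin.symm j).2)] at this
  · obtain ⟨x, hx⟩ := exists_center hproper V hV
    obtain ⟨y, hy, hxy⟩ := Set.mem_iUnion₂.mp (ht.2 (Set.mem_univ x))
    obtain ⟨U, hxU, hU⟩ := (hW y).generates x hxy
    refine ⟨t.equivFin ⟨y, hy⟩, ?_⟩
    beta_reduce
    rw [Equiv.symm_apply_apply]
    have h0 := (hW y).ne_zero hH
    refine ⟨pow_ne_zero _ h0, fun a s hs => ?_⟩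
    have h1 := hS.pow_mem hs N U
    rw [← Nat.mul_div_cancel' (hN y hy), mul_left_comm,
      powFamily_mul_eq_span hU, Submodule.mem_span_singleton] at h1
    obtain ⟨⟨_, f, rfl⟩, hf⟩ := h1
    replace hf : toK U f * σ y ^ (a * (N / m y)) = s ^ (m y * (N / m y)) := hf
    rw [Nat.mul_div_cancel' (hN y hy)] at hf
    rw [← hf, ← pow_mul, mul_comm (N / m y) a, mul_div_cancel_right₀ _ (pow_ne_zero _ h0)]
    exact hx U hxU f

end LineBundles

/-! ### From tensor powers and twists to subspaces of `K` and `K^r` -/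

section Transfer

variable {X : Scheme.{0}} [IsIntegral X] [X.Over SpecC]

theorem h0_eq_finrank {V W : Type} [AddCommGroup V] [Module X.functionField V] [AddCommGroup W]
    [Module ℂ W] (L : ∀ U : AffOpen X, Submodule (ring X U) V) (S : Submodule ℂ W) (e : V ≃+ W)
    (he : ∀ (c : ℂ) v, e (algebraMap ℂ X.functionField c • v) = c • e v)
    (hS : ∀ v, (∀ U, v ∈ L U) ↔ e v ∈ S) : h0 L = Module.finrank ℂ S := by
  let _ := Module.compHom V (algebraMap ℂ X.functionField)
  refine LinearEquiv.finrank_eq (LinearEquiv.ofBijective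
    ({ toFun := fun v => ⟨e v.1, (hS v.1).mp v.2⟩
       map_add' := fun v w => Subtype.ext (e.map_add v.1 w.1)
       map_smul' := fun c v => Subtype.ext (he c v.1) } : globalSections L →ₗ[ℂ] S) ⟨?_, ?_⟩)
  · intro v w h
    exact Subtype.ext (e.injective (congrArg Subtype.val h))
  · intro w
    refine ⟨⟨e.symm w, (hS _).mpr ?_⟩, Subtype.ext (e.apply_symm_apply _)⟩
    rw [e.apply_symm_apply]
    exact w.2

variable {H E : X.Modules} (θ : GenericFibre H ≃ₗ[X.functionField] X.functionField)

/-- The trivialization of the tensor power of a line that is induced by a trivialization. -/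
noncomputable def powTrivialization (m : ℕ) :
    (⨂[X.functionField]^m (GenericFibre H)) ≃ₗ[X.functionField] X.functionField :=
  LinearEquiv.ofLinearMap
    (PiTensorProduct.lift ((MultilinearMap.mkPiAlgebra X.functionField (Fin m)
      X.functionField).compLinearMap fun _ => θ.toLinearMap))
    (LinearMap.toSpanSingleton X.functionField _
      (PiTensorProduct.tprod X.functionField fun _ => θ.symm 1))
    (by
      refine LinearMap.ext_ring ?_
      simp)
    (by
      refine PiTensorProduct.ext (MultilinearMap.ext fun v => ?_)
      have : v = fun i => θ (v i) • θ.symm 1 := funext fun i => by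
        rw [← map_smul, smul_eq_mul, mul_one, LinearEquiv.symm_apply_apply]
      conv_rhs => rw [this]
      simp [MultilinearMap.map_smul_univ])

omit [X.Over SpecC] in
theorem powTrivialization_tprod {m : ℕ} (v : Fin m → GenericFibre H) :
    powTrivialization θ m (PiTensorProduct.tprod X.functionField v) = ∏ i, θ (v i) := by
  simp [powTrivialization]

theorem map_linePow (m : ℕ) (U : AffOpen X) :
    (linePow H m U).map ((powTrivialization θ m).toLinearMap.restrictScalars (ring X U)) =
      powFamily (lineFamily θ) m U := by
  rw [linePow, Submodule.map_span, powFamily, Submodule.pow_eq_span_pow_set]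
  congr 1
  ext c
  rw [Set.mem_pow]
  constructor
  · rintro ⟨_, ⟨t, rfl⟩, rfl⟩
    refine ⟨fun i => ⟨θ (germ H U (t i)), (mem_lineFamily θ).mpr ⟨t i, rfl⟩⟩, ?_⟩
    rw [List.prod_ofFn]
    exact (powTrivialization_tprod θ _).symm
  · rintro ⟨f, rfl⟩
    choose t ht using fun i => (mem_lineFamily θ).mp (f i).2
    refine ⟨_, ⟨t, rfl⟩, ?_⟩
    rw [List.prod_ofFn]
    exact (powTrivialization_tprod θ _).trans (Finset.prod_congr rfl fun i _ => ht i)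

theorem powTrivialization_mem_iff {m : ℕ} {U : AffOpen X}
    {v : ⨂[X.functionField]^m (GenericFibre H)} :
    powTrivialization θ m v ∈ powFamily (lineFamily θ) m U ↔ v ∈ linePow H m U := by
  rw [← map_linePow]
  constructor
  · rintro ⟨w, hw, h⟩
    exact (powTrivialization θ m).injective h ▸ hw
  · exact fun h => ⟨v, h, rfl⟩

theorem powFamily_eq_span_iff {m : ℕ} {U : AffOpen X}
    {v : ⨂[X.functionField]^m (GenericFibre H)} :
    powFamily (lineFamily θ) m U = Submodule.span (ring X U) {powTrivialization θ m v} ↔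
      linePow H m U = Submodule.span (ring X U) {v} := by
  have : Submodule.span (ring X U) {powTrivialization θ m v} = (Submodule.span (ring X U) {v}).map
      ((powTrivialization θ m).toLinearMap.restrictScalars (ring X U)) := by
    rw [Submodule.map_span, Set.image_singleton]
    rfl
  rw [this, ← map_linePow]
  exact (Submodule.map_injective_of_injective
    (f := (powTrivialization θ m).toLinearMap.restrictScalars (ring X U))
    (powTrivialization θ m).injective).eq_iff

theorem IsAmple.exists_isAmpleSection (h : IsAmple H) (x : X) :
    ∃ m σ, ∃ W : AffOpen X, x ∈ W.op ∧ IsAmpleSection θ m σ W := by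
  obtain ⟨m, hm, σ, hσ, W, hW, hxW, hWy⟩ := h x
  refine ⟨m, powTrivialization θ m σ, ⟨W, hW, ⟨⟨x, hxW⟩⟩⟩, hxW, hm,
    fun U => (powTrivialization_mem_iff θ).mpr (hσ U), fun y hy => ?_, fun y U hyU hU => ?_⟩
  · obtain ⟨U, hyU, hU⟩ := (hWy y).mp hy
    exact ⟨U, hyU, (powFamily_eq_span_iff θ).mpr hU⟩
  · exact (hWy y).mpr ⟨U, hyU, (powFamily_eq_span_iff θ).mp hU⟩

theorem h0_linePow (m : ℕ) : h0 (linePow H m) = Module.finrank ℂ (lineSections θ m) :=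
  h0_eq_finrank _ _ (powTrivialization θ m).toAddEquiv
    (fun c v => ((powTrivialization θ m).map_smul _ v).trans
      (Algebra.smul_def c (powTrivialization θ m v)).symm)
    fun _ => forall_congr' fun _ => (powTrivialization_mem_iff θ).symm

theorem exists_trivialization (hH : IsLineBundle H) :
    Nonempty (GenericFibre H ≃ₗ[X.functionField] X.functionField) := by
  obtain ⟨h1, h2⟩ := finite_genericFibre hH
  exact ⟨LinearEquiv.ofFinrankEq _ _ (by rw [h2, Module.finrank_self])⟩

/-- The trivialization of the generic fibre of `E ⊗ H ^ m`. -/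
noncomputable def twistTrivialization (E : X.Modules) (m : ℕ) :
    (GenericFibre E ⊗[X.functionField] (⨂[X.functionField]^m (GenericFibre H)))
      ≃ₗ[X.functionField] GenericFibre E :=
  (TensorProduct.congr (LinearEquiv.refl _ _) (powTrivialization θ m)).trans
    (TensorProduct.rid X.functionField (GenericFibre E))

omit [X.Over SpecC] in
theorem twistTrivialization_tmul {m : ℕ} (v : GenericFibre E)
    (w : ⨂[X.functionField]^m (GenericFibre H)) :
    twistTrivialization θ E m (v ⊗ₜ w) = powTrivialization θ m w • v := by
  simp [twistTrivialization]

/-- The families of submodules of `E_η` that define the twists of a subsheaf of `E`. -/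
noncomputable def twistFamily (F : SubmoduleFamily E) (m : ℕ) (U : AffOpen X) :
    Submodule (ring X U) (GenericFibre E) :=
  smulFamily (powFamily (lineFamily θ) m) (germFamily F) U

theorem map_twist (F : SubmoduleFamily E) (m : ℕ) (U : AffOpen X) :
    (twist F H m U).map ((twistTrivialization θ E m).toLinearMap.restrictScalars (ring X U)) =
      twistFamily θ F m U := by
  have hmem : ∀ t : Fin m → Γ(H, U.op), powTrivialization θ m
      (PiTensorProduct.tprod X.functionField fun i => germ H U (t i)) ∈
        powFamily (lineFamily θ) m U := fun t => by
    rw [powTrivialization_mem_iff]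
    exact Submodule.subset_span ⟨t, rfl⟩
  refine le_antisymm ?_ ?_
  · rw [twist, Submodule.map_span, Submodule.span_le]
    rintro _ ⟨_, ⟨s, hs, t, rfl⟩, rfl⟩
    refine Submodule.subset_span ⟨_, hmem t, _, ⟨s, hs, rfl⟩, ?_⟩
    exact (twistTrivialization_tmul θ _ _).symm
  · refine Submodule.span_le.mpr ?_
    rintro _ ⟨c, hc, _, ⟨s, hs, rfl⟩, rfl⟩
    rw [← map_linePow] at hc
    obtain ⟨w, hw, rfl⟩ := hc
    refine ⟨germ E U s ⊗ₜ w, ?_, twistTrivialization_tmul θ _ _⟩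
    induction hw using Submodule.span_induction with
    | mem w hw =>
      obtain ⟨t, rfl⟩ := hw
      exact Submodule.subset_span ⟨s, hs, t, rfl⟩
    | zero =>
      rw [TensorProduct.tmul_zero]
      exact zero_mem _
    | add v w _ _ hv hw =>
      rw [TensorProduct.tmul_add]
      exact add_mem hv hw
    | smul a w _ hw =>
      have : germ E U s ⊗ₜ[X.functionField] (a • w) = a • (germ E U s ⊗ₜ[X.functionField] w) :=
        TensorProduct.tmul_smul (a : X.functionField) _ _
      rw [this]
      exact Submodule.smul_mem _ _ hw

theorem twistTrivialization_mem_iff {F : SubmoduleFamily E} {m : ℕ} {U : AffOpen X}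
    {v : GenericFibre E ⊗[X.functionField] (⨂[X.functionField]^m (GenericFibre H))} :
    twistTrivialization θ E m v ∈ twistFamily θ F m U ↔ v ∈ twist F H m U := by
  rw [← map_twist]
  constructor
  · rintro ⟨w, hw, h⟩
    exact (twistTrivialization θ E m).injective h ▸ hw
  · exact fun h => ⟨v, h, rfl⟩

variable {r : ℕ} (b : Module.Basis (Fin r) X.functionField (GenericFibre E))

/-- The global sections of a twist, in coordinates with respect to a basis of `E_η`. -/
noncomputable def twistSections (F : SubmoduleFamily E) (m : ℕ) :
    Submodule ℂ (Fin r → X.functionField) where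
  carrier := {v | ∀ U, b.equivFun.symm v ∈ twistFamily θ F m U}
  add_mem' := fun ha hb U => by
    rw [map_add]
    exact add_mem (ha U) (hb U)
  zero_mem' := fun U => by
    rw [map_zero]
    exact zero_mem _
  smul_mem' := fun c v hv U => by
    rw [← algebraMap_smul X.functionField c v, map_smul]
    exact (twistFamily θ F m U).smul_mem (algebraMap ℂ (ring X U) c) (hv U)

theorem h0_twist (F : SubmoduleFamily E) (m : ℕ) :
    h0 (twist F H m) = Module.finrank ℂ (twistSections θ b F m) :=
  h0_eq_finrank _ _ ((twistTrivialization θ E m).trans b.equivFun).toAddEquiv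
    (fun c v => (((twistTrivialization θ E m).trans b.equivFun).map_smul _ v).trans
      (algebraMap_smul X.functionField c _))
    fun v => forall_congr' fun U => by
      change _ ↔ b.equivFun.symm (b.equivFun (twistTrivialization θ E m v)) ∈ _
      rw [LinearEquiv.symm_apply_apply, twistTrivialization_mem_iff]

theorem twistSections_mono {F G : SubmoduleFamily E} (h : F ≤ G) (m : ℕ) :
    twistSections θ b F m ≤ twistSections θ b G m := by
  intro v hv U
  refine Submodule.span_mono ?_ (hv U)
  rintro _ ⟨c, hc, _, ⟨s, hs, rfl⟩, rfl⟩
  exact ⟨c, hc, _, ⟨s, h U hs, rfl⟩, rfl⟩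

end Transfer

/-! ### The section ring of an ample line bundle is normalized -/

section FunctionField

variable {X : Scheme.{0}} [IsIntegral X] [X.Over SpecC]

omit [IsIntegral X] in
theorem compactSpace_of_isProper (hproper : IsProper (X ↘ SpecC)) : CompactSpace X :=
  QuasiCompact.compactSpace_of_compactSpace (X ↘ SpecC)

omit [IsIntegral X] in
theorem finiteType_sections (hproper : IsProper (X ↘ SpecC)) (U : AffOpen X) :
    Algebra.FiniteType ℂ Γ(X, U.op) := by
  have h := (X ↘ SpecC).finiteType_appLE (isAffineOpen_top SpecC) U.isAffine (fun _ _ => trivial)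
  exact h.comp (RingHom.FiniteType.of_surjective _
    (ConcreteCategory.bijective_of_isIso (Scheme.ΓSpecIso (CommRingCat.of ℂ)).inv).2)

theorem exists_finite_adjoin_eq_top (hproper : IsProper (X ↘ SpecC)) :
    ∃ G : Set X.functionField, G.Finite ∧ IntermediateField.adjoin ℂ G = ⊤ := by
  obtain ⟨U, -, -⟩ := exists_affOpen (genericPoint X) ⊤ trivial
  obtain ⟨s, hs⟩ := (finiteType_sections hproper U).out
  refine ⟨toK U '' s, s.finite_toSet.image _, ?_⟩
  have h : ∀ f : Γ(X, U.op), toK U f ∈ IntermediateField.adjoin ℂ (toK U '' (s : Set _)) := by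
    have h1 : Algebra.adjoin ℂ (s : Set Γ(X, U.op)) ≤
        (IntermediateField.adjoin ℂ (toK U '' (s : Set _))).toSubalgebra.comap
          (IsScalarTower.toAlgHom ℂ Γ(X, U.op) X.functionField) :=
      Algebra.adjoin_le fun f hf => IntermediateField.subset_adjoin _ _ ⟨f, hf, rfl⟩
    rw [hs] at h1
    exact fun f => h1 trivial
  rw [eq_top_iff]
  intro g _
  obtain ⟨p, q, -, rfl⟩ := IsFractionRing.div_surjective (A := Γ(X, U.op)) g
  exact div_mem (h p) (h q)

theorem trdeg_functionField {n k : ℕ} {D : Fin k → X.IdealSheafData}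
    (hD : IsSNCArrangement n D) : Algebra.trdeg ℂ X.functionField = n := by
  obtain ⟨U, hU, -, ⟨b, -⟩, -⟩ := hD.coordinates (genericPoint X)
  let V : AffOpen X := ⟨U.1, U.2, ⟨⟨_, hU⟩⟩⟩
  exact trdeg_eq_of_basis_kaehlerDifferential (R := Γ(X, V.op)) b

variable {H : X.Modules} (θ : GenericFibre H ≃ₗ[X.functionField] X.functionField)

theorem exists_isNormalized (hproper : IsProper (X ↘ SpecC)) (hH : IsLineBundle H)
    (hample : IsAmple H) :
    ∃ (N l : ℕ) (σ : Fin l → X.functionField), IsNormalized (lineSections θ) N σ := by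
  have := compactSpace_of_isProper hproper
  have h := hample.exists_isAmpleSection θ
  obtain ⟨N, l, σ, hN, hσ, hdom⟩ := exists_dominates hproper hH h
  obtain ⟨l', σ', hσ', hdom', hind⟩ := hdom.exists_independent hN hσ
  obtain ⟨m, τ, W, -, hW⟩ := h (genericPoint X)
  exact ⟨N, l', σ', isSectionRing_lineSections θ, hN, hσ', hdom', hind, hW.exists_denominator hH⟩

theorem exists_common_denominator (hproper : IsProper (X ↘ SpecC)) (hH : IsLineBundle H)
    (hample : IsAmple H) {ι : Type*} [Finite ι] (g : ι → X.functionField) :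
    ∃ a, ∃ Q ∈ lineSections θ a, Q ≠ 0 ∧ ∀ i, Q * g i ∈ lineSections θ a := by
  classical
  obtain ⟨N, l, σ, h⟩ := exists_isNormalized θ hproper hH hample
  have := Fintype.ofFinite ι
  choose a Q hQ hQ0 hQg using fun i => h.frac (g i)
  refine ⟨_, _, h.prod_mem Finset.univ fun i _ => hQ i,
    Finset.prod_ne_zero_iff.mpr fun i _ => hQ0 i, fun i => ?_⟩
  rw [← Finset.prod_erase_mul _ _ (Finset.mem_univ i),
    ← Finset.sum_erase_add _ _ (Finset.mem_univ i), mul_assoc]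
  exact h.mul_mem (h.prod_mem _ fun j _ => hQ j) (hQg i)

end FunctionField

/-- The coordinate functionals span the dual of `P`, so a maximal independent subfamily of them
already separates its points. -/
theorem exists_injective_coordinates {K ι : Type*} [Field K] [Fintype ι]
    (P : Submodule K (ι → K)) : ∃ J : Finset ι, J.card ≤ Module.finrank K P ∧
      ∀ v ∈ P, (∀ j ∈ J, v j = 0) → v = 0 := by
  classical
  let u : ι → Module.Dual K P := fun i => (LinearMap.proj i).comp P.subtype
  obtain ⟨κ, a, ha, hsp, hli⟩ := exists_linearIndependent' K u
  have := Fintype.ofInjective a ha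
  refine ⟨Finset.univ.image a, Finset.card_image_le.trans ?_, fun v hv h => funext fun i => ?_⟩
  · rw [Finset.card_univ, ← Subspace.dual_finrank_eq]
    exact hli.fintype_card_le_finrank
  · have h1 : Submodule.span K (Set.range u) ≤ LinearMap.ker (Module.Dual.eval K P ⟨v, hv⟩) := by
      rw [← hsp, Submodule.span_le]
      rintro _ ⟨j, rfl⟩
      exact h (a j) (Finset.mem_image_of_mem a (Finset.mem_univ j))
    exact h1 (Submodule.subset_span ⟨i, rfl⟩)

/-! ### Comparing the sections of twists with those of powers of `H` -/

section Bounds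

variable {X : Scheme.{0}} [IsIntegral X] [X.Over SpecC] {H E : X.Modules}
  (θ : GenericFibre H ≃ₗ[X.functionField] X.functionField)
  {r : ℕ} (b : Module.Basis (Fin r) X.functionField (GenericFibre E))

theorem IsFrame.repr_mem_powFamily {B : AffOpen X}
    {c : Module.Basis (Fin r) X.functionField (GenericFibre E)} (hc : IsFrame B c) {m : ℕ}
    {v : GenericFibre E} (hv : v ∈ twistFamily θ (⊤ : SubmoduleFamily E) m B) (j : Fin r) :
    c.repr v j ∈ powFamily (lineFamily θ) m B := by
  induction hv using Submodule.span_induction with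
  | mem v hv =>
    obtain ⟨q, hq, w, hw, rfl⟩ := hv
    rw [map_smul, Finsupp.smul_apply, smul_eq_mul, mul_comm]
    exact smul_mem_of_mem_ring _ ((hc B le_rfl w).mp hw j) hq
  | zero =>
    rw [map_zero]
    exact zero_mem _
  | add v w _ _ hv hw =>
    rw [map_add]
    exact add_mem hv hw
  | smul f v _ hv =>
    have : c.repr (f • v) = (f : X.functionField) • c.repr v := c.repr.map_smul _ _
    rw [this]
    exact smul_mem_of_mem_ring _ f.2 hv

/-- `E` is covered by finitely many frames, and `Q` is a common denominator for the coordinates of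
their vectors in the basis `b`. Multiplication by `Q` thus maps `E(m)` into `r` copies of `H^(m+a)`
for all `m` at once. -/
theorem exists_mul_coordinate_mem (hproper : IsProper (X ↘ SpecC)) (hH : IsLineBundle H)
    (hample : IsAmple H) (hE : IsLocallyFreeOfRank E r) :
    ∃ a, ∃ Q ∈ lineSections θ a, Q ≠ 0 ∧ ∀ m, ∀ v ∈ twistSections θ b (⊤ : SubmoduleFamily E) m,
      ∀ i, Q * v i ∈ lineSections θ (m + a) := by
  have := compactSpace_of_isProper hproper
  choose B c hxB hB using exists_isFrame hE
  obtain ⟨t, ht⟩ := isCompact_univ.elim_nhds_subcover (fun x => ((B x).op : Set X))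
    (fun x _ => (B x).op.isOpen.mem_nhds (hxB x))
  obtain ⟨a, Q, hQ, hQ0, h⟩ := exists_common_denominator θ hproper hH hample
    fun p : t × Fin r × Fin r => b.repr (c p.1 p.2.1) p.2.2
  refine ⟨a, Q, hQ, hQ0, fun m v hv i U =>
    ((isQCoh_lineFamily hH).pow (m + a)).mem_of_locally fun x _ => ?_⟩
  obtain ⟨y, hy, hxy⟩ := Set.mem_iUnion₂.mp (ht.2 (Set.mem_univ x))
  refine ⟨B y, hxy, ?_⟩
  have h1 : Q * v i = ∑ j, (c y).repr (b.equivFun.symm v) j * (Q * b.repr (c y j) i) := by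
    have h2 : v i = b.repr (b.equivFun.symm v) i := by
      rw [← Module.Basis.equivFun_apply, LinearEquiv.apply_symm_apply]
    conv_lhs => rw [h2, ← (c y).sum_repr (b.equivFun.symm v)]
    rw [map_sum, Finsupp.finsetSum_apply, Finset.mul_sum]
    refine Finset.sum_congr rfl fun j _ => ?_
    rw [map_smul, Finsupp.smul_apply, smul_eq_mul]
    ring
  rw [h1]
  refine sum_mem fun j _ => ?_
  rw [powFamily, pow_add]
  exact Submodule.mul_mem_mul ((hB y).repr_mem_powFamily θ (hv (B y)) j) (h (⟨y, hy⟩, j, i) (B y))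

theorem twistSections_le_genericSpan (F : SubmoduleFamily E) (m : ℕ) {v : Fin r → X.functionField}
    (hv : v ∈ twistSections θ b F m) : b.equivFun.symm v ∈ genericSpan F := by
  obtain ⟨U, -, -⟩ := exists_affOpen (genericPoint X) ⊤ trivial
  have h : twistFamily θ F m U ≤ (genericSpan F).restrictScalars (ring X U) := by
    refine Submodule.span_le.mpr ?_
    rintro _ ⟨q, -, _, ⟨s, hs, rfl⟩, rfl⟩
    exact Submodule.smul_mem _ q (germ_mem_genericSpan hs)
  exact h (hv U)

/-- Among the `r` coordinates, at most `rank F` already determine a vector of the generic fibre of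
`F`. As `a` and `Q` come from `E` alone, the bound is uniform in `F`, which the uniform degree bound
needs. -/
theorem exists_finrank_twistSections_le (hproper : IsProper (X ↘ SpecC)) (hH : IsLineBundle H)
    (hample : IsAmple H) (hE : IsLocallyFreeOfRank E r) :
    ∃ a, ∃ Q ∈ lineSections θ a, Q ≠ 0 ∧ ∀ (F : SubmoduleFamily E) (m : ℕ),
      Module.Finite ℂ (twistSections θ b F m) ∧
      Module.finrank ℂ (twistSections θ b F m) ≤
        rank F * Module.finrank ℂ (lineSections θ (m + a)) := by
  obtain ⟨N, l, σ, hS⟩ := exists_isNormalized θ hproper hH hample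
  obtain ⟨G, hG, hGtop⟩ := exists_finite_adjoin_eq_top hproper
  have hfin := hS.finite hG hGtop
  obtain ⟨a, Q, hQ, hQ0, h⟩ := exists_mul_coordinate_mem θ b hproper hH hample hE
  refine ⟨a, Q, hQ, hQ0, fun F m => ?_⟩
  obtain ⟨J, hJ, hJv⟩ := exists_injective_coordinates
    ((genericSpan F).map b.equivFun.toLinearMap)
  have hrk : Module.finrank X.functionField ((genericSpan F).map b.equivFun.toLinearMap) = rank F :=
    LinearEquiv.finrank_map_eq b.equivFun _
  let ψ : twistSections θ b F m →ₗ[ℂ] (J → lineSections θ (m + a)) :=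
    LinearMap.pi fun j => LinearMap.codRestrict (lineSections θ (m + a))
      ((LinearMap.mulLeft ℂ Q).comp ((LinearMap.proj (j : Fin r)).comp
        (twistSections θ b F m).subtype))
      fun v => h m v (twistSections_mono θ b le_top m v.2) j
  have hψ : Function.Injective ψ := by
    rw [← LinearMap.ker_eq_bot, LinearMap.ker_eq_bot']
    intro v hv
    refine Subtype.ext (hJv v.1 ⟨_, twistSections_le_genericSpan θ b F m v.2,
      b.equivFun.apply_symm_apply _⟩ fun j hj => ?_)
    have := congrArg Subtype.val (congrFun hv ⟨j, hj⟩)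
    exact (mul_eq_zero.mp this).resolve_left hQ0
  refine ⟨Module.Finite.of_injective ψ hψ, (LinearMap.finrank_le_finrank_of_injective hψ).trans ?_⟩
  rw [Module.finrank_pi_fintype, Finset.sum_const, Finset.card_univ, Fintype.card_coe, smul_eq_mul]
  exact Nat.mul_le_mul_right _ (hJ.trans hrk.le)

/-- On each member of a finite affine cover a vector of the generic fibre of `F` is a section
divided by a function; `Q` absorbs all these denominators. -/
theorem exists_smul_mem_twistSections (hproper : IsProper (X ↘ SpecC)) (hH : IsLineBundle H)
    (hample : IsAmple H) {F : SubmoduleFamily E} (hF : IsQCoh (germFamily F))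
    {ι : Type*} [Finite ι] {w : ι → Fin r → X.functionField}
    (hw : ∀ j, b.equivFun.symm (w j) ∈ genericSpan F) :
    ∃ a, ∃ Q ∈ lineSections θ a, Q ≠ 0 ∧ ∀ m, ∀ s ∈ lineSections θ m, ∀ j,
      (s * Q) • w j ∈ twistSections θ b F (m + a) := by
  have := compactSpace_of_isProper hproper
  choose B hxB _ using fun x : X => exists_affOpen x ⊤ trivial
  obtain ⟨t, ht⟩ := isCompact_univ.elim_nhds_subcover (fun x => ((B x).op : Set X))
    (fun x _ => (B x).op.isOpen.mem_nhds (hxB x))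
  choose q hq0 hq using fun (x : X) (j : ι) => exists_smul_mem hF (B x) (hw j)
  obtain ⟨a, Q, hQ, hQ0, h⟩ := exists_common_denominator θ hproper hH hample
    fun p : t × ι => (toK (B p.1) (q p.1 p.2))⁻¹
  refine ⟨a, Q, hQ, hQ0, fun m s hs j U =>
    (((isQCoh_lineFamily hH).pow (m + a)).smul hF).mem_of_locally fun x _ => ?_⟩
  obtain ⟨y, hy, hxy⟩ := Set.mem_iUnion₂.mp (ht.2 (Set.mem_univ x))
  refine ⟨B y, hxy, Submodule.subset_span
    ⟨s * (Q * (toK (B y) (q y j))⁻¹), ?_, _, hq y j, ?_⟩⟩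
  · rw [powFamily, pow_add]
    exact Submodule.mul_mem_mul (hs (B y)) (h (⟨y, hy⟩, j) (B y))
  · have : toK (B y) (q y j) ≠ 0 := (map_ne_zero_iff _ (toK_injective (B y))).mpr (hq0 y j)
    rw [map_smul, smul_smul, ← mul_assoc, mul_assoc (s * Q), inv_mul_cancel₀ this, mul_one]

/-- Multiplying a basis of the generic fibre of `F` by `Q` gives an embedding of `rank F` copies of
`H⁰(H^m)` into `H⁰(F(m+a))`; here `a` depends on `F`. -/
theorem exists_le_finrank_twistSections (hproper : IsProper (X ↘ SpecC)) (hH : IsLineBundle H)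
    (hample : IsAmple H) (hE : IsLocallyFreeOfRank E r) {F : SubmoduleFamily E}
    (hF : IsQCoh (germFamily F)) :
    ∃ a, ∃ Q ∈ lineSections θ a, Q ≠ 0 ∧ ∀ m : ℕ,
      rank F * Module.finrank ℂ (lineSections θ m) ≤
        Module.finrank ℂ (twistSections θ b F (m + a)) := by
  obtain ⟨_, _, _, _, hfin⟩ := exists_finrank_twistSections_le θ b hproper hH hample hE
  have := (finite_genericFibre hE).1
  let c := Module.finBasis X.functionField (genericSpan F)
  let w : Fin (rank F) → Fin r → X.functionField := fun j => b.equivFun (c j)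
  have hw : LinearIndependent X.functionField w :=
    (c.linearIndependent.map' _ (genericSpan F).ker_subtype).map' _ b.equivFun.ker
  obtain ⟨a, Q, hQ, hQ0, h⟩ := exists_smul_mem_twistSections θ b hproper hH hample hF (w := w)
    fun j => by
      rw [LinearEquiv.symm_apply_apply]
      exact (c j).2
  refine ⟨a, Q, hQ, hQ0, fun m => ?_⟩
  let ψ : (Fin (rank F) → lineSections θ m) →ₗ[ℂ] twistSections θ b F (m + a) :=
    { toFun := fun s => ⟨∑ j, ((s j : X.functionField) * Q) • w j,
        sum_mem fun j _ => h m _ (s j).2 j⟩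
      map_add' := fun s s' => Subtype.ext (by
        simp [add_mul, add_smul, Finset.sum_add_distrib])
      map_smul' := fun z s => Subtype.ext (by
        simp [Finset.smul_sum, smul_assoc]) }
  have hψ : Function.Injective ψ := by
    rw [← LinearMap.ker_eq_bot, LinearMap.ker_eq_bot']
    intro s hs
    refine funext fun j => Subtype.ext ?_
    have := Fintype.linearIndependent_iff.mp hw (fun j => (s j : X.functionField) * Q)
      (congrArg Subtype.val hs) j
    exact (mul_eq_zero.mp this).resolve_right hQ0
  have := (hfin F (m + a)).1
  have h1 := LinearMap.finrank_le_finrank_of_injective hψ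
  obtain ⟨N, l, σ, hS⟩ := exists_isNormalized θ hproper hH hample
  obtain ⟨G, hG, hGtop⟩ := exists_finite_adjoin_eq_top hproper
  have := hS.finite hG hGtop m
  rwa [Module.finrank_pi_fintype, Finset.sum_const, Finset.card_univ, Fintype.card_fin,
    smul_eq_mul] at h1

end Bounds

theorem factorial_mul_div_le {n m : ℕ} (hm : 1 ≤ m) {x C : ℝ} (hC : 0 ≤ C)
    (hx : x ≤ C * ((m : ℝ) + 1) ^ (n - 1)) :
    ((n - 1)! : ℝ) * x / (m : ℝ) ^ (n - 1) ≤ (n - 1)! * (C * 2 ^ (n - 1)) := by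
  have hm' : (1 : ℝ) ≤ m := by exact_mod_cast hm
  rw [div_le_iff₀ (by positivity), mul_assoc, mul_assoc, ← mul_pow]
  refine mul_le_mul_of_nonneg_left (hx.trans ?_) (by positivity)
  gcongr
  linarith

/-! ### Boundedness and monotonicity of the degree -/

section Degrees

variable {X : Scheme.{0}} [IsIntegral X] [X.Over SpecC] {H E : X.Modules} {n r k : ℕ}

theorem finrank_lineSections_add_le (θ : GenericFibre H ≃ₗ[X.functionField] X.functionField)
    (hproper : IsProper (X ↘ SpecC)) (hH : IsLineBundle H)
    (hample : IsAmple H) (hn : 1 ≤ n) {D : Fin k → X.IdealSheafData} (hD : IsSNCArrangement n D)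
    {a : ℕ} {Q : X.functionField} (hQ : Q ∈ lineSections θ a) (hQ0 : Q ≠ 0) :
    ∃ C : ℕ, ∀ m, Module.finrank ℂ (lineSections θ (m + a)) ≤
      Module.finrank ℂ (lineSections θ m) + C * (m + 1) ^ (n - 1) := by
  obtain ⟨N, l, σ, hS⟩ := exists_isNormalized θ hproper hH hample
  obtain ⟨G, hG, hGtop⟩ := exists_finite_adjoin_eq_top hproper
  exact hS.finrank_add_le hG hGtop hn (trdeg_functionField hD).le hQ hQ0

/-- The sequence of which the degree of `F` is the limit. -/
noncomputable def degreeSeq (n : ℕ) (H : X.Modules) (F : SubmoduleFamily E) (m : ℕ) : ℝ :=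
  ((n - 1)! : ℝ) * ((h0 (twist F H m) : ℝ) - (rank F : ℝ) * (h0 (linePow H m) : ℝ)) /
    (m : ℝ) ^ (n - 1)

theorem exists_degreeSeq_le (hproper : IsProper (X ↘ SpecC)) (hH : IsLineBundle H)
    (hample : IsAmple H) (hn : 1 ≤ n) {D : Fin k → X.IdealSheafData} (hD : IsSNCArrangement n D)
    (hE : IsLocallyFreeOfRank E r) :
    ∃ C : ℝ, 0 ≤ C ∧ ∀ (F : SubmoduleFamily E) (m : ℕ), 1 ≤ m → degreeSeq n H F m ≤ C := by
  obtain ⟨θ⟩ := exists_trivialization hH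
  obtain ⟨-, b, -⟩ := exists_isFrame hE (genericPoint X)
  obtain ⟨a, Q, hQ, hQ0, h⟩ := exists_finrank_twistSections_le θ b hproper hH hample hE
  obtain ⟨C, hC⟩ := finrank_lineSections_add_le θ hproper hH hample hn hD hQ hQ0
  refine ⟨(n - 1)! * (r * C * 2 ^ (n - 1)), by positivity, fun F m hm => ?_⟩
  refine factorial_mul_div_le hm (by positivity) ?_
  rw [h0_twist θ b, h0_linePow θ, sub_le_iff_le_add]
  have hr : rank F ≤ r := (rank_le hE le_top).trans (rank_top hE).le
  have h1 : Module.finrank ℂ (twistSections θ b F m) ≤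
      r * C * (m + 1) ^ (n - 1) + rank F * Module.finrank ℂ (lineSections θ m) := by
    calc _ ≤ rank F * Module.finrank ℂ (lineSections θ (m + a)) := (h F m).2
      _ ≤ rank F * (Module.finrank ℂ (lineSections θ m) + C * (m + 1) ^ (n - 1)) :=
        Nat.mul_le_mul_left _ (hC m)
      _ = rank F * (C * (m + 1) ^ (n - 1)) + rank F * Module.finrank ℂ (lineSections θ m) := by
        ring
      _ ≤ _ := by
        rw [mul_assoc]
        gcongr
  exact_mod_cast h1

/-- A real limsup may take a default value when the sequence tends to `-∞`. This lower bound
excludes that case and makes the estimates on degrees meaningful. -/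
theorem exists_le_degreeSeq (hproper : IsProper (X ↘ SpecC)) (hH : IsLineBundle H)
    (hample : IsAmple H) (hn : 1 ≤ n) {D : Fin k → X.IdealSheafData} (hD : IsSNCArrangement n D)
    (hE : IsLocallyFreeOfRank E r) {F : SubmoduleFamily E} (hF : IsCoherentSubsheaf F) :
    ∃ C : ℝ, ∀ᶠ m in Filter.atTop, C ≤ degreeSeq n H F m := by
  obtain ⟨θ⟩ := exists_trivialization hH
  obtain ⟨-, b, -⟩ := exists_isFrame hE (genericPoint X)
  obtain ⟨a, Q, hQ, hQ0, h⟩ := exists_le_finrank_twistSections θ b hproper hH hample hE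
    ((isCoherentSubsheaf_iff hE F).mp hF)
  obtain ⟨C, hC⟩ := finrank_lineSections_add_le θ hproper hH hample hn hD hQ hQ0
  refine ⟨-((n - 1)! * (rank F * C * 2 ^ (n - 1))),
    Filter.eventually_atTop.mpr ⟨a + 1, fun m' hm => ?_⟩⟩
  -- The embedding has target `H⁰(F(m+a))`, so only indices `m' = m + a` are treated; `m' ≥ a + 1`
  -- also keeps the denominator nonzero.
  obtain ⟨m, rfl⟩ := Nat.exists_eq_add_of_le' (show a ≤ m' by omega)
  rw [neg_le, degreeSeq, ← neg_div, ← mul_neg]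
  refine factorial_mul_div_le (by omega) (by positivity) ?_
  rw [h0_twist θ b, h0_linePow θ, neg_sub, sub_le_iff_le_add]
  have h1 : rank F * Module.finrank ℂ (lineSections θ (m + a)) ≤
      rank F * C * (m + a + 1) ^ (n - 1) + Module.finrank ℂ (twistSections θ b F (m + a)) := by
    calc _ ≤ rank F * (Module.finrank ℂ (lineSections θ m) + C * (m + 1) ^ (n - 1)) :=
        Nat.mul_le_mul_left _ (hC m)
      _ = rank F * C * (m + 1) ^ (n - 1) + rank F * Module.finrank ℂ (lineSections θ m) := by
        ring
      _ ≤ _ := by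
        refine Nat.add_le_add ?_ (h m)
        gcongr
        omega
  exact_mod_cast h1

theorem isCoboundedUnder_degreeSeq (hproper : IsProper (X ↘ SpecC)) (hH : IsLineBundle H)
    (hample : IsAmple H) (hn : 1 ≤ n) {D : Fin k → X.IdealSheafData} (hD : IsSNCArrangement n D)
    (hE : IsLocallyFreeOfRank E r) {F : SubmoduleFamily E} (hF : IsCoherentSubsheaf F) :
    Filter.IsCoboundedUnder (· ≤ ·) Filter.atTop (degreeSeq n H F) := by
  obtain ⟨C, hC⟩ := exists_le_degreeSeq hproper hH hample hn hD hE hF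
  exact (Filter.isBoundedUnder_of_eventually_ge hC).isCoboundedUnder_le

theorem exists_degree_le (hproper : IsProper (X ↘ SpecC)) (hH : IsLineBundle H)
    (hample : IsAmple H) (hn : 1 ≤ n) {D : Fin k → X.IdealSheafData} (hD : IsSNCArrangement n D)
    (hE : IsLocallyFreeOfRank E r) :
    ∃ C : ℝ, 0 ≤ C ∧ ∀ F : SubmoduleFamily E, IsCoherentSubsheaf F → degree n H F ≤ C := by
  obtain ⟨C, hC0, hC⟩ := exists_degreeSeq_le hproper hH hample hn hD hE
  exact ⟨C, hC0, fun F hF => Filter.limsup_le_of_le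
    (isCoboundedUnder_degreeSeq hproper hH hample hn hD hE hF)
    (Filter.eventually_atTop.mpr ⟨1, hC F⟩)⟩

/-- For equal ranks the correction terms of the two sequences coincide, so only monotonicity of `h⁰`
remains; boundedness lets the comparison pass to the limsup. -/
theorem degree_le_of_rank_eq (hproper : IsProper (X ↘ SpecC)) (hH : IsLineBundle H)
    (hample : IsAmple H) (hn : 1 ≤ n) {D : Fin k → X.IdealSheafData} (hD : IsSNCArrangement n D)
    (hE : IsLocallyFreeOfRank E r) {F G : SubmoduleFamily E} (hF : IsCoherentSubsheaf F)
    (hFG : F ≤ G) (hrank : rank F = rank G) : degree n H F ≤ degree n H G := by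
  obtain ⟨C, -, hC⟩ := exists_degreeSeq_le hproper hH hample hn hD hE
  refine Filter.limsup_le_limsup (Filter.Eventually.of_forall fun m => ?_)
    (isCoboundedUnder_degreeSeq hproper hH hample hn hD hE hF)
    (Filter.isBoundedUnder_of_eventually_le (Filter.eventually_atTop.mpr ⟨1, hC G⟩))
  obtain ⟨θ⟩ := exists_trivialization hH
  obtain ⟨-, b, -⟩ := exists_isFrame hE (genericPoint X)
  obtain ⟨_, _, _, _, hfin⟩ := exists_finrank_twistSections_le θ b hproper hH hample hE
  have := (hfin G m).1
  have h1 : h0 (twist F H m) ≤ h0 (twist G H m) := by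
    rw [h0_twist θ b, h0_twist θ b]
    exact Submodule.finrank_mono (twistSections_mono θ b hFG m)
  change degreeSeq n H F m ≤ degreeSeq n H G m
  rw [degreeSeq, degreeSeq, hrank]
  gcongr

end Degrees

/-! ### A local criterion for flatness -/

section Flatness

/-- The cokernel of `g` is killed by powers of `s`, element by element, so `g` becomes an
isomorphism once `s` is inverted. -/
theorem flat_localizedModule_of_injective {R P T : Type*} [CommRing R] [AddCommGroup P] [Module R P]
    [AddCommGroup T] [Module R T] [Module.Flat R P] (s : R) (g : P →ₗ[R] T)
    (hg : Function.Injective g) (hs : ∀ t, ∃ (k : ℕ) (p : P), g p = s ^ k • t) :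
    Module.Flat R (LocalizedModule.Away s T) := by
  let S := Submonoid.powers s
  let q := LocalizedModule.mkLinearMap S T
  have : IsLocalizedModule S (q.comp g) :=
    { map_units := IsLocalizedModule.map_units q
      surj := fun y => by
        obtain ⟨⟨t, c⟩, hc⟩ := IsLocalizedModule.surj S q y
        obtain ⟨k, p, hp⟩ := hs t
        refine ⟨⟨p, ⟨s ^ k, k, rfl⟩ * c⟩, ?_⟩
        change _ = q (g p)
        rw [hp, map_smul, ← hc, mul_smul]
        rfl
      exists_of_eq := fun {a b} h => by
        obtain ⟨c, hc⟩ := IsLocalizedModule.exists_of_eq (S := S) (f := q) h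
        refine ⟨c, hg ?_⟩
        rw [Submonoid.smul_def, Submonoid.smul_def, map_smul, map_smul]
        exact hc }
  have h1 : Module.Flat R (Localization S) := IsLocalization.flat _ S
  have h2 : Module.Flat R (LocalizedModule S P) :=
    Module.Flat.of_linearEquiv ((LocalizedModule.equivTensorProduct S P).restrictScalars R)
  exact Module.Flat.of_linearEquiv (IsLocalizedModule.linearEquiv S (q.comp g)
    (LocalizedModule.mkLinearMap S P))

theorem flat_of_span_eq_top {R T : Type*} [CommRing R] [AddCommGroup T] [Module R T] (n : ℕ)
    {G : Set R} (hG : Ideal.span G = ⊤)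
    (h : ∀ s ∈ G, ∃ g : (Fin n → R) →ₗ[R] T, Function.Injective g ∧
      ∀ t, ∃ (k : ℕ) (p : Fin n → R), g p = s ^ k • t) : Module.Flat R T :=
  Module.flat_of_localized_span R T G hG fun s => by
    obtain ⟨g, hg, hs⟩ := h s.1 s.2
    exact flat_localizedModule_of_injective s.1 g hg hs

end Flatness

/-! ### Localization of logarithmic vector fields -/

section LogVectorFields

variable {X : Scheme.{0}} [IsIntegral X] [X.Over SpecC]

/-- The quotient rule `δ c = g^(-n) (δ(g^n c) - δ(g^n) c)` extends the condition from `U` to its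
principal opens, and membership is local. -/
theorem IsQCoh.derivation_mem {J : ∀ U : AffOpen X, Submodule (ring X U) X.functionField}
    (hJ : IsQCoh J) {δ : Derivation ℂ X.functionField X.functionField} {U V : AffOpen X}
    (hring : ∀ f ∈ ring X U, δ f ∈ ring X U) (hJU : ∀ c ∈ J U, δ c ∈ J U) (h : V.op ≤ U.op)
    {c : X.functionField} (hc : c ∈ J V) : δ c ∈ J V := by
  refine hJ.mem_of_locally fun x hx => ?_
  obtain ⟨B, g, g', hg, hg', hxB⟩ := U.exists_common_basicOpen V x (h hx) hx
  refine ⟨B, hxB, ?_⟩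
  have hcB : c ∈ J B := hJ.mono (AffOpen.le_of_eq_basicOpen hg') hc
  obtain ⟨n, hn⟩ := hJ.localized U B g hg c hcB
  have h1 := hJ.mono (AffOpen.le_of_eq_basicOpen hg) (hJU _ hn)
  have h2 := ring_mono (AffOpen.le_of_eq_basicOpen hg) (hring _ (pow_mem (toK_mem_ring U g) n))
  have h3 : δ c = ((toK U g)⁻¹) ^ n • (δ (toK U g ^ n • c) - δ (toK U g ^ n) • c) := by
    have h0 : (toK U g)⁻¹ ^ n * toK U g ^ n = 1 := by
      rw [← mul_pow, inv_mul_cancel₀ (toK_ne_zero hg), one_pow]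
    rw [smul_eq_mul (toK U g ^ n), Derivation.leibniz]
    simp only [smul_eq_mul]
    rw [mul_comm c, add_sub_cancel_right, ← mul_assoc, h0, one_mul]
  rw [h3]
  exact smul_mem_of_mem_ring _ (pow_mem (inv_toK_mem_ring hg) n)
    (sub_mem h1 (smul_mem_of_mem_ring _ h2 hcB))

/-- An ideal sheaf, as a family of subsets of the function field. -/
noncomputable def idealFamily (I : X.IdealSheafData) (U : AffOpen X) :
    Submodule (ring X U) X.functionField where
  carrier := {c | ∃ f ∈ I.ideal U.aff, toK U f = c}
  add_mem' := by
    rintro _ _ ⟨f, hf, rfl⟩ ⟨g, hg, rfl⟩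
    exact ⟨f + g, add_mem hf hg, map_add _ _ _⟩
  zero_mem' := ⟨0, zero_mem _, map_zero _⟩
  smul_mem' := by
    rintro ⟨_, ⟨a, rfl⟩⟩ _ ⟨f, hf, rfl⟩
    exact ⟨a * f, Ideal.mul_mem_left _ a hf, map_mul _ _ _⟩

theorem isQCoh_idealFamily (I : X.IdealSheafData) : IsQCoh (idealFamily I) where
  mono_basicOpen := by
    rintro U B f h _ ⟨g, hg, rfl⟩
    have hBU := AffOpen.le_of_eq_basicOpen h
    refine ⟨resO hBU g, ?_, toK_resO hBU g⟩
    rw [← I.map_ideal (U := B.aff) (V := U.aff) hBU]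
    exact Ideal.mem_map_of_mem _ hg
  localized := by
    rintro U B f h _ ⟨g, hg, rfl⟩
    have hBU := AffOpen.le_of_eq_basicOpen h
    rw [← I.map_ideal (U := B.aff) (V := U.aff) hBU] at hg
    induction hg using Submodule.span_induction with
    | mem g hg =>
      obtain ⟨g, hg, rfl⟩ := hg
      refine ⟨0, g, hg, ?_⟩
      rw [pow_zero, one_smul]
      exact (toK_resO hBU g).symm
    | zero => exact ⟨0, by rw [map_zero, smul_zero]; exact zero_mem _⟩
    | add a b _ _ ha hb =>
      obtain ⟨n, hn⟩ := ha
      obtain ⟨m, hm⟩ := hb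
      refine ⟨max n m, ?_⟩
      rw [map_add, smul_add]
      exact add_mem (pow_smul_mem_of_le _ f (le_max_left n m) hn)
        (pow_smul_mem_of_le _ f (le_max_right n m) hm)
    | smul a b _ hb =>
      obtain ⟨n, hn⟩ := hb
      obtain ⟨m, hm⟩ := ring_basicOpen h (toK_mem_ring B a)
      refine ⟨m + n, ?_⟩
      have : toK U f ^ (m + n) • toK B (a • b) =
          (toK U f ^ m * toK B a) • (toK U f ^ n • toK B b) := by
        simp only [smul_eq_mul, map_mul, pow_add]
        ring
      rw [this]
      exact smul_mem_of_mem_ring _ hm hn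

theorem mem_one_iff {U : AffOpen X} {c : X.functionField} :
    c ∈ (1 : Submodule (ring X U) X.functionField) ↔ c ∈ ring X U := by
  rw [Submodule.mem_one]
  exact ⟨fun ⟨y, hy⟩ => hy ▸ y.2, fun h => ⟨⟨c, h⟩, rfl⟩⟩

variable {k n : ℕ} {D : Fin k → X.IdealSheafData}

/-- Since derivations localize by the quotient rule, the condition on all smaller affine opens `V`
reduces to `V = U`. -/
theorem mem_logT_iff {U : AffOpen X} {δ : Derivation ℂ X.functionField X.functionField} :
    δ ∈ logT D U ↔ (∀ c ∈ ring X U, δ c ∈ ring X U) ∧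
      ∀ i, ∀ c ∈ idealFamily (D i) U, δ c ∈ idealFamily (D i) U := by
  constructor
  · intro h
    constructor
    · rintro _ ⟨f, rfl⟩
      obtain ⟨g, hg⟩ := (h U le_rfl).1 f
      exact ⟨g, hg.symm⟩
    · rintro i _ ⟨f, hf, rfl⟩
      obtain ⟨g, hg, hg'⟩ := (h U le_rfl).2 i f hf
      exact ⟨g, hg, hg'.symm⟩
  · rintro ⟨h1, h2⟩ V hV
    constructor
    · intro f
      obtain ⟨g, hg⟩ := mem_one_iff.mp (isQCoh_one.derivation_mem h1
        (fun c hc => mem_one_iff.mpr (h1 c (mem_one_iff.mp hc))) hV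
        (mem_one_iff.mpr (toK_mem_ring V f)))
      exact ⟨g, hg.symm⟩
    · intro i f hf
      obtain ⟨g, hg, hg'⟩ := (isQCoh_idealFamily (D i)).derivation_mem h1 (h2 i) hV
        (c := toK V f) ⟨f, hf, rfl⟩
      exact ⟨g, hg, hg'.symm⟩

theorem logT_mono {U V : AffOpen X} (h : V.op ≤ U.op)
    {δ : Derivation ℂ X.functionField X.functionField} (hδ : δ ∈ logT D U) : δ ∈ logT D V :=
  fun W hW => hδ W (hW.trans h)

omit [IsIntegral X] in
theorem exists_pow_forall {ι : Type*} [Finite ι] {p : ι → ℕ → Prop}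
    (hp : ∀ i n m, n ≤ m → p i n → p i m) (h : ∀ i, ∃ n, p i n) : ∃ n, ∀ i, p i n := by
  have := Fintype.ofFinite ι
  choose n hn using h
  exact ⟨Finset.univ.sup n, fun i => hp i _ _ (Finset.le_sup (Finset.mem_univ i)) (hn i)⟩

/-- A derivation is controlled by its values on finitely many algebra generators of `𝒪(U)` and
finitely many generators of the ideals, so only finitely many denominators must be cleared. -/
theorem exists_pow_smul_mem_logT (hproper : IsProper (X ↘ SpecC)) {U B : AffOpen X}
    {g : Γ(X, U.op)} (hB : B.op = X.basicOpen g)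
    {δ : Derivation ℂ X.functionField X.functionField} (hδ : δ ∈ logT D B) :
    ∃ m, ∀ m', m ≤ m' → toK U g ^ m' • δ ∈ logT D U := by
  have hBU := AffOpen.le_of_eq_basicOpen hB
  have := finiteType_sections hproper U
  have : IsNoetherianRing Γ(X, U.op) := Algebra.FiniteType.isNoetherianRing ℂ _
  obtain ⟨h1, h2⟩ := mem_logT_iff.mp hδ
  obtain ⟨s, hs⟩ := Algebra.FiniteType.out (R := ℂ) (A := Γ(X, U.op))
  choose t ht using fun i : Fin k => IsNoetherian.noetherian ((D i).ideal U.aff)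
  obtain ⟨m₁, hm₁⟩ := exists_pow_forall (ι := s)
    (p := fun f m => ∀ m', m ≤ m' → toK U g ^ m' • δ (toK U f) ∈ ring X U)
    (fun f a b hab h m' hm' => h m' (hab.trans hm')) fun f => by
      obtain ⟨m, hm⟩ := ring_basicOpen hB (h1 _ (ring_mono hBU (toK_mem_ring U f)))
      refine ⟨m, fun m' hm' => ?_⟩
      obtain ⟨d, rfl⟩ := Nat.exists_eq_add_of_le' hm'
      rw [smul_eq_mul, pow_add, mul_assoc]
      exact mul_mem (pow_mem (toK_mem_ring U g) d) hm
  obtain ⟨m₂, hm₂⟩ := exists_pow_forall (ι := Σ i, t i)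
    (p := fun f m => ∀ m', m ≤ m' → toK U g ^ m' • δ (toK U f.2.1) ∈ idealFamily (D f.1) U)
    (fun f a b hab h m' hm' => h m' (hab.trans hm')) fun ⟨i, f⟩ => by
      have hf : f.1 ∈ (D i).ideal U.aff := ht i ▸ Submodule.subset_span f.2
      obtain ⟨m, hm⟩ := (isQCoh_idealFamily (D i)).localized U B g hB _
        (h2 i _ ((isQCoh_idealFamily (D i)).mono hBU ⟨f.1, hf, rfl⟩))
      exact ⟨m, fun m' hm' => pow_smul_mem_of_le _ g hm' hm⟩
  refine ⟨max m₁ m₂, fun m hm => ?_⟩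
  have hring : ∀ c ∈ ring X U, (toK U g ^ m • δ) c ∈ ring X U := by
    rintro _ ⟨f, rfl⟩
    have hf : f ∈ Algebra.adjoin ℂ (s : Set Γ(X, U.op)) := hs ▸ trivial
    change (toK U g ^ m • δ) (toK U f) ∈ ring X U
    induction hf using Algebra.adjoin_induction with
    | mem f hf => exact hm₁ ⟨f, hf⟩ m ((le_max_left _ _).trans hm)
    | algebraMap c =>
      have : toK U (algebraMap ℂ Γ(X, U.op) c) = algebraMap ℂ X.functionField c :=
        (IsScalarTower.algebraMap_apply _ _ _ _).symm
      rw [this, Derivation.map_algebraMap]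
      exact zero_mem _
    | add a b _ _ ha hb =>
      rw [map_add, map_add]
      exact add_mem ha hb
    | mul a b _ _ ha hb =>
      rw [map_mul, Derivation.leibniz]
      exact add_mem (mul_mem (toK_mem_ring U a) hb) (mul_mem (toK_mem_ring U b) ha)
  refine mem_logT_iff.mpr ⟨hring, ?_⟩
  rintro i _ ⟨f, hf, rfl⟩
  rw [← ht i] at hf
  induction hf using Submodule.span_induction with
  | mem f hf => exact hm₂ ⟨i, f, hf⟩ m ((le_max_right _ _).trans hm)
  | zero =>
    rw [map_zero, map_zero]
    exact zero_mem _
  | add a b _ _ ha hb =>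
    rw [map_add, map_add]
    exact add_mem ha hb
  | smul a b hb ih =>
    rw [smul_eq_mul, map_mul, Derivation.leibniz]
    refine add_mem (smul_mem_of_mem_ring _ (toK_mem_ring U a) ih) ?_
    rw [smul_eq_mul, mul_comm]
    refine smul_mem_of_mem_ring _ (hring _ (toK_mem_ring U a)) ⟨b, ?_, rfl⟩
    rw [← ht i]
    exact hb

end LogVectorFields

theorem derivation_sum_apply {k K ι : Type*} [CommRing k] [CommRing K] [Algebra k K] (s : Finset ι)
    (d : ι → Derivation k K K) (x : K) : (∑ j ∈ s, d j) x = ∑ j ∈ s, d j x :=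
  (congrFun (map_sum Derivation.coeFnAddMonoidHom d s) x).trans (Finset.sum_apply _ _ _)

/-- The `d j` are the partial derivatives `∂/∂f_j` on `K`: the basis `d f_j` of differentials
extends to `K`, and they are its dual basis. -/
theorem exists_dual_derivations {k R K : Type} [Field k] [CommRing R] [IsDomain R] [Algebra k R]
    [Field K] [Algebra k K] [Algebra R K] [IsScalarTower k R K] [IsFractionRing R K] {n : ℕ}
    (b : Module.Basis (Fin n) R (Ω[R⁄k])) {f : Fin n → R}
    (hf : ∀ j, b j = KaehlerDifferential.D k R (f j)) :
    ∃ d : Fin n → Derivation k K K,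
      (∀ j a, d j (algebraMap R K a) = algebraMap R K (b.repr (KaehlerDifferential.D k R a) j)) ∧
      ∀ δ : Derivation k K K, δ = ∑ j, δ (algebraMap R K (f j)) • d j := by
  have : Algebra.FormallyEtale R K := Algebra.FormallyEtale.of_isLocalization (nonZeroDivisors R)
  let e := KaehlerDifferential.tensorKaehlerEquivOfFormallyEtale k R K
  let b' := (b.baseChange K).map e
  have he : ∀ a, e.symm (KaehlerDifferential.D k K (algebraMap R K a)) =
      1 ⊗ₜ KaehlerDifferential.D k R a :=
    KaehlerDifferential.tensorKaehlerEquivOfFormallyEtale_symm_D_algebraMap k R K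
  have hb' : ∀ j, b' j = KaehlerDifferential.D k K (algebraMap R K (f j)) := fun j => by
    rw [Module.Basis.map_apply, Module.Basis.baseChange_apply, hf, ← he,
      LinearEquiv.apply_symm_apply]
  refine ⟨fun j => (b'.coord j).compDer (KaehlerDifferential.D k K), fun j a => ?_, fun δ => ?_⟩
  · change (b.baseChange K).repr (e.symm _) j = _
    erw [he]
    rw [Module.Basis.baseChange_repr_tmul, ← Algebra.algebraMap_eq_smul_one]
  · have h : δ.liftKaehlerDifferential =
        ∑ j, δ (algebraMap R K (f j)) • b'.coord j := by
      refine b'.ext fun i => ?_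
      rw [hb', Derivation.liftKaehlerDifferential_comp_D, ← hb', LinearMap.sum_apply,
        Finset.sum_eq_single i]
      · rw [LinearMap.smul_apply, Module.Basis.coord_apply, Module.Basis.repr_self,
          Finsupp.single_eq_same, smul_eq_mul, mul_one]
      · intro j _ hj
        rw [LinearMap.smul_apply, Module.Basis.coord_apply, Module.Basis.repr_self,
          Finsupp.single_eq_of_ne hj, smul_zero]
      · exact fun hi => absurd (Finset.mem_univ i) hi
    refine Derivation.ext fun x => ?_
    have hx := LinearMap.congr_fun h (KaehlerDifferential.D k K x)
    rw [Derivation.liftKaehlerDifferential_comp_D] at hx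
    rw [hx, LinearMap.sum_apply, derivation_sum_apply]
    rfl

/-! ### Local frames and flatness of `T_X(-log D)` -/

section LogFrame

variable {X : Scheme.{0}} [IsIntegral X] [X.Over SpecC] {k n : ℕ} {D : Fin k → X.IdealSheafData}

theorem exists_logT_frame (hD : IsSNCArrangement n D) (x : X) :
    ∃ (W : AffOpen X) (e : Fin n → Derivation ℂ X.functionField X.functionField), x ∈ W.op ∧
      LinearIndependent X.functionField e ∧ (∀ j, e j ∈ logT D W) ∧
      ∀ δ ∈ logT D W, ∃ c : Fin n → Γ(X, W.op), δ = ∑ j, toK W (c j) • e j := by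
  classical
  obtain ⟨U, hxU, f, ⟨b, hb⟩, c, -, hc⟩ := hD.coordinates x
  let W : AffOpen X := ⟨U.1, U.2, ⟨⟨x, hxU⟩⟩⟩
  change Fin n → Γ(X, W.op) at f
  change Module.Basis (Fin n) Γ(X, W.op) (Ω[Γ(X, W.op)⁄ℂ]) at b
  change ∀ j, b j = KaehlerDifferential.D ℂ Γ(X, W.op) (f j) at hb
  replace hc : ∀ i, (x ∈ (D i).support → (D i).ideal W.aff = Ideal.span {f (c i)}) ∧
    (x ∉ (D i).support → (D i).ideal W.aff = ⊤) := hc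
  obtain ⟨d, hd, hδ⟩ := exists_dual_derivations (K := X.functionField) b hb
  change ∀ j a, d j (toK W a) = toK W _ at hd
  have hdf : ∀ i j, d j (toK W (f i)) = if j = i then 1 else 0 := fun i j => by
    rw [hd, ← hb, Module.Basis.repr_self, Finsupp.single_apply, apply_ite (toK W), map_one, map_zero]
    simp only [eq_comm]
  -- The frame is `u_j ∂_j`, where `u_j = f_j` if `f_j = 0` is a divisor through `x`, and `u_j = 1`
  -- otherwise.
  let u : Fin n → Γ(X, W.op) := fun j => if ∃ i, x ∈ (D i).support ∧ c i = j then f j else 1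
  have hu : ∀ j, toK W (u j) ≠ 0 := fun j => by
    refine (map_ne_zero_iff _ (toK_injective W)).mpr ?_
    by_cases h : ∃ i, x ∈ (D i).support ∧ c i = j
    · simp only [u, if_pos h]
      intro h0
      refine b.ne_zero j ?_
      rw [hb, h0, map_zero]
    · simp only [u, if_neg h]
      exact one_ne_zero
  have hdli : LinearIndependent X.functionField d := by
    rw [Fintype.linearIndependent_iff]
    intro a ha i
    have := congrArg (fun δ : Derivation ℂ X.functionField X.functionField => δ (toK W (f i))) ha
    simpa [derivation_sum_apply, hdf] using this
  have hideal : ∀ {i} {a : Γ(X, W.op)}, toK W a ∈ idealFamily (D i) W ↔ a ∈ (D i).ideal W.aff :=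
    fun {i a} => ⟨fun ⟨a', ha', h⟩ => toK_injective W h ▸ ha', fun h => ⟨a, h, rfl⟩⟩
  refine ⟨W, fun j => toK W (u j) • d j, hxU, ?_, fun j => ?_, fun δ h => ?_⟩
  · exact hdli.units_smul fun j => Units.mk0 _ (hu j)
  · refine mem_logT_iff.mpr ⟨?_, ?_⟩
    · rintro _ ⟨a, rfl⟩
      change toK W (u j) * d j (toK W a) ∈ _
      rw [hd]
      exact mul_mem (toK_mem_ring W _) (toK_mem_ring W _)
    · rintro i _ ⟨a, ha, rfl⟩
      rw [Derivation.smul_apply, hd, smul_eq_mul, ← map_mul, hideal]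
      by_cases hx : x ∈ (D i).support
      · rw [(hc i).1 hx] at ha ⊢
        obtain ⟨t, rfl⟩ := Ideal.mem_span_singleton'.mp ha
        rw [Ideal.mem_span_singleton, Derivation.leibniz, map_add, Finsupp.add_apply, mul_add,
          map_smul, map_smul, Finsupp.smul_apply, Finsupp.smul_apply, ← hb,
          Module.Basis.repr_self, smul_eq_mul, smul_eq_mul]
        refine dvd_add ?_ ?_
        · by_cases hj : c i = j
          · simp only [u, if_pos (show ∃ i, x ∈ (D i).support ∧ c i = j from ⟨i, hx, hj⟩), hj]
            exact dvd_mul_right _ _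
          · rw [Finsupp.single_eq_of_ne (Ne.symm hj), mul_zero, mul_zero]
            exact dvd_zero _
        · exact (dvd_mul_right _ _).mul_left _
      · rw [(hc i).2 hx]
        trivial
  · obtain ⟨h1, h2⟩ := mem_logT_iff.mp h
    -- Tangency to `f_j = 0` says that `f_j` divides `δ f_j`, so the coefficients of `δ = ∑ δ(f_j)
    -- ∂_j` are divisible by `u_j`.
    have hv : ∀ j, ∃ v : Γ(X, W.op), δ (toK W (f j)) = toK W v * toK W (u j) := fun j => by
      by_cases hj : ∃ i, x ∈ (D i).support ∧ c i = j
      · obtain ⟨i, hx, hi⟩ := hj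
        simp only [u, if_pos (show ∃ i, x ∈ (D i).support ∧ c i = j from ⟨i, hx, hi⟩)]
        obtain ⟨a, ha, ha'⟩ := h2 i (toK W (f j)) (hideal.mpr (by
          rw [(hc i).1 hx, hi]
          exact Ideal.mem_span_singleton_self _))
        rw [(hc i).1 hx, hi] at ha
        obtain ⟨t, rfl⟩ := Ideal.mem_span_singleton'.mp ha
        exact ⟨t, by rw [← ha', map_mul]⟩
      · obtain ⟨v, hv⟩ := h1 _ (toK_mem_ring W (f j))
        refine ⟨v, ?_⟩
        simp only [u, if_neg hj]
        rw [map_one, mul_one]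
        exact hv.symm
    choose v hv using hv
    refine ⟨v, ?_⟩
    conv_lhs => rw [hδ δ]
    refine Finset.sum_congr rfl fun j _ => ?_
    rw [smul_smul, ← hv]

theorem smul_derivation_eq {U : AffOpen X} (a : Γ(X, U.op))
    (δ : Derivation ℂ X.functionField X.functionField) : a • δ = toK U a • δ :=
  Derivation.ext fun x => by
    rw [Derivation.smul_apply, Derivation.smul_apply, Algebra.smul_def, smul_eq_mul]

/-- Near each point the logarithmic frame, multiplied by a power of some `s ∈ 𝒪(U)`, consists of
fields on all of `U`. It embeds `𝒪(U)^n` in the module with cokernel killed by powers of `s`, and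
the `D(s)` cover `U`. -/
theorem flat_logT (hproper : IsProper (X ↘ SpecC)) (hD : IsSNCArrangement n D) (U : AffOpen X) :
    Module.Flat Γ(X, U.op) (logT D U) := by
  let P : Γ(X, U.op) → Prop := fun s => ∃ g : (Fin n → Γ(X, U.op)) →ₗ[Γ(X, U.op)] logT D U,
    Function.Injective g ∧ ∀ t, ∃ (k : ℕ) (p : Fin n → Γ(X, U.op)), g p = s ^ k • t
  have hP : ∀ x ∈ U.op, ∃ s, P s ∧ x ∈ X.basicOpen s := by
    intro x hx
    obtain ⟨W, e, hxW, he, heW, hW⟩ := exists_logT_frame hD x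
    obtain ⟨B, s, s', hs, hs', hxB⟩ := U.exists_common_basicOpen W x hx hxW
    refine ⟨s, ?_, hs ▸ hxB⟩
    have hs0 := toK_ne_zero hs
    obtain ⟨m, hm⟩ := exists_pow_forall (p := fun j m => ∀ m', m ≤ m' → toK U s ^ m' • e j ∈ logT D U)
      (fun j a b hab h m' hm' => h m' (hab.trans hm'))
      fun j => exists_pow_smul_mem_logT hproper hs
        (logT_mono (AffOpen.le_of_eq_basicOpen hs') (heW j))
    let e' : Fin n → logT D U := fun j => ⟨_, hm j m le_rfl⟩
    have hcoe : ∀ p : Fin n → Γ(X, U.op), ((∑ j, p j • e' j : logT D U) :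
        Derivation ℂ X.functionField X.functionField) =
          ∑ j, (toK U (p j) * toK U s ^ m) • e j := fun p => by
      rw [AddSubmonoidClass.coe_finsetSum]
      refine Finset.sum_congr rfl fun j _ => ?_
      rw [Submodule.coe_smul, smul_derivation_eq, smul_smul]
    refine ⟨Fintype.linearCombination Γ(X, U.op) e', ?_, fun t => ?_⟩
    · rw [← LinearMap.ker_eq_bot, LinearMap.ker_eq_bot']
      intro p hp
      rw [Fintype.linearCombination_apply] at hp
      have h := congrArg Subtype.val hp
      rw [hcoe] at h
      refine funext fun j => toK_injective U ?_
      have := Fintype.linearIndependent_iff.mp he _ h j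
      rw [Pi.zero_apply, map_zero]
      exact (mul_eq_zero.mp this).resolve_right (pow_ne_zero _ hs0)
    -- Clear the denominators of `t` on the side of `W` to expand it in the frame. The coefficients
    -- then lie in `𝒪(B)`, and a power of `s` brings them into `𝒪(U)`.
    · obtain ⟨a, ha⟩ := exists_pow_smul_mem_logT hproper hs'
        (logT_mono (AffOpen.le_of_eq_basicOpen hs) t.2)
      obtain ⟨c, hc⟩ := hW _ (ha a le_rfl)
      have hc' : ∀ j, (toK W s')⁻¹ ^ a * toK W (c j) ∈ ring X B := fun j =>
        mul_mem (pow_mem (inv_toK_mem_ring hs') a)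
          (ring_mono (AffOpen.le_of_eq_basicOpen hs') (toK_mem_ring W (c j)))
      obtain ⟨l, hl⟩ := exists_pow_forall
        (p := fun j l => ∃ v : Γ(X, U.op),
          toK U v = toK U s ^ l * ((toK W s')⁻¹ ^ a * toK W (c j)))
        (fun j l l' hl h => by
          obtain ⟨v, hv⟩ := h
          obtain ⟨d, rfl⟩ := Nat.exists_eq_add_of_le hl
          exact ⟨s ^ d * v, by rw [map_mul, map_pow, hv, pow_add]; ring⟩)
        fun j => by
          obtain ⟨l, v, hv⟩ := ring_basicOpen hs (hc' j)
          exact ⟨l, v, hv⟩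
      choose v hv using hl
      refine ⟨m + l, v, Subtype.ext ?_⟩
      rw [Fintype.linearCombination_apply, hcoe, Submodule.coe_smul, smul_derivation_eq]
      have h0 : (toK W s')⁻¹ ^ a * toK W s' ^ a = 1 := by
        rw [← mul_pow, inv_mul_cancel₀ (toK_ne_zero hs'), one_pow]
      have ht : (t : Derivation ℂ X.functionField X.functionField) =
          ∑ j, ((toK W s')⁻¹ ^ a * toK W (c j)) • e j := by
        rw [← one_smul X.functionField (t : Derivation ℂ X.functionField X.functionField), ← h0,
          mul_smul, hc, Finset.smul_sum]
        exact Finset.sum_congr rfl fun j _ => smul_smul _ _ _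
      rw [ht, Finset.smul_sum]
      refine Finset.sum_congr rfl fun j _ => ?_
      rw [hv, smul_smul, map_pow, pow_add]
      congr 1
      ring
  refine flat_of_span_eq_top n (G := {s | P s}) ?_ fun s hs => hs
  rw [← U.isAffine.self_le_iSup_basicOpen_iff]
  intro x hx
  obtain ⟨s, hs, hxs⟩ := hP x hx
  exact TopologicalSpace.Opens.mem_iSup.mpr ⟨⟨s, hs⟩, hxs⟩

end LogFrame

/-- The range is the kernel of the map to `(E ⧸ N) ⊗ T`. Multiplication by `q` is injective on `E ⧸
N`, and stays so after tensoring with the flat module `T`. -/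
theorem mem_range_rTensor_of_smul_mem {R E T : Type*} [CommRing R] [AddCommGroup E] [Module R E]
    [AddCommGroup T] [Module R T] [Module.Flat R T] {N : Submodule R E} {q : R}
    (hq : ∀ s : E, q • s ∈ N → s ∈ N) {z : E ⊗[R] T}
    (hz : q • z ∈ LinearMap.range (LinearMap.rTensor T N.subtype)) :
    z ∈ LinearMap.range (LinearMap.rTensor T N.subtype) := by
  have hex : Function.Exact (LinearMap.rTensor T N.subtype) (LinearMap.rTensor T N.mkQ) :=
    rTensor_exact T (LinearMap.exact_subtype_mkQ N) N.mkQ_surjective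
  have hinj : Function.Injective (LinearMap.lsmul R (E ⧸ N) q) := by
    rw [← LinearMap.ker_eq_bot, LinearMap.ker_eq_bot']
    intro s hs
    obtain ⟨s, rfl⟩ := N.mkQ_surjective s
    rw [LinearMap.lsmul_apply, ← map_smul, Submodule.mkQ_apply, Submodule.Quotient.mk_eq_zero] at hs
    rw [Submodule.mkQ_apply, Submodule.Quotient.mk_eq_zero]
    exact hq s hs
  have h1 := Module.Flat.rTensor_preserves_injective_linearMap (M := T) _ hinj
  have h2 : LinearMap.rTensor T (LinearMap.lsmul R (E ⧸ N) q) =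
      LinearMap.lsmul R ((E ⧸ N) ⊗[R] T) q := TensorProduct.ext' fun _ _ => rfl
  refine (hex z).mp (h1 ?_)
  rw [h2, map_zero, LinearMap.lsmul_apply, ← map_smul]
  exact (hex _).mpr hz

/-! ### Invariant saturations and the two ranges of `α` -/

section Final

variable {X : Scheme.{0}} [IsIntegral X] [X.Over SpecC] {k n r : ℕ} {D : Fin k → X.IdealSheafData}
  {E H : X.Modules}

theorem le_saturation_of_rank_eq (hE : IsLocallyFreeOfRank E r) {F G : SubmoduleFamily E}
    (hFG : F ≤ G) (hrank : rank F = rank G) : G ≤ saturation F := by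
  have := (finite_genericFibre hE).1
  have h := Submodule.eq_of_le_of_finrank_eq (genericSpan_mono hFG) hrank
  intro U s hs
  rw [mem_saturation, h]
  exact germ_mem_genericSpan hs

/-- A section `s` of the saturation has a multiple `q s` in `F`, so `q Φ(s) = Φ(q s)` lies in `G ⊗
T`, hence in the saturation tensored with `T`. Torsion-freeness and flatness remove the factor `q`.
-/
theorem mapsInto_saturation (hproper : IsProper (X ↘ SpecC)) (hD : IsSNCArrangement n D)
    (hE : IsLocallyFreeOfRank E r) {Φ : LogCoHiggsField D E} {F G : SubmoduleFamily E}
    (hF : IsCoherentSubsheaf F) (hFG : F ≤ G) (hrank : rank F = rank G) (h : MapsInto Φ F G) :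
    MapsInto Φ (saturation F) (saturation F) := by
  rintro U _ ⟨s, hs, rfl⟩
  have := flat_logT hproper hD U
  obtain ⟨q, hq, t, ht, hqs⟩ := exists_smul_mem ((isCoherentSubsheaf_iff hE F).mp hF) U hs
  rw [← germ_smul] at hqs
  have hts := germ_injective hE U hqs
  have hG := le_saturation_of_rank_eq hE hFG hrank
  refine mem_range_rTensor_of_smul_mem (q := q) (fun s hs => ?_) ?_
  · rw [mem_saturation, germ_smul] at hs
    exact (Submodule.smul_mem_iff (genericSpan F) ((map_ne_zero_iff _ (toK_injective U)).mpr hq)).mp hs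
  · rw [← map_smul, ← hts]
    obtain ⟨z, hz⟩ := h U ⟨t, ht, rfl⟩
    refine ⟨LinearMap.rTensor (logT D U) (Submodule.inclusion (hG U)) z, ?_⟩
    rw [← hz, ← LinearMap.comp_apply, ← LinearMap.rTensor_comp]
    rfl

theorem muAlpha_top (hE : IsLocallyFreeOfRank E r) (hr : 0 < r) (α : ℝ) :
    muAlpha n H α ⊤ (⊤ : SubmoduleFamily E) = slope n H (⊤ : SubmoduleFamily E) + α := by
  rw [muAlpha, rank_top hE, div_self (Nat.cast_ne_zero.mpr hr.ne'), mul_one]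

theorem mapsInto_top (Φ : LogCoHiggsField D E) (F : SubmoduleFamily E) : MapsInto Φ F ⊤ := by
  intro U z _
  have : Function.Surjective (LinearMap.rTensor (logT D U) ((⊤ : SubmoduleFamily E) U).subtype) :=
    LinearMap.rTensor_surjective _ fun s => ⟨⟨s, trivial⟩, rfl⟩
  exact this z

/-- A destabilizing subsheaf `F` of `E` destabilizes the pair for small parameters. -/
theorem not_isMuSemistable (hE : IsLocallyFreeOfRank E r) (Φ : LogCoHiggsField D E)
    {F : SubmoduleFamily E} (hF : IsCoherentSubsheaf F) (hbot : F ≠ ⊥) (htop : F ≠ ⊤) {α : ℝ}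
    (h0 : 0 ≤ α) (hα : α < slope n H F - slope n H (⊤ : SubmoduleFamily E)) :
    ¬ IsMuSemistable n H Φ α := by
  intro h
  have hr : 0 < r := by
    rw [← rank_top hE]
    exact (rank_pos hE hbot).trans_le (rank_le hE le_top)
  have h1 := h (F, ⊤) ⟨hF, isCoherentSubsheaf_top hE, hbot, le_top, mapsInto_top Φ F⟩
    fun h => htop (congrArg Prod.fst h)
  rw [muAlpha_top hE hr, muAlpha] at h1
  have h2 : 0 ≤ α * ((rank F : ℝ) / (rank (⊤ : SubmoduleFamily E) : ℝ)) := by positivity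
  linarith

theorem slope_le_of_isCoHiggsSemistable (hproper : IsProper (X ↘ SpecC)) (hH : IsLineBundle H)
    (hample : IsAmple H) (hn : 1 ≤ n) (hD : IsSNCArrangement n D) (hE : IsLocallyFreeOfRank E r)
    {Φ : LogCoHiggsField D E} (hss : IsCoHiggsSemistable n H Φ) {F G : SubmoduleFamily E}
    (hF : IsCoherentSubsheaf F) (hbot : F ≠ ⊥) (hFG : F ≤ G) (hrank : rank F = rank G)
    (hΦ : MapsInto Φ F G) : slope n H F ≤ slope n H (⊤ : SubmoduleFamily E) := by
  have h1 : slope n H F ≤ slope n H (saturation F) := by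
    unfold slope
    rw [rank_saturation]
    exact div_le_div_of_nonneg_right (degree_le_of_rank_eq hproper hH hample hn hD hE hF
      (le_saturation F) (rank_saturation F).symm) (Nat.cast_nonneg _)
  -- Semistability speaks only of proper subsheaves; a saturation equal to `E` needs nothing
  -- further.
  by_cases h : saturation F = ⊤
  · rwa [h] at h1
  · exact h1.trans (hss _ (isCoherentSubsheaf_saturation hE F)
      (fun h => hbot (eq_bot_iff.mpr (h ▸ le_saturation F))) h
      (mapsInto_saturation hproper hD hE hF hFG hrank hΦ))

theorem exists_isMuSemistable (hproper : IsProper (X ↘ SpecC)) (hH : IsLineBundle H)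
    (hample : IsAmple H) (hn : 1 ≤ n) (hD : IsSNCArrangement n D) (hE : IsLocallyFreeOfRank E r)
    {Φ : LogCoHiggsField D E} (hss : IsCoHiggsSemistable n H Φ) :
    ∃ γ : ℝ, 0 < γ ∧ ∀ α, γ < α → IsMuSemistable n H Φ α := by
  obtain ⟨C, hC0, hC⟩ := exists_degree_le hproper hH hample hn hD hE
  let μ := slope n H (⊤ : SubmoduleFamily E)
  -- Beyond `r (C - μ)` the loss `α / r` outweighs the largest possible gain in slope `C - μ`; the
  -- `1` keeps the bound positive.
  refine ⟨max 1 (r * (C - μ)), lt_max_of_lt_left one_pos, ?_⟩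
  rintro α hα ⟨F, G⟩ ⟨hF, -, hbot, hFG, hΦ⟩ -
  change F ≤ G at hFG
  change F ≠ ⊥ at hbot
  have hFpos := rank_pos hE hbot
  have hFG' := rank_le hE hFG
  have hGr : rank G ≤ r := (rank_le hE le_top).trans (rank_top hE).le
  have hr : 0 < r := hFpos.trans_le (hFG'.trans hGr)
  have hGpos : (0 : ℝ) < rank G := by exact_mod_cast hFpos.trans_le hFG'
  rw [muAlpha_top hE hr]
  change slope n H F + α * ((rank F : ℝ) / (rank G : ℝ)) ≤ μ + α
  rcases hFG'.eq_or_lt with hrank | hrank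
  · rw [hrank, div_self hGpos.ne', mul_one]
    exact add_le_add_left
      (slope_le_of_isCoHiggsSemistable hproper hH hample hn hD hE hss hF hbot hFG hrank hΦ) α
  -- Dividing by a rank at least `1` preserves the bound because `C ≥ 0`.
  · have h1 : slope n H F ≤ C := by
      unfold slope
      rw [div_le_iff₀ (by exact_mod_cast hFpos)]
      refine (hC F hF).trans (le_mul_of_one_le_right hC0 ?_)
      exact_mod_cast hFpos
    have hα0 : 0 < α := one_pos.trans (lt_of_le_of_lt (le_max_left _ _) hα)
    -- Ranks are integers, so the gap is at least `1 / rank G ≥ 1 / r`.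
    have h2 : (rank F : ℝ) / (rank G : ℝ) ≤ 1 - 1 / r := by
      have h3 : (rank F : ℝ) + 1 ≤ rank G := by exact_mod_cast hrank
      have h4 : 1 / (r : ℝ) ≤ 1 / rank G := one_div_le_one_div_of_le hGpos (by exact_mod_cast hGr)
      have h5 : (rank F : ℝ) / rank G ≤ (rank G - 1) / rank G := by
        gcongr
        linarith
      rw [sub_div, div_self hGpos.ne'] at h5
      linarith
    have h3 : C - μ ≤ α * (1 / r) := by
      rw [mul_one_div, le_div_iff₀ (by exact_mod_cast hr), mul_comm]
      exact (le_max_right _ _).trans hα.le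
    have h4 := mul_le_mul_of_nonneg_left h2 hα0.le
    rw [mul_sub, mul_one] at h4
    linarith

end Final

end LogCoHiggs

theorem proposition7p3
    (X : Scheme.{0}) [X.Over LogCoHiggs.SpecC] [IsIntegral X]
    (n : ℕ) (hn : 1 ≤ n)
    (hproper : IsProper (X ↘ LogCoHiggs.SpecC))
    (hsmooth : SmoothOfRelativeDimension n (X ↘ LogCoHiggs.SpecC))
    (H : X.Modules) (hH : LogCoHiggs.IsLineBundle H) (hample : LogCoHiggs.IsAmple H)
    (k : ℕ) (D : Fin k → X.IdealSheafData) (hD : LogCoHiggs.IsSNCArrangement n D)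
    (E : X.Modules) (hE : LogCoHiggs.IsVectorBundle E)
    (Φ : LogCoHiggs.LogCoHiggsField D E)
    (hns : ¬ LogCoHiggs.IsSemistable n H E) :
    ∃ β γ : ℝ, 0 < β ∧ 0 < γ ∧
      (∀ α : ℝ, 0 ≤ α → α < β → ¬ LogCoHiggs.IsMuSemistable n H Φ α) ∧
      (LogCoHiggs.IsCoHiggsSemistable n H Φ →
        ∀ α : ℝ, γ < α → LogCoHiggs.IsMuSemistable n H Φ α) := by
  obtain ⟨r, hE⟩ := hE
  rw [LogCoHiggs.IsSemistable] at hns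
  push Not at hns
  obtain ⟨F, hF, hbot, htop, hslope⟩ := hns
  -- `γ` must be exhibited even when `(E, Φ)` is not semistable; the second claim is then vacuous
  -- and `1` serves.
  by_cases hss : LogCoHiggs.IsCoHiggsSemistable n H Φ
  · obtain ⟨γ, hγ, h⟩ := LogCoHiggs.exists_isMuSemistable hproper hH hample hn hD hE hss
    exact ⟨_, γ, sub_pos.mpr hslope, hγ,
      fun _ h0 hα => LogCoHiggs.not_isMuSemistable hE Φ hF hbot htop h0 hα, fun _ => h⟩
  · exact ⟨_, 1, sub_pos.mpr hslope, one_pos,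
      fun _ h0 hα => LogCoHiggs.not_isMuSemistable hE Φ hF hbot htop h0 hα, fun h => absurd h hss⟩
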